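/- Let $G=(V,E)$ be a finite, simple, undirected, connected graph with $n\ge 1$ vertices and $m$ edges, and let $\mathrm{dist}(u,v)$ denote the length of a shortest path between $u$ and $v$. The eccentricity of a vertex $v$ is $e(v)=\max_{u\in V}\mathrm{dist}(u,v)$, the radius of $G$ is $\mathrm{rad}(G)=\min_{v\in V}e(v)$, and the center of $G$ is $C(G)=\{v\in V : e(v)=\mathrm{rad}(G)\}$. The graph $G$ is Helly if every family of pairwise intersecting balls $N^r[v]=\{u\in V : \mathrm{dist}(u,v)\le r\}$ ($v \in V$, $r\in\mathbb{N}$) has a common vertex, and $C_4$-free if it has no induced cycle on four vertices. Theorem. The eccentricities of all vertices of a $C_4$-free Helly graph can be computed in linear time, and so can its center. That is, there is a deterministic algorithm (a single program on a word RAM with words of $O(\log (n+m+2))$ bits, where each elementary operation takes unit time) which, given the adjacency lists of any connected $C_4$-free Helly graph $G$ on the vertex set $\{0,\dots,n-1\}$, with the lists in an arbitrary order, outputs $e(v)$ for all $v\in V$ after $O(n+m)$ steps; and there is such an algorithm which outputs the center $C(G)$, as its indicator function on $V$, after $O(n+m)$ steps. -/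

import Mathlib

/-! ### Graph classes -/

namespace SimpleGraph

variable {V : Type*}

/-- The closed ball of radius `r` around `v`. The extended distance is `⊤` between vertices in
different components, so no junk value enters here. -/
def closedNbhd (G : SimpleGraph V) (v : V) (r : ℕ) : Set V :=
  {u | G.edist v u ≤ r}

/-- A graph is Helly if every family of pairwise intersecting closed balls has a common point. -/
def IsHelly (G : SimpleGraph V) : Prop :=
  ∀ F : Set (V × ℕ),
    (∀ p ∈ F, ∀ q ∈ F, (G.closedNbhd p.1 p.2 ∩ G.closedNbhd q.1 q.2).Nonempty) →
      (⋂ p ∈ F, G.closedNbhd p.1 p.2).Nonempty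

/-- `C₄`-free: no *induced* cycle on four vertices. -/
def IsC4Free (G : SimpleGraph V) : Prop :=
  ¬ (cycleGraph 4).IsIndContained G

end SimpleGraph

/-! ### The machine model: a word RAM, programmed in a structured language

A program uses finitely many scalar registers and finitely many arrays, both named by natural
numbers, and every register and every array cell holds one machine word, i.e. a natural number
below a bound `B`. Every value that is read or computed has to be below `B`; a program that
violates this is stuck. Each elementary operation costs one time step. -/

namespace WordRAM

/-- The contents of the registers and of the arrays. -/
structure Store where
  reg : ℕ → ℕ
  arr : ℕ → ℕ → ℕ

/-- `s.setReg x v` writes `v` into register `x`. -/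
def Store.setReg (s : Store) (x v : ℕ) : Store :=
  { s with reg := fun y => if y = x then v else s.reg y }

/-- `s.setArr a i v` writes `v` into cell `i` of array `a`. -/
def Store.setArr (s : Store) (a i v : ℕ) : Store :=
  { s with arr := fun b j => if b = a ∧ j = i then v else s.arr b j }

/-- The binary word operations. -/
inductive BinOp where
  | plus | minus | times | quot | less | equal

/-- Subtraction is truncated at `0`, division rounds down (and yields `0` for divisor `0`);
comparisons return `1` for true and `0` for false. -/
def BinOp.apply : BinOp → ℕ → ℕ → ℕ
  | .plus, x, y => x + y
  | .minus, x, y => x - y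
  | .times, x, y => x * y
  | .quot, x, y => x / y
  | .less, x, y => if x < y then 1 else 0
  | .equal, x, y => if x = y then 1 else 0

/-- Expressions: constants, registers, array cells, and binary operations. -/
inductive Expr where
  | const (k : ℕ)
  | reg (x : ℕ)
  | cell (a : ℕ) (i : Expr)
  | bin (o : BinOp) (e f : Expr)

/-- The number of elementary operations in the evaluation of an expression. -/
def Expr.cost : Expr → ℕ
  | .const _ => 1
  | .reg _ => 1
  | .cell _ i => i.cost + 1
  | .bin _ e f => e.cost + f.cost + 1

/-- `word B v` is `v` if it fits into a machine word, and fails otherwise. -/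
def word (B v : ℕ) : Option ℕ :=
  if v < B then some v else none

/-- The value of an expression, undefined if some value on the way does not fit into a word. -/
def Expr.eval (B : ℕ) (s : Store) : Expr → Option ℕ
  | .const k => word B k
  | .reg x => word B (s.reg x)
  | .cell a i => (i.eval B s).bind fun j => word B (s.arr a j)
  | .bin o e f => (e.eval B s).bind fun x => (f.eval B s).bind fun y => word B (o.apply x y)

/-- Programs. In `ite` and `loop` the condition counts as true if its value is not `0`. -/
inductive Prog where
  | nop
  | assign (x : ℕ) (e : Expr)
  | put (a : ℕ) (i e : Expr)
  | seq (p q : Prog)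
  | ite (e : Expr) (p q : Prog)
  | loop (e : Expr) (p : Prog)

/-- `Runs B p s t s'`: with words below `B`, the program `p` started in `s` halts in `s'` after
exactly `t` elementary steps. -/
inductive Runs (B : ℕ) : Prog → Store → ℕ → Store → Prop
  | nop (s : Store) : Runs B .nop s 1 s
  | assign (s : Store) (x : ℕ) (e : Expr) (v : ℕ) (he : e.eval B s = some v) :
      Runs B (.assign x e) s (e.cost + 1) (s.setReg x v)
  | put (s : Store) (a : ℕ) (i e : Expr) (j v : ℕ)
      (hi : i.eval B s = some j) (he : e.eval B s = some v) :
      Runs B (.put a i e) s (i.cost + e.cost + 1) (s.setArr a j v)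
  | seq (p q : Prog) (s s' s'' : Store) (t t' : ℕ)
      (hp : Runs B p s t s') (hq : Runs B q s' t' s'') :
      Runs B (.seq p q) s (t + t') s''
  | ite_true (e : Expr) (p q : Prog) (s s' : Store) (v t : ℕ)
      (he : e.eval B s = some v) (hv : v ≠ 0) (hp : Runs B p s t s') :
      Runs B (.ite e p q) s (e.cost + 1 + t) s'
  | ite_false (e : Expr) (p q : Prog) (s s' : Store) (t : ℕ)
      (he : e.eval B s = some 0) (hq : Runs B q s t s') :
      Runs B (.ite e p q) s (e.cost + 1 + t) s'
  | loop_true (e : Expr) (p : Prog) (s s' s'' : Store) (v t t' : ℕ)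
      (he : e.eval B s = some v) (hv : v ≠ 0)
      (hp : Runs B p s t s') (hl : Runs B (.loop e p) s' t' s'') :
      Runs B (.loop e p) s (e.cost + 1 + t + t') s''
  | loop_false (e : Expr) (p : Prog) (s : Store) (he : e.eval B s = some 0) :
      Runs B (.loop e p) s (e.cost + 1) s

/-- `L` lists, for every vertex, its neighbours, each exactly once and in an arbitrary order. -/
def IsAdjLists {n : ℕ} (G : SimpleGraph (Fin n)) (L : Fin n → List (Fin n)) : Prop :=
  ∀ v, (L v).Nodup ∧ ∀ u, u ∈ L v ↔ G.Adj v u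

/-- The position at which the list of vertex `i` starts in the concatenation of all lists. -/
def listStart {n : ℕ} (L : Fin n → List (Fin n)) (i : ℕ) : ℕ :=
  ((List.ofFn L).take i).flatten.length

/-- The store that holds the adjacency lists `L` and nothing else: register `0` holds the number
`n` of vertices, cells `0, …, n` of array `0` hold the starting positions of the lists (cell `n`
their total length), array `1` holds the concatenation of the lists; all the rest is `0`. -/
def inputStore {n : ℕ} (L : Fin n → List (Fin n)) : Store where
  reg x := if x = 0 then n else 0
  arr a i :=
    if a = 0 then (if i ≤ n then listStart L i else 0)
    else if a = 1 then ((List.ofFn L).flatten.map Fin.val).getD i 0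
    else 0

/-- `f`, a number for every vertex of every finite graph, is computable in linear time on the
graphs that satisfy `C`: one program, given any adjacency-list representation of a graph in the
class with `n` vertices and `m` edges, on words of at most `k log₂ (n + m + 2)` bits, halts after
at most `c (n + m)` steps, with the value at `v` in cell `v` of array `2`. -/
def LinearTimeOn (C : ∀ n : ℕ, SimpleGraph (Fin n) → Prop)
    (f : ∀ n : ℕ, SimpleGraph (Fin n) → Fin n → ℕ∞) : Prop :=
  ∃ (p : Prog) (c k : ℕ), ∀ (n : ℕ) (G : SimpleGraph (Fin n)), C n G →
    ∀ L : Fin n → List (Fin n), IsAdjLists G L →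
      ∃ (t : ℕ) (s : Store),
        Runs ((n + G.edgeSet.ncard + 2) ^ k) p (inputStore L) t s ∧
        t ≤ c * (n + G.edgeSet.ncard) ∧
        ∀ v : Fin n, (s.arr 2 v : ℕ∞) = f n G v

end WordRAM

/-! ### Metric consequences of the Helly property; cliques and central vertices -/

namespace SimpleGraph

variable {V : Type*} {G : SimpleGraph V}

/-! In a connected graph two balls meet as soon as the distance of their centers is at most the sum
of their radii, so the Helly property is a tool for constructing vertices: any family of pairwise
compatible distance bounds is realised by one vertex (`IsHelly.exists_common`). Write `r` for the
radius. Adding a ball around `v` to the family of all balls of radius `r` shows that the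
eccentricity of `v` is `r` plus the distance from `v` to the center (`IsDistTo.eccLe_iff`). One
breadth-first search from the center therefore yields all eccentricities, and the task is to find
`r` and the center.

If there is no induced four-cycle, the vertices at given distances on the geodesics between two
fixed vertices form a clique (`IsHelly.slice_adj`). Not all eccentricities are at most `2r - 2`,
since otherwise the balls of radius `r - 1` would have a common point. Let `u` have eccentricity at
least `2r - 1`. Every central vertex equals or is adjacent to a central vertex at distance at most
`e(u) - r` from `u`, and the latter form a clique `A`, because they lie in one slice. Hence the
center has diameter at most three, and a vertex farthest from an arbitrary vertex has eccentricity
between `2r - 3` and `2r`. This leaves two candidates for `r`.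

Distances to a set `S` of diameter at most two are encoded by gates: every vertex `z` outside `S`
has a gate next to `S` whose neighbours in `S` are exactly the vertices of `S` closest to `z`. In a
clique, central vertices are recognised by counting adjacent gates, which decides between the two
candidates for `r` and finds a central vertex `c`. A vertex `u` as above comes from one more
extremal choice (`IsHelly.not_eccLe_of_extremal`): among the central neighbours of `c` in a slice,
one that sees the most gates has only vertices of eccentricity at least `2r - 1` at distance `r`.

The full center is cut out by two filters (`IsHelly.eccLe_iff_passesFilter`), one for `A` and one
for the closed neighbourhood of a vertex of `A`. A filter for `S` concerns the vertices at distance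
`r - 1` from `S`. For each of their gates `h` let `s h` be a neighbour of `h` in `S` that sees the
most gates. A vertex `x` passes if, for every `h`, some vertex of `S` within distance one of `x`
sees the same gates as `s h`. Passing brings these vertices within distance `r` of `x`; conversely
the Helly property produces for a central `x` a vertex of `S` seeing at least what `s h` sees, and
maximality forces equality. Only the classes of vertices of `S` with equal gate neighbourhoods
matter, so partition refinement and counting of classes evaluate a filter in linear time.

On the machine side, the algorithm is written with loops over vertices and over neighbour lists.
These are compiled to the word RAM, time is charged to degrees, and every step increases the largest
word by a bounded amount only, so that words of logarithmic length suffice (`Exec.runs`,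
`Cmd.implements`, `linearTimeOn_of_cmd`). -/

theorem IsC4Free.adj_or_adj (h : G.IsC4Free) {x p y q : V} (hxp : G.Adj x p) (hpy : G.Adj p y)
    (hyq : G.Adj y q) (hqx : G.Adj q x) (hxy : x ≠ y) (hpq : p ≠ q) : G.Adj x y ∨ G.Adj p q := by
  by_contra hcon
  push Not at hcon
  obtain ⟨h1, h2⟩ := hcon
  refine h ⟨⟨⟨![x, p, y, q], ?_⟩, ?_⟩⟩
  · intro i j hij
    fin_cases i <;> fin_cases j <;> simp at hij ⊢
    all_goals first
      | exact absurd hij (by first | exact hxp.ne | exact hpy.ne | exact hyq.ne | exact hqx.ne)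
      | exact absurd hij.symm (by first | exact hxp.ne | exact hpy.ne | exact hyq.ne | exact hqx.ne)
      | exact absurd hij hxy
      | exact absurd hij.symm hxy
      | exact absurd hij hpq
      | exact absurd hij.symm hpq
  · intro i j
    have hcyc : ∀ i j : Fin 4, (cycleGraph 4).Adj i j ↔ (i + 1 = j ∨ j + 1 = i) := by decide
    rw [hcyc]
    change G.Adj (![x, p, y, q] i) (![x, p, y, q] j) ↔ _
    have hyx : ¬ G.Adj y x := fun h => h1 h.symm
    have hqp : ¬ G.Adj q p := fun h => h2 h.symm
    fin_cases i <;> fin_cases j <;>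
      simp [hxp, hpy, hyq, hqx, hxp.symm, hpy.symm, hyq.symm, hqx.symm, h1, h2, hyx, hqp]

/-- A vertex on a shortest path. -/
theorem Connected.exists_dist_le (hc : G.Connected) {u v : V} {a b : ℕ}
    (h : G.dist u v ≤ a + b) : ∃ x, G.dist u x ≤ a ∧ G.dist v x ≤ b := by
  obtain ⟨p, hp⟩ := hc.exists_walk_length_eq_dist u v
  refine ⟨p.getVert a, ?_, ?_⟩
  · exact (dist_le (p.take a)).trans (by simp [Walk.take_length])
  · rw [dist_comm]
    refine (dist_le (p.drop a)).trans ?_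
    rw [Walk.drop_length]; omega

theorem Connected.dist_le_one_iff (hc : G.Connected) {u v : V} :
    G.dist u v ≤ 1 ↔ u = v ∨ G.Adj u v := by
  constructor
  · intro h
    rcases Nat.le_one_iff_eq_zero_or_eq_one.1 h with h | h
    · exact Or.inl (hc.dist_eq_zero_iff.1 h)
    · exact Or.inr (dist_eq_one_iff_adj.1 h)
  · rintro (rfl | h)
    · simp
    · exact (dist_eq_one_iff_adj.2 h).le

/-- A vertex at the right place of a shortest path lies in both of two balls, so inequalities
between distances and radii can replace nonempty intersections. This is the form in which the Helly
property is applied. -/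
theorem IsHelly.exists_common (hh : G.IsHelly) (hc : G.Connected) (F : Set (V × ℕ))
    (h : ∀ p ∈ F, ∀ q ∈ F, G.dist p.1 q.1 ≤ p.2 + q.2) :
    ∃ x, ∀ p ∈ F, G.dist p.1 x ≤ p.2 := by
  have key : ∀ (v x : V) (r : ℕ), x ∈ G.closedNbhd v r ↔ G.dist v x ≤ r := by
    intro v x r
    rw [closedNbhd, Set.mem_ofPred_eq, ← (hc.preconnected v x).coe_dist_eq_edist]
    exact Nat.cast_le
  obtain ⟨x, hx⟩ := hh F (by
    intro p hp q hq
    obtain ⟨x, h1, h2⟩ := hc.exists_dist_le (h p hp q hq)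
    exact ⟨x, (key _ _ _).2 h1, (key _ _ _).2 h2⟩)
  refine ⟨x, fun p hp => (key _ _ _).1 ?_⟩
  exact Set.mem_iInter₂.1 hx p hp

/-- The Helly property for a family `F` of balls, a further ball around `x`, and balls of one
radius around the points of a set `Z`. -/
theorem IsHelly.exists_common_extend (hh : G.IsHelly) (hc : G.Connected) (F : Set (V × ℕ))
    (hF : ∀ p ∈ F, ∀ q ∈ F, G.dist p.1 q.1 ≤ p.2 + q.2) (x : V) (i : ℕ)
    (hx : ∀ p ∈ F, G.dist p.1 x ≤ p.2 + i) (Z : Set V) (j : ℕ)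
    (hZ : ∀ y ∈ Z, ∀ z ∈ Z, G.dist y z ≤ j + j) (hFZ : ∀ p ∈ F, ∀ z ∈ Z, G.dist p.1 z ≤ p.2 + j)
    (hxZ : ∀ z ∈ Z, G.dist x z ≤ i + j) :
    ∃ b, (∀ p ∈ F, G.dist p.1 b ≤ p.2) ∧ G.dist x b ≤ i ∧ ∀ z ∈ Z, G.dist z b ≤ j := by
  obtain ⟨b, hb⟩ := hh.exists_common hc ({p | p ∈ F ∨ p = (x, i) ∨ (p.1 ∈ Z ∧ p.2 = j)}) (by
    rintro ⟨v, k⟩ hp ⟨w, l⟩ hq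
    simp only [Set.mem_ofPred_eq, Prod.mk.injEq] at hp hq
    rcases hp with hp | ⟨rfl, rfl⟩ | ⟨hp, rfl⟩ <;> rcases hq with hq | ⟨rfl, rfl⟩ | ⟨hq, rfl⟩
    · exact hF _ hp _ hq
    · exact hx _ hp
    · exact hFZ _ hp _ hq
    · rw [dist_comm, add_comm]; exact hx _ hq
    · simp
    · exact hxZ _ hq
    · rw [dist_comm, add_comm]; exact hFZ _ hq _ hp
    · rw [dist_comm, add_comm]; exact hxZ _ hp
    · exact hZ _ hp _ hq)
  exact ⟨b, fun p hp => hb p (Or.inl hp), hb _ (Or.inr (Or.inl rfl)),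
    fun z hz => hb (z, j) (Or.inr (Or.inr ⟨hz, rfl⟩))⟩

/-- In a `C₄`-free Helly graph the slices of an interval are cliques. -/
theorem IsHelly.slice_adj (hh : G.IsHelly) (hc : G.Connected) (h4 : G.IsC4Free) {u w x y : V}
    {a b : ℕ} (huw : G.dist u w = a + b) (hux : G.dist u x ≤ a) (hwx : G.dist w x ≤ b)
    (huy : G.dist u y ≤ a) (hwy : G.dist w y ≤ b) (hne : x ≠ y) : G.Adj x y := by
  by_contra hadj
  have hk : 2 ≤ G.dist x y := by
    by_contra hlt
    rcases hc.dist_le_one_iff.1 (by omega : G.dist x y ≤ 1) with h | h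
    · exact hne h
    · exact hadj h
  have ha : 1 ≤ a := by
    rcases Nat.eq_zero_or_pos a with rfl | h
    · exact absurd ((hc.dist_eq_zero_iff.1 (Nat.le_zero.1 hux)).symm.trans
        (hc.dist_eq_zero_iff.1 (Nat.le_zero.1 huy))) hne
    · exact h
  have hb : 1 ≤ b := by
    rcases Nat.eq_zero_or_pos b with rfl | h
    · exact absurd ((hc.dist_eq_zero_iff.1 (Nat.le_zero.1 hwx)).symm.trans
        (hc.dist_eq_zero_iff.1 (Nat.le_zero.1 hwy))) hne
    · exact h
  have hwu : G.dist w u = a + b := by rw [dist_comm]; exact huw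
  -- Replace `x` by a vertex `x'` of the same slice at distance exactly two from `y`: the radii
  -- `G.dist x y - 2` around `x` and `2` around `y` leave no other possibility.
  obtain ⟨x', h1, h2, h3⟩ := hh.exists_common_extend hc {(u, a), (w, b)} (by
      simp only [Set.mem_insert_iff, Set.mem_singleton_iff]
      rintro p (rfl | rfl) q (rfl | rfl) <;> simp only [dist_self] <;> omega)
    x (G.dist x y - 2) (by
      simp only [Set.mem_insert_iff, Set.mem_singleton_iff]
      rintro p (rfl | rfl) <;> simp only <;> omega) {y} 2 (by simp) (by
      simp only [Set.mem_insert_iff, Set.mem_singleton_iff]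
      rintro p (rfl | rfl) z rfl <;> simp only <;> omega) (by
      simp only [Set.mem_singleton_iff]
      rintro z rfl; omega)
  have hux' := h1 (u, a) (by simp)
  have hwx' := h1 (w, b) (by simp)
  have hyx' := h3 y rfl
  simp only at hux' hwx'
  have t1 := hc.dist_triangle (u := x) (v := x') (w := y)
  have t2 := G.dist_comm (u := x') (v := y)
  -- A common neighbour of `x'` and `y` one step closer to an endpoint; it is used once towards `u`
  -- and once towards `w`.
  have mid : ∀ (s : V) (k : ℕ), 1 ≤ k → G.dist s x' ≤ k → G.dist s y ≤ k →
      ∃ p, G.dist s p ≤ k - 1 ∧ G.dist x' p ≤ 1 ∧ G.dist y p ≤ 1 := by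
    intro s k hk1 hs1 hs2
    obtain ⟨p, h1, h2, h3⟩ := hh.exists_common_extend hc {(s, k - 1)} (by simp) x' 1 (by
      simp only [Set.mem_singleton_iff]
      rintro _ rfl; simp only; omega) {y} 1 (by simp) (by
      simp only [Set.mem_singleton_iff]
      rintro _ rfl _ rfl; simp only; omega) (by
      simp only [Set.mem_singleton_iff]
      rintro _ rfl; omega)
    exact ⟨p, h1 (s, k - 1) rfl, h2, h3 y rfl⟩
  obtain ⟨p, hp1, hp2, hp3⟩ := mid u a ha hux' huy
  obtain ⟨q, hq1, hq2, hq3⟩ := mid w b hb hwx' hwy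
  have t3 := hc.dist_triangle (u := u) (v := p) (w := w)
  have t4 := hc.dist_triangle (u := p) (v := q) (w := w)
  have t5 := G.dist_comm (u := q) (v := w)
  have t6 := hc.dist_triangle (u := x') (v := p) (w := y)
  have t7 := hc.dist_triangle (u := x') (v := q) (w := y)
  have t8 := G.dist_comm (u := p) (v := y)
  have t9 := G.dist_comm (u := q) (v := y)
  -- A shorter connection would make `u` and `w` closer than `a + b`. Hence `x', p, y, q` violates
  -- the absence of induced four-cycles.
  have hpq : 2 ≤ G.dist p q := by omega
  have e1 : G.Adj x' p := dist_eq_one_iff_adj.1 (by omega)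
  have e2 : G.Adj y p := dist_eq_one_iff_adj.1 (by omega)
  have e3 : G.Adj x' q := dist_eq_one_iff_adj.1 (by omega)
  have e4 : G.Adj y q := dist_eq_one_iff_adj.1 (by omega)
  have n1 : ∀ {s t : V}, 2 ≤ G.dist s t → s ≠ t ∧ ¬ G.Adj s t := by
    intro s t hst
    refine ⟨?_, fun h => ?_⟩
    · rintro rfl; simp at hst
    · have := dist_eq_one_iff_adj.2 h; omega
  obtain ⟨m1, m2⟩ := n1 hpq
  obtain ⟨m3, m4⟩ := n1 (by omega : 2 ≤ G.dist x' y)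
  rcases h4.adj_or_adj e1 e2.symm e4 e3.symm m3 m1 with h | h
  · exact m4 h
  · exact m2 h

/-- `k` bounds the eccentricity of `v`. -/
def EccLe (G : SimpleGraph V) (v : V) (k : ℕ) : Prop := ∀ z, G.dist v z ≤ k

/-- The radius, as a natural number, described by its defining property. -/
structure IsRad (G : SimpleGraph V) (r : ℕ) : Prop where
  exists_eccLe : ∃ c, G.EccLe c r
  le : ∀ c k, G.EccLe c k → r ≤ k

theorem EccLe.dist_le_add {c : V} {k : ℕ} (h : G.EccLe c k) (hc : G.Connected) (x y : V) :
    G.dist x y ≤ k + k := by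
  have := hc.dist_triangle (u := x) (v := c) (w := y)
  have := G.dist_comm (u := x) (v := c)
  have := h x
  have := h y
  omega

/-- The Helly property inside the center. -/
theorem IsHelly.exists_center (hh : G.IsHelly) (hc : G.Connected) {r : ℕ} {c : V}
    (hr : G.EccLe c r) (x : V) (i : ℕ) (hx : G.EccLe x (r + i)) (Z : Set V) (j : ℕ)
    (hZ : ∀ y ∈ Z, ∀ z ∈ Z, G.dist y z ≤ j + j) (hZr : ∀ z ∈ Z, G.EccLe z (r + j))
    (hxZ : ∀ z ∈ Z, G.dist x z ≤ i + j) :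
    ∃ b, G.EccLe b r ∧ G.dist x b ≤ i ∧ ∀ z ∈ Z, G.dist z b ≤ j := by
  -- The common points of all balls of radius `r` are the vertices of eccentricity at most `r`; the
  -- vertex `c` makes these balls intersect pairwise.
  obtain ⟨b, h1, h2, h3⟩ := hh.exists_common_extend hc {p | p.2 = r} (by
    rintro ⟨p, _⟩ rfl ⟨q, _⟩ hq
    obtain rfl : _ = _ := hq
    exact hr.dist_le_add hc p q) x i (by
    rintro ⟨p, _⟩ rfl
    rw [dist_comm]; exact hx p) Z j hZ (by
    rintro ⟨p, _⟩ rfl z hz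
    rw [dist_comm]; exact hZr z hz p) hxZ
  exact ⟨b, fun z => by rw [dist_comm]; exact h1 (z, r) rfl, h2, h3⟩

/-- The ball of radius `k` around `v` meets every ball of radius `r`, so it contains a central
vertex. This is the nontrivial half of the formula for the eccentricity in terms of the distance to
the center. -/
theorem IsHelly.exists_center_dist_le (hh : G.IsHelly) (hc : G.Connected) {r : ℕ}
    (hr : G.IsRad r) {v : V} {k : ℕ} (hv : G.EccLe v (r + k)) :
    ∃ c, G.EccLe c r ∧ G.dist v c ≤ k := by
  obtain ⟨c, hcr⟩ := hr.exists_eccLe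
  obtain ⟨b, h1, h2, -⟩ := hh.exists_center hc hcr v k hv ∅ 0 (by simp) (by simp) (by simp)
  exact ⟨b, h1, h2⟩

/-- If all distances were at most `2 * r - 2`, the balls of radius `r - 1` would intersect pairwise,
and a common point would have eccentricity below the radius. -/
theorem IsHelly.exists_not_eccLe (hh : G.IsHelly) (hc : G.Connected) {r : ℕ}
    (hr : G.IsRad r) (h1 : 1 ≤ r) : ∃ u, ¬ G.EccLe u (2 * r - 2) := by
  by_contra hcon
  push Not at hcon
  obtain ⟨x, hx⟩ := hh.exists_common hc {p | p.2 = r - 1} (by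
    rintro ⟨p, _⟩ rfl ⟨q, _⟩ hq
    obtain rfl : _ = _ := hq
    have := hcon p q
    simp only at this ⊢; omega)
  have := hr.le x (r - 1) (fun z => by rw [dist_comm]; exact hx (z, r - 1) rfl)
  omega

/-- Central vertices are close to the central vertices next to a nearly diametral vertex. -/
theorem IsHelly.exists_center_near (hh : G.IsHelly) (hc : G.Connected) {r k : ℕ}
    {u : V} (hu : G.EccLe u (r + k)) (hk : r ≤ k + 1) {x : V} (hx : G.EccLe x r) :
    ∃ a, G.EccLe a r ∧ G.dist x a ≤ 1 ∧ G.dist u a ≤ k := by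
  have hxu := hx u
  -- The balls of radius one around `x` and of radius `k` around `u` meet, since `x` has distance at
  -- most `r ≤ k + 1` from `u`.
  obtain ⟨b, h1, h2, h3⟩ := hh.exists_center hc hx x 1 (fun z => (hx z).trans (by omega)) {u} k
    (by simp) (by rintro _ rfl; exact hu) (by rintro _ rfl; omega)
  exact ⟨b, h1, h2, h3 u rfl⟩

/-! ### The diameter of the center and the eccentricity of a farthest vertex -/

section Finite

variable [Finite V]

theorem exists_farthest (G : SimpleGraph V) (v : V) : ∃ u, ∀ z, G.dist v z ≤ G.dist v u := by
  have : Nonempty V := ⟨v⟩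
  exact Finite.exists_max (fun z => G.dist v z)

/-- Let `u` have eccentricity at least `2 * r - 1`, attained at `w`. Each of `x` and `y` is within
distance one of a central vertex in the slice between `u` and `w` at distance `r` from `w`, and this
slice is a clique. -/
theorem IsHelly.center_dist_le_three (hh : G.IsHelly) (hc : G.Connected) (h4 : G.IsC4Free) {r : ℕ}
    (hr : G.IsRad r) {x y : V} (hx : G.EccLe x r) (hy : G.EccLe y r) : G.dist x y ≤ 3 := by
  rcases Nat.eq_zero_or_pos r with rfl | h1
  · exact (hx y).trans (by omega)
  obtain ⟨u, hu⟩ := hh.exists_not_eccLe hc hr h1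
  obtain ⟨w, hw⟩ := G.exists_farthest u
  have hlt : 2 * r - 2 < G.dist u w := by
    by_contra hcon
    exact hu (fun z => (hw z).trans (not_lt.1 hcon))
  obtain ⟨k, hk⟩ : ∃ k, G.dist u w = r + k := ⟨G.dist u w - r, by omega⟩
  have hue : G.EccLe u (r + k) := fun z => (hw z).trans hk.le
  obtain ⟨a, ha, hxa, hua⟩ := hh.exists_center_near hc hue (by omega) hx
  obtain ⟨b, hb, hyb, hub⟩ := hh.exists_center_near hc hue (by omega) hy
  have hab : G.dist a b ≤ 1 := by
    rw [hc.dist_le_one_iff]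
    by_cases hne : a = b
    · exact Or.inl hne
    · refine Or.inr (hh.slice_adj hc h4 (w := w) (a := k) (b := r) (by omega) hua ?_ hub ?_ hne)
      · rw [dist_comm]; exact ha w
      · rw [dist_comm]; exact hb w
  have t1 := hc.dist_triangle (u := x) (v := a) (w := y)
  have t2 := hc.dist_triangle (u := a) (v := b) (w := y)
  have t3 := G.dist_comm (u := b) (v := y)
  omega

/-- A vertex farthest from an arbitrary one has almost maximal eccentricity. -/
theorem IsHelly.rad_le_of_farthest (hh : G.IsHelly) (hc : G.Connected) (h4 : G.IsC4Free) {r : ℕ}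
    (hr : G.IsRad r) {v u w : V} (hu : ∀ z, G.dist v z ≤ G.dist v u)
    (hw : ∀ z, G.dist u z ≤ G.dist u w) : 2 * r ≤ G.dist u w + 3 ∧ G.dist u w ≤ 2 * r := by
  have hv : r ≤ G.dist v u := hr.le v _ hu
  have hur : r ≤ G.dist u w := hr.le u _ hw
  obtain ⟨c, hcr, hvc⟩ := hh.exists_center_dist_le hc hr (v := v) (k := G.dist v u - r)
    (fun z => (hu z).trans (by omega))
  obtain ⟨c', hcr', huc⟩ := hh.exists_center_dist_le hc hr (v := u) (k := G.dist u w - r)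
    (fun z => (hw z).trans (by omega))
  have t1 := hc.dist_triangle (u := v) (v := c) (w := u)
  have t2 := hc.dist_triangle (u := c) (v := c') (w := u)
  -- Going from `v` to `u` through `c` and `c'` gives `e(v) ≤ (e(v) - r) + 3 + (e(u) - r)`, and
  -- `e(v)` cancels.
  have t3 := hh.center_dist_le_three hc h4 hr hcr hcr'
  have t4 := G.dist_comm (u := c') (v := u)
  have t5 := hcr.dist_le_add hc u w
  omega

end Finite

/-! ### Distances to a set -/

/-- `D` is the distance to the nonempty set `S`. -/
structure IsDistTo (G : SimpleGraph V) (S : Set V) (D : V → ℕ) : Prop where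
  exists_eq : ∀ v, ∃ q ∈ S, G.dist q v = D v
  le : ∀ q ∈ S, ∀ v, D v ≤ G.dist q v

theorem exists_isDistTo (G : SimpleGraph V) {S : Set V} (hS : S.Nonempty) :
    ∃ D, G.IsDistTo S D := by
  refine ⟨fun v => sInf ((fun q => G.dist q v) '' S), fun v => ?_, fun q hq v => ?_⟩
  · exact Nat.sInf_mem (hS.image _)
  · exact Nat.sInf_le ⟨q, hq, rfl⟩

namespace IsDistTo

variable {S : Set V} {D : V → ℕ}

theorem eq_zero_iff (h : G.IsDistTo S D) (hc : G.Connected) {v : V} : D v = 0 ↔ v ∈ S := by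
  constructor
  · intro h0
    obtain ⟨q, hq, he⟩ := h.exists_eq v
    rw [h0] at he
    rwa [← hc.dist_eq_zero_iff.1 he]
  · intro hv
    have := h.le v hv v
    simpa using this

theorem le_add_dist (h : G.IsDistTo S D) (hc : G.Connected) (u v : V) :
    D v ≤ D u + G.dist u v := by
  obtain ⟨q, hq, he⟩ := h.exists_eq u
  have := h.le q hq v
  have := hc.dist_triangle (u := q) (v := u) (w := v)
  omega

theorem le_succ_of_adj (h : G.IsDistTo S D) (hc : G.Connected) {u v : V} (ha : G.Adj u v) :
    D v ≤ D u + 1 := by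
  have := h.le_add_dist hc u v
  have := dist_eq_one_iff_adj.2 ha
  omega

theorem exists_pred (h : G.IsDistTo S D) (hc : G.Connected) {v : V} (hv : D v ≠ 0) :
    ∃ u, G.Adj u v ∧ D u + 1 = D v := by
  obtain ⟨q, hq, he⟩ := h.exists_eq v
  obtain ⟨u, h1, h2⟩ := hc.exists_dist_le (u := q) (v := v) (a := D v - 1) (b := 1) (by omega)
  have h3 := h.le q hq u
  have h4 := h.le_add_dist hc u v
  have h5 := G.dist_comm (u := u) (v := v)
  have h6 : G.dist u v = 1 := by omega
  exact ⟨u, dist_eq_one_iff_adj.1 h6, by omega⟩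

theorem dist_singleton (G : SimpleGraph V) (u : V) : G.IsDistTo {u} (G.dist u) :=
  ⟨fun _ => ⟨u, rfl, rfl⟩, by rintro _ rfl v; exact le_rfl⟩

/-- The eccentricity of `v` is thus exactly `r + D v`: the triangle inequality bounds it from above,
and the Helly property supplies a central vertex that is close enough for the reverse bound. -/
theorem eccLe_iff {r : ℕ} (h : G.IsDistTo {c | G.EccLe c r} D) (hh : G.IsHelly)
    (hc : G.Connected) (hr : G.IsRad r) (v : V) (k : ℕ) : G.EccLe v k ↔ r + D v ≤ k := by
  constructor
  · intro hv
    have hrk := hr.le v k hv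
    obtain ⟨c, h1, h2⟩ := hh.exists_center_dist_le hc hr (v := v) (k := k - r)
      (fun z => (hv z).trans (by omega))
    have := h.le c h1 v
    have := G.dist_comm (u := c) (v := v)
    omega
  · intro hk z
    obtain ⟨q, hq, he⟩ := h.exists_eq v
    have := hq z
    have := hc.dist_triangle (u := v) (v := q) (w := z)
    have := G.dist_comm (u := q) (v := v)
    omega

end IsDistTo

/-! ### Gates -/

/-- Vertices at distance at least two from `S` have a neighbour closer to `S` with the same
projection to `S`. -/
theorem IsHelly.exists_pred_same_projection (hh : G.IsHelly) (hc : G.Connected) {S : Set V}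
    {D : V → ℕ} (hD : G.IsDistTo S D) (hS : ∀ p ∈ S, ∀ q ∈ S, G.dist p q ≤ 2) {z : V}
    (hz : 2 ≤ D z) : ∃ y, G.Adj z y ∧ D y + 1 = D z ∧ ∀ q ∈ S, G.dist q z = D z →
      G.dist q y = D y := by
  -- The balls of radius `D z - 1` around the projection of `z` meet pairwise because `2 ≤ 2 * (D z
  -- - 1)`; this is where the diameter of `S` and `2 ≤ D z` enter. They also meet the ball of radius
  -- one around `z`.
  obtain ⟨y, -, h2, h3⟩ := hh.exists_common_extend hc ∅ (by simp) z 1 (by simp)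
    {q | q ∈ S ∧ G.dist q z = D z} (D z - 1) (by
      intro p hp q hq
      have := hS p hp.1 q hq.1
      omega) (by simp) (by
      intro q hq
      have := hq.2
      rw [dist_comm]; omega)
  obtain ⟨q, hq, he⟩ := hD.exists_eq z
  have h4 := h3 q ⟨hq, he⟩
  have h5 := hD.le q hq y
  have h6 := hD.le_add_dist hc y z
  have h7 := G.dist_comm (u := y) (v := z)
  refine ⟨y, dist_eq_one_iff_adj.1 (by omega), by omega, fun p hp hpz => ?_⟩
  have h8 := h3 p ⟨hp, hpz⟩
  have h9 := hD.le p hp y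
  omega

/-- `g` maps every vertex outside of `S` to a vertex next to `S` on a shortest path to `S` that
sees the same part of `S`. -/
def IsGate (G : SimpleGraph V) (S : Set V) (D : V → ℕ) (g : V → V) : Prop :=
  ∀ z, D z ≠ 0 → D (g z) = 1 ∧ ∀ q ∈ S, (G.Adj q (g z) ↔ G.dist q z = D z)

/-- The gates of the vertices at distance `k`. -/
def gatesAt (D : V → ℕ) (g : V → V) (k : ℕ) : Set V := {y | ∃ z, D z = k ∧ g z = y}

/-- `x` or a neighbour of `x` in `S` sees, for every gate `h`, exactly the gates that `s h` sees. -/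
def PassesFilter (G : SimpleGraph V) (S H : Set V) (s : V → V) (x : V) : Prop :=
  ∀ h ∈ H, ∃ b ∈ S, G.dist x b ≤ 1 ∧ ∀ y ∈ H, (G.Adj b y ↔ G.Adj (s h) y)

/-- `s h` is a neighbour of `h` in `S` that sees as many vertices of `H` as possible. -/
def IsSelection (G : SimpleGraph V) (S H : Set V) (s : V → V) : Prop :=
  ∀ h ∈ H, s h ∈ S ∧ G.Adj (s h) h ∧ ∀ b ∈ S, G.Adj b h →
    {y | y ∈ H ∧ G.Adj b y}.ncard ≤ {y | y ∈ H ∧ G.Adj (s h) y}.ncard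

/-- Soundness of a filter. The vertex `s h` for the gate `h` of `z` sees `h`; hence some `b` within
distance one of `x` sees it too, and by the defining property of a gate `b` is at distance `r - 1`
from `z`. -/
theorem PassesFilter.dist_le (hc : G.Connected) {r : ℕ} (h2 : 2 ≤ r) {S : Set V} {D : V → ℕ}
    {g s : V → V} (hg : G.IsGate S D g) (hs : G.IsSelection S (gatesAt D g (r - 1)) s) {x : V}
    (hx : G.PassesFilter S (gatesAt D g (r - 1)) s x) {z : V} (hz : D z = r - 1) :
    G.dist x z ≤ r := by
  obtain ⟨b, hbS, hxb, hb⟩ := hx (g z) ⟨z, hz, rfl⟩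
  have h1 := (hb (g z) ⟨z, hz, rfl⟩).2 (hs (g z) ⟨z, hz, rfl⟩).2.1
  have h3 := ((hg z (by omega)).2 b hbS).1 h1
  have := hc.dist_triangle (u := x) (v := b) (w := z)
  omega

/-! ### Extremal central vertices and completeness of the filters -/

section Finite

variable [Finite V]

/-- The neighbourhood of a central vertex contains all of the information on a nearly diametral
vertex: a central vertex `c'` that is extremal in a slice has only nearly diametral vertices at
maximal distance. -/
theorem IsHelly.not_eccLe_of_extremal (hh : G.IsHelly) (hc : G.Connected) (h4 : G.IsC4Free)
    {r : ℕ} (h2 : 2 ≤ r) {c u₀ c' u : V} (hcr : G.EccLe c r) (hu₀ : G.dist c u₀ = 1 + (r - 1))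
    {K : Set V} (hK : K = {x | G.dist c x ≤ 1 ∧ G.dist u₀ x ≤ r - 1}) {D : V → ℕ} {g : V → V}
    (hD : G.IsDistTo K D) (hg : G.IsGate K D g) (hc' : c' ∈ K) (hcr' : G.EccLe c' r)
    (hmax : ∀ b ∈ K, G.EccLe b r → {y | y ∈ gatesAt D g (r - 1) ∧ G.Adj b y}.ncard ≤
      {y | y ∈ gatesAt D g (r - 1) ∧ G.Adj c' y}.ncard)
    (hu : G.dist c' u = r) : ¬ G.EccLe u (2 * r - 2) := by
  intro hcon
  have hclique : ∀ x ∈ K, ∀ y ∈ K, G.dist x y ≤ 1 := by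
    subst hK
    intro x hx y hy
    rw [hc.dist_le_one_iff]
    by_cases hne : x = y
    · exact Or.inl hne
    · exact Or.inr (hh.slice_adj hc h4 hu₀ hx.1 hx.2 hy.1 hy.2 hne)
  have hcu := hcr u
  -- If the eccentricity of `u` were at most `2 * r - 2`, the balls of radius `r - 1` around `u` and
  -- around all vertices within `r - 1` of `c'` would be compatible with one another and with
  -- centrality. The resulting `b` is as close as `c'` to everything at that distance, and closer to
  -- `u`.
  obtain ⟨b, hb, hcb, hZ⟩ := hh.exists_center hc hcr c 1 (fun z => (hcr z).trans (by omega))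
    {z | z = u ∨ G.dist c' z ≤ r - 1} (r - 1) (by
      rintro y (rfl | hy) z (rfl | hz)
      · simp
      · exact (hcon z).trans (by omega)
      · have := hcon y
        rw [dist_comm]; omega
      · have := hc.dist_triangle (u := y) (v := c') (w := z)
        have := G.dist_comm (u := y) (v := c')
        omega) (by
      rintro z (rfl | hz) y
      · exact (hcon y).trans (by omega)
      · have := hc.dist_triangle (u := z) (v := c') (w := y)
        have := G.dist_comm (u := z) (v := c')
        have := hcr' y
        omega) (by
      intro z _
      have := hcr z
      omega)
  have hc'K : G.dist c c' ≤ 1 ∧ G.dist u₀ c' ≤ r - 1 := by rw [hK] at hc'; exact hc'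
  have hbK : b ∈ K := by
    rw [hK]
    refine ⟨hcb, hZ u₀ (Or.inr ?_)⟩
    rw [dist_comm]; exact hc'K.2
  have hbu : G.dist b u ≤ r - 1 := by
    rw [dist_comm]; exact hZ u (Or.inl rfl)
  -- The vertex `b` gives the upper bound. The lower bound holds because `K` is a clique containing
  -- `c'`, which is at distance `r` from `u`.
  have hDu : D u = r - 1 := by
    have h1 := hD.le b hbK u
    obtain ⟨q, hq, he⟩ := hD.exists_eq u
    have h3 := hclique c' hc' q hq
    have h5 := hc.dist_triangle (u := c') (v := q) (w := u)
    omega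
  -- The vertex `b` sees every gate that `c'` sees, and in addition the gate of `u`, which
  -- contradicts the maximality of `c'`.
  have hsub : {y | y ∈ gatesAt D g (r - 1) ∧ G.Adj c' y} ⊂
      {y | y ∈ gatesAt D g (r - 1) ∧ G.Adj b y} := by
    refine ⟨?_, fun hcon' => ?_⟩
    · rintro y ⟨⟨z, hz, rfl⟩, hy⟩
      refine ⟨⟨z, hz, rfl⟩, ?_⟩
      have h1 := ((hg z (by omega)).2 c' hc').1 hy
      have h3 := hZ z (Or.inr (by omega))
      have h5 := hD.le b hbK z
      rw [dist_comm] at h3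
      exact ((hg z (by omega)).2 b hbK).2 (by omega)
    · have h1 : g u ∈ {y | y ∈ gatesAt D g (r - 1) ∧ G.Adj b y} :=
        ⟨⟨u, hDu, rfl⟩, ((hg u (by omega)).2 b hbK).2 (by
          have := hD.le b hbK u
          omega)⟩
      have h3 := ((hg u (by omega)).2 c' hc').1 (hcon' h1).2
      omega
  have := hmax b hbK hb
  have := Set.ncard_lt_ncard hsub
  omega

/-- Completeness of a filter for a set `S` that is an intersection of balls. The family `F`, the
ball of radius one around `x`, and the balls of radius `r - 1` around the vertices whose gates `s h`
sees are pairwise compatible. A common vertex lies in `S`, is close to `x`, and sees at least as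
many gates as `s h`. -/
theorem IsHelly.passesFilter (hh : G.IsHelly) (hc : G.Connected) {r : ℕ} (h2 : 2 ≤ r) {S : Set V}
    {F : Set (V × ℕ)} (hS : ∀ v, v ∈ S ↔ ∀ p ∈ F, G.dist p.1 v ≤ p.2) {D : V → ℕ}
    {g s : V → V} (hD : G.IsDistTo S D)
    (hg : G.IsGate S D g) (hs : G.IsSelection S (gatesAt D g (r - 1)) s) {x : V}
    (hx : G.EccLe x r) (hxF : ∀ p ∈ F, G.dist p.1 x ≤ p.2 + 1) :
    G.PassesFilter S (gatesAt D g (r - 1)) s x := by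
  intro h hh'
  obtain ⟨hsS, hsh, hmax⟩ := hs h hh'
  have hsF := (hS _).1 hsS
  obtain ⟨b, hb, hxb, hZ⟩ := hh.exists_common_extend hc F (by
      intro p hp q hq
      have h3 := hsF p hp
      have h5 := hsF q hq
      have := hc.dist_triangle (u := p.1) (v := s h) (w := q.1)
      have := G.dist_comm (u := s h) (v := q.1)
      omega) x 1 hxF {z | D z = r - 1 ∧ G.Adj (s h) (g z)} (r - 1) (by
      rintro y ⟨hy, hy'⟩ z ⟨hz, hz'⟩
      have h3 := ((hg y (by omega)).2 _ hsS).1 hy'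
      have h5 := ((hg z (by omega)).2 _ hsS).1 hz'
      have := hc.dist_triangle (u := y) (v := s h) (w := z)
      have := G.dist_comm (u := s h) (v := y)
      omega) (by
      rintro p hp z ⟨hz, hz'⟩
      have h3 := hsF p hp
      have h5 := ((hg z (by omega)).2 _ hsS).1 hz'
      have := hc.dist_triangle (u := p.1) (v := s h) (w := z)
      omega) (by
      intro z _
      have := hx z
      omega)
  have hbS := (hS b).2 hb
  have hsub : {y | y ∈ gatesAt D g (r - 1) ∧ G.Adj (s h) y} ⊆
      {y | y ∈ gatesAt D g (r - 1) ∧ G.Adj b y} := by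
    rintro y ⟨⟨z, hz, rfl⟩, hy⟩
    refine ⟨⟨z, hz, rfl⟩, ((hg z (by omega)).2 b hbS).2 ?_⟩
    have h3 := hZ z ⟨hz, hy⟩
    have h5 := hD.le b hbS z
    rw [dist_comm] at h3
    omega
  have hbh : G.Adj b h := (hsub ⟨hh', hsh⟩).2
  -- Since `b` also sees `h`, it competed in the selection of `s h`; maximality turns the inclusion
  -- into an equality.
  have heq := Set.eq_of_subset_of_ncard_le hsub (hmax b hbS hbh)
  refine ⟨b, hbS, hxb, fun y hy => ?_⟩
  have : y ∈ {y | y ∈ gatesAt D g (r - 1) ∧ G.Adj (s h) y} ↔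
      y ∈ {y | y ∈ gatesAt D g (r - 1) ∧ G.Adj b y} := by rw [heq]
  simpa [hy] using this.symm

/-- The two filters single out the center. -/
theorem IsHelly.eccLe_iff_passesFilter (hh : G.IsHelly) (hc : G.Connected) {r k : ℕ} (h2 : 2 ≤ r)
    {u c : V} (hu : G.EccLe u (r + k)) (hk : r ≤ k + 1) {A N : Set V}
    (hA : A = {a | G.EccLe a r ∧ G.dist u a ≤ k}) (hAc : ∀ a ∈ A, ∀ b ∈ A, G.dist a b ≤ 1)
    (hcA : c ∈ A) (hN : N = {v | G.dist c v ≤ 1}) {DA DN : V → ℕ} {gA gN sA sN : V → V}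
    (hDA : G.IsDistTo A DA) (hDN : G.IsDistTo N DN) (hgA : G.IsGate A DA gA)
    (hgN : G.IsGate N DN gN) (hsA : G.IsSelection A (gatesAt DA gA (r - 1)) sA)
    (hsN : G.IsSelection N (gatesAt DN gN (r - 1)) sN) (x : V) :
    G.EccLe x r ↔ DA x ≤ 1 ∧ G.PassesFilter A (gatesAt DA gA (r - 1)) sA x ∧
      G.PassesFilter N (gatesAt DN gN (r - 1)) sN x := by
  have hcr : G.EccLe c r := by rw [hA] at hcA; exact hcA.1
  constructor
  · intro hx
    obtain ⟨a, ha, hxa, hua⟩ := hh.exists_center_near hc hu hk hx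
    have haA : a ∈ A := by rw [hA]; exact ⟨ha, hua⟩
    refine ⟨?_, ?_, ?_⟩
    · refine (hDA.le a haA x).trans ?_
      rw [dist_comm]; exact hxa
    -- `A` is the intersection of all balls of radius `r` and of the ball of radius `k` around `u`.
    · refine hh.passesFilter hc h2 (F := {p | p.2 = r ∨ p = (u, k)}) ?_ hDA hgA hsA hx ?_
      · intro v
        rw [hA]
        constructor
        · rintro ⟨hv, hv'⟩ ⟨p, i⟩ (rfl | hp)
          · rw [dist_comm]; exact hv p
          · obtain ⟨rfl, rfl⟩ := Prod.mk.inj hp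
            exact hv'
        · intro hv
          refine ⟨fun z => ?_, hv (u, k) (Or.inr rfl)⟩
          rw [dist_comm]; exact hv (z, r) (Or.inl rfl)
      · rintro ⟨p, i⟩ (rfl | hp)
        · rw [dist_comm]; exact (hx p).trans (Nat.le_succ _)
        · obtain ⟨rfl, rfl⟩ := Prod.mk.inj hp
          have := hx p
          rw [dist_comm]; simp only; omega
    -- The vertex `x` is within distance one of `A`, hence within distance two of `c`, as
    -- completeness of the filter for the ball `N` requires.
    · refine hh.passesFilter hc h2 (F := {(c, 1)}) (by simp [hN]) hDN hgN hsN hx ?_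
      rintro _ rfl
      have h3 := hAc c hcA a haA
      have h5 := hc.dist_triangle (u := c) (v := a) (w := x)
      have h6 := G.dist_comm (u := a) (v := x)
      simp only; omega
  · rintro ⟨hx1, hxA, hxN⟩ z
    have hcz := hcr z
    obtain ⟨q, hq, hqz⟩ := hDN.exists_eq z
    -- Each `z` is covered in one of three ways. If `G.dist c z = r`, then `z` is at distance `r -
    -- 1` from `N`. Otherwise `z` is at distance at most `r - 1` from `A`: at equality the filter
    -- for `A` applies, and below it one step into `A` and one step inside this clique suffice.
    rcases Nat.lt_or_ge (G.dist c z) r with hlt | hge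
    · have h3 := hDA.le c hcA z
      by_cases h5 : DA z = r - 1
      · exact hxA.dist_le hc h2 hgA hsA h5
      · obtain ⟨a, ha, hax⟩ := hDA.exists_eq x
        obtain ⟨a', ha', haz⟩ := hDA.exists_eq z
        have h6 := hAc a ha a' ha'
        have h7 := hc.dist_triangle (u := a) (v := a') (w := z)
        have h8 := hc.dist_triangle (u := x) (v := a) (w := z)
        have h9 := G.dist_comm (u := x) (v := a)
        omega
    · refine hxN.dist_le hc h2 hgN hsN ?_
      obtain ⟨y, hy1, hy2⟩ := hc.exists_dist_le (u := c) (v := z) (a := 1) (b := r - 1) (by omega)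
      have h3 := hDN.le y (by rw [hN]; exact hy1) z
      have h5 : G.dist c q ≤ 1 := by rw [hN] at hq; exact hq
      have h6 := hc.dist_triangle (u := c) (v := q) (w := z)
      have h7 := G.dist_comm (u := y) (v := z)
      omega

end Finite

end SimpleGraph

/-! ### From loops over vertices and neighbours to runs of the word RAM -/

namespace WordRAM

/-! ### Unbounded semantics -/

/-- The value of an expression on a machine with unbounded words. -/
def Expr.val (s : Store) : Expr → ℕ
  | .const k => k
  | .reg x => s.reg x
  | .cell a i => s.arr a (i.val s)
  | .bin o e f => o.apply (e.val s) (f.val s)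

namespace Store

@[simp] theorem setReg_reg (s : Store) (x v y : ℕ) :
    (s.setReg x v).reg y = if y = x then v else s.reg y := rfl

@[simp] theorem setReg_arr (s : Store) (x v : ℕ) : (s.setReg x v).arr = s.arr := rfl

@[simp] theorem setArr_reg (s : Store) (a i v : ℕ) : (s.setArr a i v).reg = s.reg := rfl

@[simp] theorem setArr_arr (s : Store) (a i v b j : ℕ) :
    (s.setArr a i v).arr b j = if b = a ∧ j = i then v else s.arr b j := rfl

end Store

namespace Expr

@[simp] theorem val_const (s : Store) (k : ℕ) : (const k).val s = k := rfl

@[simp] theorem val_reg (s : Store) (x : ℕ) : (reg x).val s = s.reg x := rfl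

@[simp] theorem val_cell (s : Store) (a : ℕ) (i : Expr) :
    (cell a i).val s = s.arr a (i.val s) := rfl

@[simp] theorem val_plus (s : Store) (e f : Expr) :
    (bin .plus e f).val s = e.val s + f.val s := rfl

@[simp] theorem val_minus (s : Store) (e f : Expr) :
    (bin .minus e f).val s = e.val s - f.val s := rfl

@[simp] theorem val_quot (s : Store) (e f : Expr) :
    (bin .quot e f).val s = e.val s / f.val s := rfl

@[simp] theorem val_less (s : Store) (e f : Expr) :
    (bin .less e f).val s = if e.val s < f.val s then 1 else 0 := rfl

@[simp] theorem val_equal (s : Store) (e f : Expr) :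
    (bin .equal e f).val s = if e.val s = f.val s then 1 else 0 := rfl

end Expr

/-- Runs on a machine with unbounded words. -/
inductive Exec : Prog → Store → ℕ → Store → Prop
  | nop (s : Store) : Exec .nop s 1 s
  | assign (s : Store) (x : ℕ) (e : Expr) : Exec (.assign x e) s (e.cost + 1) (s.setReg x (e.val s))
  | put (s : Store) (a : ℕ) (i e : Expr) :
      Exec (.put a i e) s (i.cost + e.cost + 1) (s.setArr a (i.val s) (e.val s))
  | seq {p q : Prog} {s s' s'' : Store} {t t' : ℕ}
      (hp : Exec p s t s') (hq : Exec q s' t' s'') : Exec (.seq p q) s (t + t') s''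
  | ite_true {e : Expr} {p q : Prog} {s s' : Store} {t : ℕ}
      (he : e.val s ≠ 0) (hp : Exec p s t s') : Exec (.ite e p q) s (e.cost + 1 + t) s'
  | ite_false {e : Expr} {p q : Prog} {s s' : Store} {t : ℕ}
      (he : e.val s = 0) (hq : Exec q s t s') : Exec (.ite e p q) s (e.cost + 1 + t) s'
  | loop_true {e : Expr} {p : Prog} {s s' s'' : Store} {t t' : ℕ}
      (he : e.val s ≠ 0) (hp : Exec p s t s') (hl : Exec (.loop e p) s' t' s'') :
      Exec (.loop e p) s (e.cost + 1 + t + t') s''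
  | loop_false {e : Expr} {p : Prog} {s : Store} (he : e.val s = 0) :
      Exec (.loop e p) s (e.cost + 1) s

/-- An operation that, with second argument `f`, increases values by at most `4`. -/
def BinOp.tame : BinOp → Expr → Bool
  | .plus, .const k => decide (k ≤ 4)
  | .plus, _ => false
  | .times, _ => false
  | _, _ => true

/-- Expressions whose value exceeds the contents of the store only by a multiple of their cost. -/
def Expr.tame : Expr → Bool
  | .const k => decide (k ≤ 4)
  | .reg _ => true
  | .cell _ i => i.tame
  | .bin o e f => e.tame && f.tame && o.tame f

/-- Programs all of whose expressions are tame. -/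
def Prog.tame : Prog → Bool
  | .nop => true
  | .assign _ e => e.tame
  | .put _ i e => i.tame && e.tame
  | .seq p q => p.tame && q.tame
  | .ite e p q => e.tame && p.tame && q.tame
  | .loop e p => e.tame && p.tame

/-- All words in the store are at most `M`. -/
def Store.LE (s : Store) (M : ℕ) : Prop := (∀ x, s.reg x ≤ M) ∧ ∀ a i, s.arr a i ≤ M

theorem Store.LE.mono {s : Store} {M M' : ℕ} (h : s.LE M) (hM : M ≤ M') : s.LE M' :=
  ⟨fun x => (h.1 x).trans hM, fun a i => (h.2 a i).trans hM⟩

theorem BinOp.apply_le {o : BinOp} {f : Expr} (h : o.tame f) {s : Store} {x : ℕ} :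
    o.apply x (f.val s) ≤ x + 4 := by
  cases o with
  | plus =>
    cases f <;> simp [BinOp.tame] at h
    simpa [BinOp.apply, Expr.val] using h
  | minus => simp only [BinOp.apply]; omega
  | times => simp [BinOp.tame] at h
  | quot => exact (Nat.div_le_self _ _).trans (by omega)
  | less => simp only [BinOp.apply]; split_ifs <;> omega
  | equal => simp only [BinOp.apply]; split_ifs <;> omega

/-- Words read from the store are at most `M`, and each operation of a tame expression adds at most
`4`. Hence no intermediate value overflows when `B` exceeds `M + 4 * e.cost`. -/
theorem Expr.eval_eq_some {B M : ℕ} {s : Store} (hs : s.LE M) :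
    ∀ e : Expr, e.tame → M + 4 * e.cost < B →
      e.eval B s = some (e.val s) ∧ e.val s ≤ M + 4 * e.cost := by
  intro e
  induction e with
  | const k =>
    intro ht hB
    simp only [Expr.tame, decide_eq_true_eq] at ht
    simp only [Expr.cost] at hB
    simp only [Expr.eval, word, Expr.val, Expr.cost]
    rw [if_pos (by omega)]
    exact ⟨rfl, by omega⟩
  | reg x =>
    intro _ hB
    have := hs.1 x
    simp only [Expr.cost] at hB
    simp only [Expr.eval, word, Expr.val, Expr.cost]
    rw [if_pos (by omega)]
    exact ⟨rfl, by omega⟩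
  | cell a i ih =>
    intro ht hB
    simp only [Expr.cost] at hB
    obtain ⟨h1, -⟩ := ih ht (by omega)
    have := hs.2 a (i.val s)
    simp only [Expr.eval, word, Expr.val, Expr.cost, h1, Option.bind_some]
    rw [if_pos (by omega)]
    exact ⟨rfl, by omega⟩
  | bin o e f ihe ihf =>
    intro ht hB
    simp only [Expr.tame, Bool.and_eq_true] at ht
    simp only [Expr.cost] at hB
    obtain ⟨h1, h1'⟩ := ihe ht.1.1 (by omega)
    obtain ⟨h2, -⟩ := ihf ht.1.2 (by omega)
    have := BinOp.apply_le ht.2 (s := s) (x := e.val s)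
    simp only [Expr.eval, word, Expr.val, Expr.cost, h1, h2, Option.bind_some]
    rw [if_pos (by omega)]
    exact ⟨rfl, by omega⟩

theorem Store.LE.setReg {s : Store} {M : ℕ} (h : s.LE M) {x v : ℕ} (hv : v ≤ M) :
    (s.setReg x v).LE M := by
  refine ⟨fun y => ?_, h.2⟩
  simp only [Store.setReg]
  split_ifs
  · exact hv
  · exact h.1 y

theorem Store.LE.setArr {s : Store} {M : ℕ} (h : s.LE M) {a i v : ℕ} (hv : v ≤ M) :
    (s.setArr a i v).LE M := by
  refine ⟨h.1, fun b j => ?_⟩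
  simp only [Store.setArr]
  split_ifs
  · exact hv
  · exact h.2 b j

/-- A tame run is possible with all words that exceed the contents of the store by at least four
times the number of steps. -/
theorem Exec.runs {B : ℕ} {p : Prog} {s s' : Store} {t : ℕ} (h : Exec p s t s') :
    ∀ {M : ℕ}, p.tame → s.LE M → M + 4 * t < B → Runs B p s t s' ∧ s'.LE (M + 4 * t) := by
  induction h with
  | nop s => intro M _ hs _; exact ⟨.nop s, hs.mono (by omega)⟩
  | assign s x e =>
    intro M ht hs hB
    obtain ⟨h1, h2⟩ := Expr.eval_eq_some (B := B) hs e ht (by omega)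
    exact ⟨.assign s x e _ h1, (hs.mono (by omega)).setReg (by omega)⟩
  | put s a i e =>
    intro M ht hs hB
    simp only [Prog.tame, Bool.and_eq_true] at ht
    obtain ⟨h1, -⟩ := Expr.eval_eq_some (B := B) hs i ht.1 (by omega)
    obtain ⟨h3, h4⟩ := Expr.eval_eq_some (B := B) hs e ht.2 (by omega)
    exact ⟨.put s a i e _ _ h1 h3, (hs.mono (by omega)).setArr (by omega)⟩
  | seq hp hq ihp ihq =>
    intro M ht hs hB
    simp only [Prog.tame, Bool.and_eq_true] at ht
    obtain ⟨h1, h2⟩ := ihp ht.1 hs (by omega)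
    obtain ⟨h3, h4⟩ := ihq ht.2 h2 (by omega)
    exact ⟨.seq _ _ _ _ _ _ _ h1 h3, h4.mono (by omega)⟩
  | ite_true he hp ih =>
    intro M ht hs hB
    simp only [Prog.tame, Bool.and_eq_true] at ht
    obtain ⟨h1, -⟩ := Expr.eval_eq_some (B := B) hs _ ht.1.1 (by omega)
    obtain ⟨h3, h4⟩ := ih ht.1.2 hs (by omega)
    exact ⟨.ite_true _ _ _ _ _ _ _ h1 he h3, h4.mono (by omega)⟩
  | ite_false he hq ih =>
    intro M ht hs hB
    simp only [Prog.tame, Bool.and_eq_true] at ht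
    obtain ⟨h1, -⟩ := Expr.eval_eq_some (B := B) hs _ ht.1.1 (by omega)
    obtain ⟨h3, h4⟩ := ih ht.2 hs (by omega)
    exact ⟨.ite_false _ _ _ _ _ _ (he ▸ h1) h3, h4.mono (by omega)⟩
  | loop_true he hp hl ihp ihl =>
    intro M ht hs hB
    have ht' := ht
    simp only [Prog.tame, Bool.and_eq_true] at ht'
    obtain ⟨h1, -⟩ := Expr.eval_eq_some (B := B) hs _ ht'.1 (by omega)
    obtain ⟨h3, h4⟩ := ihp ht'.2 hs (by omega)
    obtain ⟨h5, h6⟩ := ihl ht h4 (by omega)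
    exact ⟨.loop_true _ _ _ _ _ _ _ _ h1 he h3 h5, h6.mono (by omega)⟩
  | loop_false he =>
    intro M ht hs hB
    simp only [Prog.tame, Bool.and_eq_true] at ht
    obtain ⟨h1, -⟩ := Expr.eval_eq_some (B := B) hs _ ht.1 (by omega)
    exact ⟨.loop_false _ _ _ (he ▸ h1), hs.mono (by omega)⟩

/-! ### Graph commands

A small language with loops over all vertices and over all neighbours of a vertex. Its commands use
registers below `64`; they do not write the input. -/

/-- The commands of the graph language. `forV x c` executes `c` for every vertex, held by register
`x`; `forN x y c` executes `c` for every neighbour of the vertex in register `x`, held by register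
`y`. -/
inductive Cmd where
  | nop
  | set (x : ℕ) (e : Expr)
  | put (a : ℕ) (i e : Expr)
  | seq (c d : Cmd)
  | ite (e : Expr) (c d : Cmd)
  | forV (x : ℕ) (c : Cmd)
  | forN (x y : ℕ) (c : Cmd)

infixr:60 " ;; " => Cmd.seq

variable {n : ℕ}

/-- The adjacency list of vertex number `k`. -/
def nbrs (L : Fin n → List (Fin n)) (k : ℕ) : List (Fin n) :=
  if h : k < n then L ⟨k, h⟩ else []

@[simp] theorem nbrs_val (L : Fin n → List (Fin n)) (v : Fin n) : nbrs L v = L v := by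
  simp [nbrs]

/-- The time of a loop over `l`, given the effect and the time of its body. -/
def loopTime (f : Store → Store) (t : Store → ℕ) (x : ℕ) : List (Fin n) → Store → ℕ
  | [], _ => 0
  | v :: l, s => 12 + t (s.setReg x v) + loopTime f t x l (f (s.setReg x v))

namespace Cmd

/-- The effect of a command. -/
def run (L : Fin n → List (Fin n)) : Cmd → Store → Store
  | .nop, s => s
  | .set x e, s => s.setReg x (e.val s)
  | .put a i e, s => s.setArr a (i.val s) (e.val s)
  | .seq c d, s => d.run L (c.run L s)
  | .ite e c d, s => if e.val s ≠ 0 then c.run L s else d.run L s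
  | .forV x c, s => (List.finRange n).foldl (fun s (v : Fin n) => c.run L (s.setReg x v)) s
  | .forN x y c, s => (nbrs L (s.reg x)).foldl (fun s (v : Fin n) => c.run L (s.setReg y v)) s

@[simp] theorem run_nop (L : Fin n → List (Fin n)) (s : Store) : nop.run L s = s := rfl

@[simp] theorem run_set (L : Fin n → List (Fin n)) (x : ℕ) (e : Expr) (s : Store) :
    (set x e).run L s = s.setReg x (e.val s) := rfl

@[simp] theorem run_put (L : Fin n → List (Fin n)) (a : ℕ) (i e : Expr) (s : Store) :
    (put a i e).run L s = s.setArr a (i.val s) (e.val s) := rfl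

@[simp] theorem run_seq (L : Fin n → List (Fin n)) (c d : Cmd) (s : Store) :
    (c ;; d).run L s = d.run L (c.run L s) := rfl

@[simp] theorem run_ite (L : Fin n → List (Fin n)) (e : Expr) (c d : Cmd) (s : Store) :
    (ite e c d).run L s = if e.val s = 0 then d.run L s else c.run L s := by
  simp [run]

/-- An upper bound for the running time of a command. -/
def time (L : Fin n → List (Fin n)) : Cmd → Store → ℕ
  | .nop, _ => 1
  | .set _ e, _ => e.cost + 1
  | .put _ i e, _ => i.cost + e.cost + 1
  | .seq c d, s => c.time L s + d.time L (c.run L s)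
  | .ite e c d, s => e.cost + 1 + if e.val s ≠ 0 then c.time L s else d.time L s
  | .forV x c, s => 16 + loopTime (c.run L) (c.time L) x (List.finRange n) s
  | .forN x y c, s => 16 + loopTime (c.run L) (c.time L) y (nbrs L (s.reg x)) s

/-- The registers that a command may write. -/
def wr : Cmd → List ℕ
  | .nop => []
  | .set x _ => [x]
  | .put _ _ _ => []
  | .seq c d => c.wr ++ d.wr
  | .ite _ c d => c.wr ++ d.wr
  | .forV x c => x :: c.wr
  | .forN _ y c => y :: c.wr

/-- The arrays that a command may write. -/
def wa : Cmd → List ℕ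
  | .nop => []
  | .set _ _ => []
  | .put a _ _ => [a]
  | .seq c d => c.wa ++ d.wa
  | .ite _ c d => c.wa ++ d.wa
  | .forV _ c => c.wa
  | .forN _ _ c => c.wa

/-- Frame rule for registers. The list of writable registers of a concrete command is computable, so
the side condition is usually settled by `decide`; `run_arr` plays the same role for arrays. -/
theorem run_reg (L : Fin n → List (Fin n)) {y : ℕ} :
    ∀ (c : Cmd) (s : Store), y ∉ c.wr → (c.run L s).reg y = s.reg y := by
  intro c
  induction c with
  | nop => intro s _; rfl
  | set x e =>
    intro s h
    simp only [wr, List.mem_singleton] at h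
    simp [run, Store.setReg, h]
  | put a i e => intro s _; rfl
  | seq c d ihc ihd =>
    intro s h
    simp only [wr, List.mem_append, not_or] at h
    simp only [run]
    rw [ihd _ h.2, ihc _ h.1]
  | ite e c d ihc ihd =>
    intro s h
    simp only [wr, List.mem_append, not_or] at h
    simp only [run]
    split_ifs
    · exact ihc _ h.1
    · exact ihd _ h.2
  | forV x c ih =>
    intro s h
    simp only [wr, List.mem_cons, not_or] at h
    simp only [run]
    induction List.finRange n generalizing s with
    | nil => rfl
    | cons v l ihl =>
      rw [List.foldl_cons, ihl, ih _ h.2]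
      simp [Store.setReg, h.1]
  | forN x z c ih =>
    intro s h
    simp only [wr, List.mem_cons, not_or] at h
    simp only [run]
    induction nbrs L (s.reg x) generalizing s with
    | nil => rfl
    | cons v l ihl =>
      rw [List.foldl_cons, ihl, ih _ h.2]
      simp [Store.setReg, h.1]

theorem run_arr (L : Fin n → List (Fin n)) {a : ℕ} :
    ∀ (c : Cmd) (s : Store), a ∉ c.wa → (c.run L s).arr a = s.arr a := by
  intro c
  induction c with
  | nop => intro s _; rfl
  | set x e => intro s _; rfl
  | put b i e =>
    intro s h
    simp only [wa, List.mem_singleton] at h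
    simp [run, Store.setArr, h]
  | seq c d ihc ihd =>
    intro s h
    simp only [wa, List.mem_append, not_or] at h
    simp only [run]
    rw [ihd _ h.2, ihc _ h.1]
  | ite e c d ihc ihd =>
    intro s h
    simp only [wa, List.mem_append, not_or] at h
    simp only [run]
    split_ifs
    · exact ihc _ h.1
    · exact ihd _ h.2
  | forV x c ih =>
    intro s h
    simp only [wa] at h
    simp only [run]
    induction List.finRange n generalizing s with
    | nil => rfl
    | cons v l ihl =>
      rw [List.foldl_cons, ihl, ih _ h]
      rfl
  | forN x z c ih =>
    intro s h
    simp only [wa] at h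
    simp only [run]
    induction nbrs L (s.reg x) generalizing s with
    | nil => rfl
    | cons v l ihl =>
      rw [List.foldl_cons, ihl, ih _ h]
      rfl

/-- Invariants of loops. -/
theorem loop_induct (L : Fin n → List (Fin n)) (c : Cmd) (x : ℕ) (l : List (Fin n)) (s : Store)
    (I : List (Fin n) → Store → ℕ → Prop) (h0 : I [] s 0)
    (hstep : ∀ (pre : List (Fin n)) (v : Fin n) (post : List (Fin n)) (s' : Store) (T : ℕ),
      l = pre ++ v :: post → (∀ a, a ∉ c.wa → s'.arr a = s.arr a) →
      (∀ y, y ≠ x → y ∉ c.wr → s'.reg y = s.reg y) → I pre s' T →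
      I (pre ++ [v]) (c.run L (s'.setReg x v)) (T + (12 + c.time L (s'.setReg x v)))) :
    I l (l.foldl (fun s (v : Fin n) => c.run L (s.setReg x v)) s)
      (loopTime (c.run L) (c.time L) x l s) := by
  suffices ∀ (post pre : List (Fin n)) (s' : Store) (T : ℕ), l = pre ++ post →
      (∀ a, a ∉ c.wa → s'.arr a = s.arr a) → (∀ y, y ≠ x → y ∉ c.wr → s'.reg y = s.reg y) →
      I pre s' T → I l (post.foldl (fun s (v : Fin n) => c.run L (s.setReg x v)) s')
        (T + loopTime (c.run L) (c.time L) x post s') by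
    have := this l [] s 0 rfl (fun _ _ => rfl) (fun _ _ _ => rfl) h0
    rwa [Nat.zero_add] at this
  intro post
  induction post with
  | nil =>
    intro pre s' T hl _ _ hI
    simp only [List.append_nil] at hl
    subst hl
    exact hI
  | cons v post ih =>
    intro pre s' T hl ha hr hI
    have := ih (pre ++ [v]) (c.run L (s'.setReg x v)) (T + (12 + c.time L (s'.setReg x v)))
      (by simp [hl]) (fun a h => by rw [run_arr L _ _ h]; exact ha a h)
      (fun y h h' => by
        rw [run_reg L _ _ h']
        simp only [Store.setReg, if_neg h]
        exact hr y h h') (hstep pre v post s' T hl ha hr hI)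
    rw [Nat.add_assoc] at this
    exact this

/-- Invariants of vertex loops, with time. -/
theorem forV_induct_time (L : Fin n → List (Fin n)) (c : Cmd) (x : ℕ) (s : Store)
    (I : ℕ → Store → ℕ → Prop) (h0 : I 0 s 0)
    (hstep : ∀ (v : Fin n) (s' : Store) (T : ℕ), (∀ a, a ∉ c.wa → s'.arr a = s.arr a) →
      (∀ y, y ≠ x → y ∉ c.wr → s'.reg y = s.reg y) → I v s' T →
      I (v + 1) (c.run L (s'.setReg x v)) (T + (12 + c.time L (s'.setReg x v)))) :
    ∃ T, (forV x c).time L s = 16 + T ∧ I n ((forV x c).run L s) T := by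
  refine ⟨_, rfl, ?_⟩
  have := loop_induct L c x (List.finRange n) s (fun l s T => I l.length s T) h0 (by
    intro pre v post s' T hl ha hr hI
    have hv : (v : ℕ) = pre.length := by
      have h1 : (List.finRange n)[pre.length]? = some v := by simp [hl]
      rw [List.getElem?_eq_some_iff] at h1
      obtain ⟨h2, h3⟩ := h1
      simp at h3
      rw [← h3]
    have := hstep v s' T ha hr (by rw [hv]; exact hI)
    rw [hv] at this
    simpa [hv] using this)
  rw [List.length_finRange] at this
  exact this

/-- Invariants of vertex loops. -/
theorem forV_induct (L : Fin n → List (Fin n)) (c : Cmd) (x : ℕ) (s : Store)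
    (I : ℕ → Store → Prop) (h0 : I 0 s)
    (hstep : ∀ (v : Fin n) (s' : Store), (∀ a, a ∉ c.wa → s'.arr a = s.arr a) →
      (∀ y, y ≠ x → y ∉ c.wr → s'.reg y = s.reg y) → I v s' →
      I (v + 1) (c.run L (s'.setReg x v))) :
    I n ((forV x c).run L s) := by
  obtain ⟨T, -, h⟩ := forV_induct_time L c x s (fun k s _ => I k s) h0
    (fun v s' _ ha hr hI => hstep v s' ha hr hI)
  exact h

/-- Invariants of neighbour loops. -/
theorem forN_induct (L : Fin n → List (Fin n)) (c : Cmd) (x y : ℕ) (s : Store) (u : Fin n)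
    (hu : s.reg x = u) (I : List (Fin n) → Store → Prop) (h0 : I [] s)
    (hstep : ∀ (pre : List (Fin n)) (v : Fin n) (post : List (Fin n)) (s' : Store),
      L u = pre ++ v :: post → (∀ a, a ∉ c.wa → s'.arr a = s.arr a) →
      (∀ z, z ≠ y → z ∉ c.wr → s'.reg z = s.reg z) → I pre s' →
      I (pre ++ [v]) (c.run L (s'.setReg y v))) :
    I (L u) ((forN x y c).run L s) := by
  have := loop_induct L c y (L u) s (fun l s _ => I l s) h0
    (fun pre v post s' _ hl ha hr hI => hstep pre v post s' hl ha hr hI)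
  simpa [run, hu] using this

/-! ### Linear time -/

/-- A constant: the time of a command counts as linear if it is at most this constant times the
size of the graph. -/
def weight : Cmd → ℕ
  | .nop => 1
  | .set _ e => e.cost + 1
  | .put _ i e => i.cost + e.cost + 1
  | .seq c d => c.weight + d.weight
  | .ite e c d => e.cost + 1 + (c.weight + d.weight)
  | .forV _ c => 28 + c.weight
  | .forN _ _ c => 28 + c.weight

/-- Commands without loops. -/
def flat : Cmd → Bool
  | .nop => true
  | .set _ _ => true
  | .put _ _ _ => true
  | .seq c d => c.flat && d.flat
  | .ite _ c d => c.flat && d.flat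
  | .forV _ _ => false
  | .forN _ _ _ => false

/-- Commands that do not change register `x` and loop over the neighbours of the vertex in `x`
only. -/
def scans (x : ℕ) : Cmd → Bool
  | .nop => true
  | .set y _ => y != x
  | .put _ _ _ => true
  | .seq c d => c.scans x && d.scans x
  | .ite _ c d => c.scans x && d.scans x
  | .forV _ _ => false
  | .forN y z c => y == x && z != x && c.flat

theorem time_le_of_flat (L : Fin n → List (Fin n)) :
    ∀ (c : Cmd) (s : Store), c.flat → c.time L s ≤ c.weight := by
  intro c
  induction c with
  | nop => intro s _; exact le_rfl
  | set x e => intro s _; exact le_rfl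
  | put a i e => intro s _; exact le_rfl
  | seq c d ihc ihd =>
    intro s h
    simp only [flat, Bool.and_eq_true] at h
    exact Nat.add_le_add (ihc _ h.1) (ihd _ h.2)
  | ite e c d ihc ihd =>
    intro s h
    simp only [flat, Bool.and_eq_true] at h
    have h1 := ihc s h.1
    have h2 := ihd s h.2
    simp only [time, weight]
    split_ifs <;> omega
  | forV x c ih => intro s h; simp [flat] at h
  | forN x y c ih => intro s h; simp [flat] at h

theorem loopTime_le (f : Store → Store) (t : Store → ℕ) (x : ℕ) (w : ℕ) (h : ∀ s, t s ≤ w)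
    (l : List (Fin n)) (s : Store) : loopTime f t x l s ≤ (12 + w) * l.length := by
  induction l generalizing s with
  | nil => simp [loopTime]
  | cons v l ih =>
    have h1 := ih (f (s.setReg x v))
    have h2 := h (s.setReg x v)
    simp only [loopTime, List.length_cons, Nat.mul_add]
    omega

/-- Register `x` stays fixed, so every neighbour loop in `c` runs over the same list. The number of
such loops and the cost of their loop-free bodies are absorbed by `c.weight`. -/
theorem time_le_of_scans (L : Fin n → List (Fin n)) (x : ℕ) :
    ∀ (c : Cmd) (s : Store), c.scans x → x ∉ c.wr →
      c.time L s ≤ c.weight * (1 + (nbrs L (s.reg x)).length) := by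
  intro c
  induction c with
  | nop => intro s _ _; simp [time, weight]
  | set y e => intro s _ _; exact Nat.le_mul_of_pos_right _ (by omega)
  | put a i e => intro s _ _; exact Nat.le_mul_of_pos_right _ (by omega)
  | seq c d ihc ihd =>
    intro s h hw
    simp only [scans, Bool.and_eq_true] at h
    simp only [wr, List.mem_append, not_or] at hw
    have h1 := ihc s h.1 hw.1
    have h2 := ihd (c.run L s) h.2 hw.2
    rw [run_reg L _ _ hw.1] at h2
    simp only [time, weight, Nat.add_mul]
    omega
  | ite e c d ihc ihd =>
    intro s h hw
    simp only [scans, Bool.and_eq_true] at h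
    simp only [wr, List.mem_append, not_or] at hw
    have h1 := ihc s h.1 hw.1
    have h2 := ihd s h.2 hw.2
    have h3 : e.cost + 1 ≤ (e.cost + 1) * (1 + (nbrs L (s.reg x)).length) :=
      Nat.le_mul_of_pos_right _ (by omega)
    simp only [time, weight, Nat.add_mul (e.cost + 1), Nat.add_mul c.weight]
    split_ifs <;> omega
  | forV y c ih => intro s h; simp [scans] at h
  | forN y z c ih =>
    intro s h hw
    simp only [scans, Bool.and_eq_true, beq_iff_eq] at h
    obtain ⟨⟨rfl, -⟩, hf⟩ := h
    have h1 := loopTime_le (c.run L) (c.time L) z c.weight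
      (fun s => time_le_of_flat L c s hf) (nbrs L (s.reg y)) s
    simp only [time, weight]
    have h2 : (28 + c.weight) * (1 + (nbrs L (s.reg y)).length) =
      28 + c.weight + 16 * (nbrs L (s.reg y)).length +
        (12 + c.weight) * (nbrs L (s.reg y)).length := by ring
    omega

/-- The size of a graph. -/
def graphSize (L : Fin n → List (Fin n)) : ℕ := (∑ v, (1 + (L v).length)) + 1

/-- The command `c`, started in `s`, takes linear time. -/
def Linear (L : Fin n → List (Fin n)) (c : Cmd) (s : Store) : Prop :=
  c.time L s ≤ c.weight * graphSize L

theorem linear_of_flat {L : Fin n → List (Fin n)} {c : Cmd} (h : c.flat) (s : Store) :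
    Linear L c s :=
  (time_le_of_flat L c s h).trans (Nat.le_mul_of_pos_right _ (Nat.succ_pos _))

theorem Linear.seq {L : Fin n → List (Fin n)} {c d : Cmd} {s : Store} (hc : Linear L c s)
    (hd : Linear L d (c.run L s)) : Linear L (c ;; d) s := by
  unfold Linear at *
  simp only [time, weight, Nat.add_mul]
  omega

theorem Linear.ite {L : Fin n → List (Fin n)} {e : Expr} {c d : Cmd} {s : Store}
    (hc : e.val s ≠ 0 → Linear L c s) (hd : e.val s = 0 → Linear L d s) :
    Linear L (.ite e c d) s := by
  unfold Linear at *
  have h3 : e.cost + 1 ≤ (e.cost + 1) * graphSize L :=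
    Nat.le_mul_of_pos_right _ (Nat.succ_pos _)
  simp only [time, weight, Nat.add_mul (e.cost + 1), Nat.add_mul c.weight]
  by_cases h : e.val s = 0
  · have := hd h
    rw [if_neg (by simpa using h)]; omega
  · have := hc h
    rw [if_pos h]; omega

/-- A vertex loop takes linear time if its body, executed for the vertices in some order, takes time
proportional to the degrees. -/
theorem linear_forV_of_le {L : Fin n → List (Fin n)} {c : Cmd} {x : ℕ} {s : Store} {T : ℕ}
    (hT : (forV x c).time L s = 16 + T)
    (h : T ≤ ∑ v : Fin n, (12 + c.weight * (1 + (L v).length))) : Linear L (.forV x c) s := by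
  unfold Linear
  rw [hT, weight, graphSize]
  have h1 : ∑ v : Fin n, (12 + c.weight * (1 + (L v).length)) ≤
      (12 + c.weight) * ∑ v : Fin n, (1 + (L v).length) := by
    rw [Finset.mul_sum]
    refine Finset.sum_le_sum fun v _ => ?_
    have : 12 ≤ 12 * (1 + (L v).length) := Nat.le_mul_of_pos_right _ (by omega)
    rw [Nat.add_mul]; omega
  generalize (∑ v : Fin n, (1 + (L v).length)) = S at *
  have h2 : (28 + c.weight) * (S + 1) = 28 + c.weight + 16 * S + (12 + c.weight) * S := by ring
  omega

theorem linear_forV {L : Fin n → List (Fin n)} {c : Cmd} {x : ℕ} (hs : c.scans x) (hx : x ∉ c.wr)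
    (s : Store) : Linear L (.forV x c) s := by
  refine linear_forV_of_le rfl ?_
  rw [← List.sum_ofFn, List.ofFn_eq_map]
  induction List.finRange n generalizing s with
  | nil => simp [loopTime]
  | cons v l ih =>
    have h1 := time_le_of_scans L x c (s.setReg x v) hs hx
    have h2 := ih (c.run L (s.setReg x v))
    simp only [Store.setReg, ↓reduceIte, nbrs_val] at h1
    simp only [loopTime, List.map_cons, List.sum_cons]
    simp only [Store.setReg] at h2 ⊢
    omega

end Cmd

/-! ### Compilation of graph commands -/

/-- Expressions that use registers below `64` only. -/
def Expr.low : Expr → Bool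
  | .const _ => true
  | .reg x => decide (x < 64)
  | .cell _ i => i.low
  | .bin _ e f => e.low && f.low

/-- Commands that use registers below `64` only and do not write the input. -/
def Cmd.low : Cmd → Bool
  | .nop => true
  | .set x e => decide (x < 64) && decide (0 < x) && e.low
  | .put a i e => decide (1 < a) && i.low && e.low
  | .seq c d => c.low && d.low
  | .ite e c d => e.low && c.low && d.low
  | .forV x c => decide (x < 64) && decide (0 < x) && c.low
  | .forN x y c => decide (x < 64) && decide (y < 64) && decide (0 < y) && c.low

/-- A loop in which register `i` runs up to `hi`, and `x` holds the value of `e`. -/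
def countLoop (i x : ℕ) (hi e : Expr) (p : Prog) : Prog :=
  .loop (.bin .less (.reg i) hi)
    (.seq (.assign x e) (.seq p (.assign i (.bin .plus (.reg i) (.const 1)))))

/-- The program for a command. Loops at depth `d` use the registers `64 + 2 * d` and
`65 + 2 * d`. -/
def Cmd.compile : Cmd → ℕ → Prog
  | .nop, _ => .nop
  | .set x e, _ => .assign x e
  | .put a i e, _ => .put a i e
  | .seq c d, k => .seq (c.compile k) (d.compile k)
  | .ite e c d, k => .ite e (c.compile k) (d.compile k)
  | .forV x c, k => .seq (.assign (64 + 2 * k) (.const 0))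
      (countLoop (64 + 2 * k) x (.reg 0) (.reg (64 + 2 * k)) (c.compile (k + 1)))
  | .forN x y c, k => .seq (.assign (64 + 2 * k) (.cell 0 (.reg x)))
      (.seq (.assign (65 + 2 * k) (.cell 0 (.bin .plus (.reg x) (.const 1))))
        (countLoop (64 + 2 * k) y (.reg (65 + 2 * k)) (.cell 1 (.reg (64 + 2 * k)))
          (c.compile (k + 1))))

/-- The store holds the adjacency lists `L` as its input. -/
structure HasInput (L : Fin n → List (Fin n)) (s : Store) : Prop where
  reg_zero : s.reg 0 = n
  arr_zero : s.arr 0 = (inputStore L).arr 0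
  arr_one : s.arr 1 = (inputStore L).arr 1

theorem hasInput_inputStore (L : Fin n → List (Fin n)) : HasInput L (inputStore L) :=
  ⟨rfl, rfl, rfl⟩

/-- Two stores agree up to the reserved registers. -/
def Agree (s σ : Store) : Prop := s.arr = σ.arr ∧ ∀ x < 64, s.reg x = σ.reg x

theorem Agree.val {s σ : Store} (h : Agree s σ) : ∀ {e : Expr}, e.low → e.val s = e.val σ := by
  intro e
  induction e with
  | const k => intro _; rfl
  | reg x => intro hl; exact h.2 x (by simpa [Expr.low] using hl)
  | cell a i ih => intro hl; simp only [Expr.val, h.1]; rw [ih hl]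
  | bin o e f ihe ihf =>
    intro hl
    simp only [Expr.low, Bool.and_eq_true] at hl
    simp only [Expr.val]
    rw [ihe hl.1, ihf hl.2]

theorem Agree.setReg {s σ : Store} (h : Agree s σ) (x v : ℕ) :
    Agree (s.setReg x v) (σ.setReg x v) := by
  refine ⟨h.1, fun y hy => ?_⟩
  simp only [Store.setReg]
  split_ifs
  · rfl
  · exact h.2 y hy

theorem Agree.setReg_reserved {s σ : Store} (h : Agree s σ) {x : ℕ} (hx : 64 ≤ x) (v : ℕ) :
    Agree (s.setReg x v) σ := by
  refine ⟨h.1, fun y hy => ?_⟩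
  simp only [Store.setReg]
  rw [if_neg (by omega)]
  exact h.2 y hy

theorem Agree.setArr {s σ : Store} (h : Agree s σ) (a i v : ℕ) :
    Agree (s.setArr a i v) (σ.setArr a i v) := by
  refine ⟨?_, h.2⟩
  simp only [Store.setArr, h.1]

theorem HasInput.of_agree {L : Fin n → List (Fin n)} {s σ : Store} (h : HasInput L σ)
    (ha : Agree s σ) : HasInput L s :=
  ⟨by rw [ha.2 0 (by omega)]; exact h.reg_zero, by rw [ha.1]; exact h.arr_zero,
    by rw [ha.1]; exact h.arr_one⟩

theorem Cmd.not_mem_of_low : ∀ {c : Cmd}, c.low → 0 ∉ c.wr ∧ 0 ∉ c.wa ∧ 1 ∉ c.wa := by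
  intro c
  induction c with
  | nop => simp [wr, wa]
  | set x e => simp [wr, wa, low]; omega
  | put a i e => simp [wr, wa, low]; omega
  | seq c d ihc ihd => simp only [wr, wa, low, List.mem_append, Bool.and_eq_true]; tauto
  | ite e c d ihc ihd => simp only [wr, wa, low, List.mem_append, Bool.and_eq_true]; tauto
  | forV x c ih =>
    simp only [wr, wa, low, List.mem_cons, Bool.and_eq_true, decide_eq_true_eq]
    intro h
    obtain ⟨h1, h2, h3⟩ := ih h.2
    exact ⟨by rintro (h | h) <;> [omega; exact h1 h], h2, h3⟩
  | forN x y c ih =>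
    simp only [wr, wa, low, List.mem_cons, Bool.and_eq_true, decide_eq_true_eq]
    intro h
    obtain ⟨h1, h2, h3⟩ := ih h.2
    exact ⟨by rintro (h | h) <;> [omega; exact h1 h], h2, h3⟩

theorem HasInput.run {L : Fin n → List (Fin n)} {s : Store} (h : HasInput L s) {c : Cmd}
    (hc : c.low) : HasInput L (c.run L s) := by
  obtain ⟨h1, h2, h3⟩ := Cmd.not_mem_of_low hc
  exact ⟨by rw [Cmd.run_reg L c s h1]; exact h.reg_zero,
    by rw [Cmd.run_arr L c s h2]; exact h.arr_zero, by rw [Cmd.run_arr L c s h3]; exact h.arr_one⟩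

theorem HasInput.setReg {L : Fin n → List (Fin n)} {s : Store} (h : HasInput L s) {x : ℕ}
    (hx : x ≠ 0) (v : ℕ) : HasInput L (s.setReg x v) :=
  ⟨by simp only [Store.setReg, if_neg hx.symm]; exact h.reg_zero, h.arr_zero, h.arr_one⟩

/-! ### The layout of the input -/

theorem listStart_succ (L : Fin n → List (Fin n)) (v : Fin n) :
    listStart L (v + 1) = listStart L v + (L v).length := by
  have h : (List.ofFn L).take (v + 1) = (List.ofFn L).take v ++ [L v] := by
    rw [List.take_add_one]
    simp
  simp [listStart, h]

theorem getD_flatten (L : Fin n → List (Fin n)) (v : Fin n) {j : ℕ} (hj : j < (L v).length) :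
    ((List.ofFn L).flatten.map Fin.val).getD (listStart L v + j) 0 = ((L v)[j] : Fin n) := by
  have h : List.ofFn L = (List.ofFn L).take v ++ (L v :: (List.ofFn L).drop (v + 1)) := by
    conv_lhs => rw [← List.take_append_drop v (List.ofFn L)]
    rw [List.drop_eq_getElem_cons (by simp)]
    simp
  have h2 : (List.ofFn L).flatten = ((List.ofFn L).take v).flatten ++
      (L v ++ ((List.ofFn L).drop (v + 1)).flatten) := by
    conv_lhs => rw [h]
    simp
  rw [h2, List.getD_eq_getElem?_getD, List.getElem?_map, listStart,
    List.getElem?_append_right (by omega)]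
  simp [List.getElem?_append_left, hj]

theorem HasInput.start {L : Fin n → List (Fin n)} {s : Store} (h : HasInput L s) (k : ℕ) :
    s.arr 0 k = if k ≤ n then listStart L k else 0 := by
  rw [h.arr_zero]; rfl

theorem HasInput.entry {L : Fin n → List (Fin n)} {s : Store} (h : HasInput L s) (v : Fin n)
    {j : ℕ} (hj : j < (L v).length) : s.arr 1 (listStart L v + j) = ((L v)[j] : Fin n) := by
  rw [h.arr_one, ← getD_flatten L v hj]; rfl

/-! ### Correctness of the compilation -/

/-- What it means for the program `p` to implement the effect `f` in time `t`. -/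
def Implements (L : Fin n → List (Fin n)) (p : Prog) (k : ℕ) (f : Store → Store)
    (t : Store → ℕ) : Prop :=
  ∀ s σ, Agree s σ → HasInput L σ → ∃ t' s', Exec p s t' s' ∧ t' ≤ t σ ∧ Agree s' (f σ) ∧
    ∀ x, 64 ≤ x → x < 64 + 2 * k → s'.reg x = s.reg x

/-- One simulation for both kinds of loops. The predicate `P` records the part of the store on which
the bound `hi` and the expression `e` depend. The body preserves it, because it writes neither the
input nor, being compiled at depth `k + 1`, the two reserved registers of depth `k`. -/
theorem implements_countLoop {L : Fin n → List (Fin n)} {p : Prog} {k : ℕ} {f : Store → Store}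
    {t : Store → ℕ} (hp : Implements L p (k + 1) f t) (hf : ∀ σ, HasInput L σ → HasInput L (f σ))
    {x : ℕ} (hx0 : 0 < x) (hx : x < 64) {hi e : Expr} (he : e.cost ≤ 2) (hhi : hi.cost = 1)
    {K : ℕ} {val : ℕ → ℕ} (P : Store → Prop)
    (hP : ∀ s s', (∀ x, s'.arr x = s.arr x ∨ 2 ≤ x) → s'.reg 0 = s.reg 0 →
      s'.reg (65 + 2 * k) = s.reg (65 + 2 * k) → P s → P s')
    (hPhi : ∀ s, P s → hi.val s = K) (hPe : ∀ s, P s → e.val s = val (s.reg (64 + 2 * k))) :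
    ∀ (l : List (Fin n)) (i : ℕ), K = i + l.length →
      (∀ j (h : j < l.length), val (i + j) = (l[j] : Fin n)) →
      ∀ s σ, Agree s σ → HasInput L σ → P s → s.reg (64 + 2 * k) = i →
      ∃ t' s', Exec (countLoop (64 + 2 * k) x hi e p) s t' s' ∧ t' ≤ 4 + loopTime f t x l σ ∧
        Agree s' (l.foldl (fun s (v : Fin n) => f (s.setReg x v)) σ) ∧
        ∀ x, 64 ≤ x → x < 64 + 2 * k → s'.reg x = s.reg x := by
  intro l
  induction l with
  | nil =>
    intro i hK _ s σ hag _ hPs hi'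
    refine ⟨_, s, Exec.loop_false ?_, ?_, hag, fun _ _ _ => rfl⟩
    · simp only [Expr.val, BinOp.apply, hPhi s hPs, hi', hK]
      simp
    · simp only [Expr.cost, hhi]; omega
  | cons v l ih =>
    intro i hK hval s σ hag hin hPs hi'
    have hv : e.val s = v := by
      rw [hPe s hPs, hi']
      exact hval 0 (by simp)
    obtain ⟨t1, s1, h1, h2, h3, h4⟩ := hp _ _ (hag.setReg x v) (hin.setReg (by omega) v)
    have hs1i : s1.reg (64 + 2 * k) = i := by
      rw [h4 _ (by omega) (by omega)]
      simp only [Store.setReg]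
      rw [if_neg (by omega), hi']
    have hin1 := hf _ (hin.setReg hx0.ne' v)
    obtain ⟨t2, s2, g1, g2, g3, g4⟩ := ih (i + 1) (by rw [hK, List.length_cons]; omega) (by
        intro j hj
        have := hval (j + 1) (by simp; omega)
        rw [show i + 1 + j = i + (j + 1) by omega, this]
        simp)
      (s1.setReg (64 + 2 * k) (i + 1)) (f (σ.setReg x v)) (h3.setReg_reserved (by omega) _) hin1
      (by
        have hin' := hin.of_agree hag
        have hin'' := hin1.of_agree h3
        refine hP s _ (fun a => ?_) ?_ ?_ hPs
        · by_cases ha : a < 2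
          · left
            have : a = 0 ∨ a = 1 := by omega
            rcases this with rfl | rfl
            · exact hin''.arr_zero.trans hin'.arr_zero.symm
            · exact hin''.arr_one.trans hin'.arr_one.symm
          · right; omega
        · simp only [Store.setReg]
          rw [if_neg (by omega), hin''.reg_zero, hin'.reg_zero]
        · simp only [Store.setReg]
          rw [if_neg (by omega), h4 _ (by omega) (by omega)]
          simp only [Store.setReg]
          rw [if_neg (by omega)])
      (by simp [Store.setReg])
    have e1 := Exec.assign s x e
    rw [hv] at e1
    have e2 := Exec.assign s1 (64 + 2 * k) (.bin .plus (.reg (64 + 2 * k)) (.const 1))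
    have e3 : (Expr.bin .plus (.reg (64 + 2 * k)) (.const 1)).val s1 = i + 1 := by
      simp [Expr.val, BinOp.apply, hs1i]
    rw [e3] at e2
    refine ⟨_, s2, Exec.loop_true ?_ (Exec.seq e1 (Exec.seq h1 e2)) g1, ?_, g3, ?_⟩
    · simp only [Expr.val, BinOp.apply, hPhi s hPs, hi', hK]
      simp
    · simp only [Expr.cost, hhi, loopTime]
      omega
    · intro y hy hy'
      rw [g4 y hy hy']
      simp only [Store.setReg]
      rw [if_neg (by omega), h4 y hy (by omega)]
      simp only [Store.setReg]
      rw [if_neg (by omega)]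

theorem Cmd.implements (L : Fin n → List (Fin n)) :
    ∀ (c : Cmd) (k : ℕ), c.low → Implements L (c.compile k) k (c.run L) (c.time L) := by
  intro c
  induction c with
  | nop =>
    intro k _ s σ hag _
    exact ⟨_, _, Exec.nop s, le_rfl, hag, fun _ _ _ => rfl⟩
  | set x e =>
    intro k hl s σ hag _
    simp only [low, Bool.and_eq_true, decide_eq_true_eq] at hl
    refine ⟨_, _, Exec.assign s x e, le_rfl, ?_, fun y hy _ => ?_⟩
    · rw [hag.val hl.2]; exact hag.setReg _ _
    · simp only [Store.setReg]; rw [if_neg (by omega)]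
  | put a i e =>
    intro k hl s σ hag _
    simp only [low, Bool.and_eq_true, decide_eq_true_eq] at hl
    refine ⟨_, _, Exec.put s a i e, le_rfl, ?_, fun y hy _ => rfl⟩
    rw [hag.val hl.2, hag.val hl.1.2]; exact hag.setArr _ _ _
  | seq c d ihc ihd =>
    intro k hl s σ hag hin
    simp only [low, Bool.and_eq_true] at hl
    obtain ⟨t1, s1, h1, h2, h3, h4⟩ := ihc k hl.1 s σ hag hin
    obtain ⟨t2, s2, g1, g2, g3, g4⟩ := ihd k hl.2 s1 _ h3 (hin.run hl.1)
    exact ⟨_, s2, Exec.seq h1 g1, Nat.add_le_add h2 g2, g3,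
      fun y hy hy' => (g4 y hy hy').trans (h4 y hy hy')⟩
  | ite e c d ihc ihd =>
    intro k hl s σ hag hin
    simp only [low, Bool.and_eq_true] at hl
    by_cases he : e.val σ = 0
    · obtain ⟨t1, s1, h1, h2, h3, h4⟩ := ihd k hl.2 s σ hag hin
      refine ⟨_, s1, Exec.ite_false ((hag.val hl.1.1).trans he) h1, ?_, ?_, h4⟩
      · simp [time, he, h2]
      · simpa [run, he] using h3
    · obtain ⟨t1, s1, h1, h2, h3, h4⟩ := ihc k hl.1.2 s σ hag hin
      refine ⟨_, s1, Exec.ite_true (by rw [hag.val hl.1.1]; exact he) h1, ?_, ?_, h4⟩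
      · simp [time, he, h2]
      · simpa [run, he] using h3
  | forV x c ih =>
    intro k hl s σ hag hin
    simp only [low, Bool.and_eq_true, decide_eq_true_eq] at hl
    obtain ⟨t1, s1, h1, h2, h3, h4⟩ := implements_countLoop (ih (k + 1) hl.2)
      (fun σ h => h.run hl.2) hl.1.2 hl.1.1 (hi := .reg 0) (e := .reg (64 + 2 * k))
      (by simp [Expr.cost]) rfl (K := n) (val := id) (fun s => s.reg 0 = n)
      (fun s s' _ h _ h' => h.trans h') (fun s h => h) (fun s _ => rfl) (List.finRange n) 0
      (by simp) (by simp) (s.setReg (64 + 2 * k) 0) σ (hag.setReg_reserved (by omega) 0) hin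
      (by
        simp only [Store.setReg]
        rw [if_neg (by omega), hag.2 0 (by omega), hin.reg_zero])
      (by simp [Store.setReg])
    refine ⟨_, s1, Exec.seq (Exec.assign s (64 + 2 * k) (.const 0)) h1, ?_, h3, fun y hy hy' => ?_⟩
    · simp only [Expr.cost, time]; omega
    · rw [h4 y hy hy']
      simp only [Store.setReg]
      rw [if_neg (by omega)]
  | forN x y c ih =>
    intro k hl s σ hag hin
    simp only [low, Bool.and_eq_true, decide_eq_true_eq] at hl
    have hin' := hin.of_agree hag
    have hxx : s.reg x = σ.reg x := hag.2 x (by omega)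
    -- Register `x` may hold a number that is not a vertex. The end position then reads as `0`, so
    -- the loop stops at once, in agreement with the empty list of `nbrs`.
    have hst : (if σ.reg x + 1 ≤ n then listStart L (σ.reg x + 1) else 0) ≤
          (if σ.reg x ≤ n then listStart L (σ.reg x) else 0) + (nbrs L (σ.reg x)).length ∧
        (nbrs L (σ.reg x) ≠ [] → σ.reg x < n ∧
          (if σ.reg x + 1 ≤ n then listStart L (σ.reg x + 1) else 0) =
          listStart L (σ.reg x) + (nbrs L (σ.reg x)).length) := by
      by_cases hlt : σ.reg x < n
      · have h1 := listStart_succ L ⟨σ.reg x, hlt⟩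
        have h2 : nbrs L (σ.reg x) = L ⟨σ.reg x, hlt⟩ := by simp [nbrs, hlt]
        simp only at h1
        rw [if_pos (by omega), if_pos (by omega), h2, h1]
        exact ⟨le_rfl, fun _ => ⟨hlt, rfl⟩⟩
      · rw [if_neg (by omega)]
        have h2 : nbrs L (σ.reg x) = [] := by simp [nbrs, hlt]
        exact ⟨by omega, fun h => absurd h2 h⟩
    have e1 := Exec.assign s (64 + 2 * k) (.cell 0 (.reg x))
    have v1 : (Expr.cell 0 (.reg x)).val s =
        if σ.reg x ≤ n then listStart L (σ.reg x) else 0 := by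
      simp only [Expr.val]
      rw [hin'.start, hxx]
    rw [v1] at e1
    have e2 := Exec.assign
      (s.setReg (64 + 2 * k) (if σ.reg x ≤ n then listStart L (σ.reg x) else 0))
      (65 + 2 * k) (.cell 0 (.bin .plus (.reg x) (.const 1)))
    have v2 : (Expr.cell 0 (.bin .plus (.reg x) (.const 1))).val
        (s.setReg (64 + 2 * k) (if σ.reg x ≤ n then listStart L (σ.reg x) else 0)) =
        if σ.reg x + 1 ≤ n then listStart L (σ.reg x + 1) else 0 := by
      simp only [Expr.val, BinOp.apply, Store.setReg]
      rw [if_neg (by omega), hxx, hin'.start]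
    rw [v2] at e2
    generalize hlo : (if σ.reg x ≤ n then listStart L (σ.reg x) else 0) = lo at *
    generalize hup : (if σ.reg x + 1 ≤ n then listStart L (σ.reg x + 1) else 0) = up at *
    set s2 := (s.setReg (64 + 2 * k) lo).setReg (65 + 2 * k) up with hs2
    have hag2 : Agree s2 σ :=
      (hag.setReg_reserved (by omega) _).setReg_reserved (by omega) _
    have r1 : s2.reg (64 + 2 * k) = lo := by
      simp only [hs2, Store.setReg]
      rw [if_neg (by omega), if_pos trivial]
    have r2 : s2.reg (65 + 2 * k) = up := by
      simp only [hs2, Store.setReg]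
      rw [if_pos trivial]
    have r3 : ∀ z, 64 ≤ z → z < 64 + 2 * k → s2.reg z = s.reg z := by
      intro z hz hz'
      simp only [hs2, Store.setReg]
      rw [if_neg (by omega), if_neg (by omega)]
    by_cases hnil : nbrs L (σ.reg x) = []
    · refine ⟨_, s2, Exec.seq e1 (Exec.seq e2 (Exec.loop_false ?_)), ?_, ?_, r3⟩
      · simp only [Expr.val, BinOp.apply, r1, r2]
        rw [if_neg]
        have := hst.1
        rw [hnil] at this
        simpa using this
      · simp only [Expr.cost, time]; omega
      · simpa [run, hnil] using hag2
    · obtain ⟨hlt, hup'⟩ := hst.2 hnil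
      rw [if_pos hlt.le] at hlo
      have h2 : nbrs L (σ.reg x) = L ⟨σ.reg x, hlt⟩ := by simp [nbrs, hlt]
      obtain ⟨t1, s1, h1, g2, h3, h4⟩ := implements_countLoop (ih (k + 1) hl.2)
        (fun σ h => h.run hl.2) (x := y) hl.1.2 hl.1.1.2 (hi := .reg (65 + 2 * k))
        (e := .cell 1 (.reg (64 + 2 * k))) (by simp [Expr.cost]) rfl (K := up)
        (val := (inputStore L).arr 1)
        (fun s => s.arr 1 = (inputStore L).arr 1 ∧ s.reg (65 + 2 * k) = up)
        (fun s s' h _ h' h'' => ⟨by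
          rcases h 1 with h | h
          · rw [h]; exact h''.1
          · omega, h'.trans h''.2⟩)
        (fun s h => h.2) (fun s h => by simp only [Expr.val]; rw [h.1]) (nbrs L (σ.reg x)) lo
        (by rw [hup', hlo]) (by
          intro j hj
          have hj' : j < (L ⟨σ.reg x, hlt⟩).length := by rwa [h2] at hj
          have h5 := hin'.entry ⟨σ.reg x, hlt⟩ hj'
          rw [hin'.arr_one] at h5
          rw [← hlo, h5]
          simp [h2]) s2 σ hag2 hin ⟨(hin.of_agree hag2).arr_one, r2⟩ r1
      refine ⟨_, s1, Exec.seq e1 (Exec.seq e2 h1), ?_, h3, fun z hz hz' => ?_⟩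
      · simp only [Expr.cost, time]; omega
      · rw [h4 z hz hz', r3 z hz hz']

/-- The degrees sum to twice the number of edges, and a nonempty vertex set absorbs the extra unit
in `Cmd.graphSize`. -/
theorem graphSize_le {G : SimpleGraph (Fin n)} {L : Fin n → List (Fin n)} (hL : IsAdjLists G L)
    (hn : 0 < n) : Cmd.graphSize L ≤ 2 * (n + G.edgeSet.ncard) := by
  classical
  have h1 : ∀ v, (L v).length = G.degree v := by
    intro v
    rw [← List.toFinset_card_of_nodup (hL v).1, ← G.card_neighborFinset_eq_degree]
    congr 1
    ext u
    simp [(hL v).2 u]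
  have h2 := G.sum_degrees_eq_twice_card_edges
  have h3 : G.edgeSet.ncard = G.edgeFinset.card := by
    rw [← SimpleGraph.coe_edgeFinset, Set.ncard_coe_finset]
  simp only [Cmd.graphSize, h1, Finset.sum_add_distrib, h2, h3]
  simp
  omega

theorem inputStore_le {L : Fin n → List (Fin n)} : (inputStore L).LE (2 * Cmd.graphSize L) := by
  have hlen : (List.ofFn L).flatten.length + n ≤ Cmd.graphSize L := by
    rw [List.length_flatten, List.map_ofFn, List.sum_ofFn, Cmd.graphSize]
    simp [Finset.sum_add_distrib]
    omega
  constructor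
  · intro x
    simp only [inputStore]
    split_ifs <;> omega
  · intro a i
    simp only [inputStore]
    split_ifs with h1 h2 h3
    · have : listStart L i ≤ (List.ofFn L).flatten.length := by
        simp only [listStart]
        conv_rhs => rw [← List.take_append_drop i (List.ofFn L), List.flatten_append]
        rw [List.length_append]
        omega
      omega
    · omega
    · rw [List.getD_eq_getElem?_getD]
      by_cases h : i < (List.ofFn L).flatten.length
      · have := ((List.ofFn L).flatten[i]).isLt
        simp only [List.getElem?_map, List.getElem?_eq_getElem h, Option.map_some, Option.getD_some]
        omega
      · rw [List.getElem?_eq_none (by rw [List.length_map]; omega)]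
        simp
    · omega

/-- Linear time algorithms may be given as graph commands. -/
theorem linearTimeOn_of_cmd {C : ∀ n : ℕ, SimpleGraph (Fin n) → Prop}
    {f : ∀ n : ℕ, SimpleGraph (Fin n) → Fin n → ℕ∞} (c : Cmd) (hl : c.low)
    (ht : (c.compile 0).tame) (hC : ∀ n G, C n G → 0 < n)
    (h : ∀ (n : ℕ) (G : SimpleGraph (Fin n)), C n G → ∀ L, IsAdjLists G L →
      Cmd.Linear L c (inputStore L) ∧
        ∀ v : Fin n, ((c.run L (inputStore L)).arr 2 v : ℕ∞) = f n G v) :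
    LinearTimeOn C f := by
  -- With `N = n + m` the graph size is at most `2 * N`, which gives the time bound. All words stay
  -- at most `2 * graphSize + 4 * t ≤ (8 * c.weight + 4) * N`, and `8 * c.weight + 4 ≤ 2 ^ (8 *
  -- c.weight + 2)` turns the constant factor into a power of `N + 2`.
  refine ⟨c.compile 0, 2 * c.weight, 8 * c.weight + 3, fun n G hG L hL => ?_⟩
  obtain ⟨h1, h2⟩ := h n G hG L hL
  obtain ⟨t, s, hex, hts, hag, -⟩ := c.implements L 0 hl (inputStore L) (inputStore L)
    ⟨rfl, fun _ _ => rfl⟩ (hasInput_inputStore L)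
  have hsize := graphSize_le hL (hC n G hG)
  have h3 : c.weight * Cmd.graphSize L ≤ c.weight * (2 * (n + G.edgeSet.ncard)) :=
    Nat.mul_le_mul_left _ hsize
  unfold Cmd.Linear at h1
  have hle := inputStore_le (L := L)
  refine ⟨t, s, (hex.runs ht hle ?_).1, by
    rw [Nat.mul_comm 2, Nat.mul_assoc]; omega, fun v => by rw [hag.1]; exact h2 v⟩
  generalize n + G.edgeSet.ncard = N at *
  have h4 : 2 * Cmd.graphSize L + 4 * t ≤ (8 * c.weight + 4) * N := by
    have : (8 * c.weight + 4) * N = 4 * (c.weight * (2 * N)) + 4 * N := by ring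
    omega
  have h5 : (8 * c.weight + 4) * N < (8 * c.weight + 4) * (N + 2) :=
    Nat.mul_lt_mul_of_pos_left (by omega) (by omega)
  have h6 : 8 * c.weight + 4 ≤ (N + 2) ^ (8 * c.weight + 2) := by
    have h7 : 8 * c.weight + 4 ≤ 2 ^ (8 * c.weight + 2) := by
      have : ∀ k : ℕ, k + 2 + 2 ≤ 2 ^ (k + 2) := by
        intro k
        induction k with
        | zero => norm_num
        | succ k ih => rw [show k + 1 + 2 = (k + 2) + 1 by omega, pow_succ]; omega
      have := this (8 * c.weight)
      omega
    exact h7.trans (Nat.pow_le_pow_left (by omega) _)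
  have h8 : (8 * c.weight + 4) * (N + 2) ≤ (N + 2) ^ (8 * c.weight + 3) := by
    rw [show 8 * c.weight + 3 = (8 * c.weight + 2) + 1 by omega, pow_succ]
    exact Nat.mul_le_mul_right _ h6
  omega

/-! ### Breadth-first search -/

/-- The increment of an expression. -/
def Expr.inc (e : Expr) : Expr := .bin .plus e (.const 1)

@[simp] theorem Expr.val_inc (s : Store) (e : Expr) : e.inc.val s = e.val s + 1 := rfl

/-- Initialization of breadth-first search from the vertices marked in array `12`. After the search
array `10` holds the distances plus the content of register `1`, and array `11` holds the vertices
in the order of their distances. -/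
def bfsInit : Cmd :=
  .set 2 (.const 0) ;;
  .forV 3 (.ite (.cell 12 (.reg 3))
    (.put 10 (.reg 3) (.reg 1) ;; .put 11 (.reg 2) (.reg 3) ;; .set 2 (Expr.inc (.reg 2)))
    (.put 10 (.reg 3) (.const 0)))

/-- The visit of a neighbour in a search. -/
def bfsVisit : Cmd :=
  .ite (.cell 10 (.reg 5)) .nop
    (.put 10 (.reg 5) (Expr.inc (.cell 10 (.reg 4))) ;; .put 11 (.reg 2) (.reg 5) ;;
      .set 2 (Expr.inc (.reg 2)))

/-- Breadth-first search, see `bfsInit`. -/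
def bfs : Cmd :=
  bfsInit ;; .forV 3 (.set 4 (.cell 11 (.reg 3)) ;; .forN 4 5 bfsVisit)

/-- The state of a search after the first `h` entries of the queue `l` have been processed. -/
structure QueueInv (G : SimpleGraph (Fin n)) (S : Set (Fin n)) (D : Fin n → ℕ) (l : List (Fin n))
    (h : ℕ) : Prop where
  nodup : l.Nodup
  sorted : l.Pairwise (fun a b => D a ≤ D b)
  src : ∀ v ∈ S, v ∈ l
  closed : ∀ i (hi : i < l.length), i < h → ∀ y, G.Adj l[i] y → y ∈ l
  near : ∀ hh : h < l.length, ∀ a ∈ l, D a ≤ D l[h] + 1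
  le : h ≤ l.length

namespace QueueInv

variable {G : SimpleGraph (Fin n)} {S : Set (Fin n)} {D : Fin n → ℕ} {l : List (Fin n)} {h : ℕ}

/-- Follow predecessors towards `S`. By induction the predecessor of `x` is in the queue, and being
strictly closer to `S` than the head it stands before it, so its neighbours have already been
entered. Vertices still missing are therefore farther than the head. -/
theorem mem_of_le (hq : QueueInv G S D l h) (hc : G.Connected) (hD : G.IsDistTo S D)
    (hh : h < l.length) {x : Fin n} (hx : D x ≤ D l[h]) : x ∈ l := by
  induction hk : D x using Nat.strong_induction_on generalizing x with
  | _ k ih =>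
    by_cases h0 : D x = 0
    · exact hq.src x ((hD.eq_zero_iff hc).1 h0)
    · obtain ⟨u, hu, hux⟩ := hD.exists_pred hc h0
      have hul := ih (D u) (by omega) (by omega) rfl
      obtain ⟨i, hi, rfl⟩ := List.getElem_of_mem hul
      refine hq.closed i hi ?_ x hu
      by_contra hle
      rcases Nat.lt_or_eq_of_le (not_lt.1 hle) with hlt | rfl
      · have := List.pairwise_iff_getElem.1 hq.sorted h i hh hi hlt
        omega
      · omega

/-- A completely processed queue contains `S` and is closed under adjacency, hence contains all
vertices. In a connected graph the queue thus never runs empty early, and a loop with exactly `n`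
rounds performs the search. -/
theorem lt_length (hq : QueueInv G S D l h) (hc : G.Connected) (hD : G.IsDistTo S D)
    (hh : h < n) : h < l.length := by
  by_contra hlt
  have he : h = l.length := by have := hq.le; omega
  have hall : ∀ x, x ∈ l := by
    intro x
    induction hk : D x using Nat.strong_induction_on generalizing x with
    | _ k ih =>
      by_cases h0 : D x = 0
      · exact hq.src x ((hD.eq_zero_iff hc).1 h0)
      · obtain ⟨u, hu, hux⟩ := hD.exists_pred hc h0
        have hul := ih (D u) (by omega) u rfl
        obtain ⟨i, hi, rfl⟩ := List.getElem_of_mem hul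
        exact hq.closed i hi (by omega) x hu
  have h1 : l.toFinset = Finset.univ := by ext x; simp [hall x]
  have h2 := List.toFinset_card_of_nodup hq.nodup
  rw [h1, Finset.card_univ, Fintype.card_fin] at h2
  omega

/-- New entries lie one level beyond the head and nothing in the queue lies farther, so appending
them keeps the queue sorted and within two consecutive levels. -/
theorem extend (hq : QueueInv G S D l h) (hh : h < l.length) {ext : List (Fin n)}
    (hnd : (l ++ ext).Nodup) (hext : ∀ a ∈ ext, D a = D l[h] + 1)
    (hmem : ∀ y, G.Adj l[h] y → y ∈ l ++ ext) : QueueInv G S D (l ++ ext) (h + 1) := by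
  have hsorted : (l ++ ext).Pairwise (fun a b => D a ≤ D b) := by
    rw [List.pairwise_append]
    refine ⟨hq.sorted, ?_, fun a ha b hb => ?_⟩
    · rw [List.pairwise_iff_forall_sublist]
      intro a b hab
      rw [hext a (hab.subset (by simp)), hext b (hab.subset (by simp))]
    · rw [hext b hb]
      exact hq.near hh a ha
  refine ⟨hnd, hsorted, fun v hv => List.mem_append_left _ (hq.src v hv), ?_, ?_, by simp; omega⟩
  · intro i hi hih y hy
    rcases Nat.lt_or_eq_of_le (Nat.lt_succ_iff.1 hih) with hlt | rfl
    · rw [List.getElem_append_left (by omega)] at hy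
      exact List.mem_append_left _ (hq.closed i _ hlt y hy)
    · rw [List.getElem_append_left hh] at hy
      exact hmem y hy
  · intro hh' a ha
    have h1 : D a ≤ D l[h] + 1 := by
      rcases List.mem_append.1 ha with ha | ha
      · exact hq.near hh a ha
      · exact (hext a ha).le
    have h2 := List.pairwise_iff_getElem.1 hsorted h (h + 1) (by simp; omega) hh' (by omega)
    rw [List.getElem_append_left hh] at h2
    omega

end QueueInv

/-- The part of the store used by the search represents the queue `l`. -/
structure QueueRep (D : Fin n → ℕ) (b : ℕ) (l : List (Fin n)) (s : Store) : Prop where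
  tail : s.reg 2 = l.length
  queue : ∀ i (h : i < l.length), s.arr 11 i = (l[i] : Fin n)
  dist : ∀ v : Fin n, s.arr 10 v = if v ∈ l then D v + b else 0

/-- The result of a search. -/
structure Searched (D : Fin n → ℕ) (b : ℕ) (l : List (Fin n)) (s : Store) : Prop where
  nodup : l.Nodup
  length : l.length = n
  sorted : l.Pairwise (fun a b => D a ≤ D b)
  queue : ∀ i (h : i < l.length), s.arr 11 i = (l[i] : Fin n)
  dist : ∀ v : Fin n, s.arr 10 v = D v + b

theorem Searched.mem {D : Fin n → ℕ} {b : ℕ} {l : List (Fin n)} {s : Store}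
    (h : Searched D b l s) (v : Fin n) : v ∈ l := by
  have h2 := List.toFinset_card_of_nodup h.nodup
  have h1 : l.toFinset = Finset.univ := by
    rw [← Finset.card_eq_iff_eq_univ, h2, h.length, Fintype.card_fin]
  rw [← List.mem_toFinset, h1]
  exact Finset.mem_univ v

theorem Searched.sum_eq {D : Fin n → ℕ} {b : ℕ} {l : List (Fin n)} {s : Store}
    (h : Searched D b l s) (f : Fin n → ℕ) : (l.map f).sum = ∑ v, f v := by
  rw [← List.sum_toFinset f h.nodup]
  congr 1
  ext v
  simp [h.mem v]

theorem bfsInit_spec (L : Fin n → List (Fin n)) (D : Fin n → ℕ) (S : Set (Fin n)) (s : Store)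
    (hS : ∀ v : Fin n, s.arr 12 v ≠ 0 ↔ v ∈ S) (hD : ∀ v, D v = 0 ↔ v ∈ S) :
    ∃ l, QueueRep D (s.reg 1) l (bfsInit.run L s) ∧ l.Nodup ∧ ∀ v, v ∈ l ↔ v ∈ S := by
  have key := Cmd.forV_induct L (.ite (.cell 12 (.reg 3))
    (.put 10 (.reg 3) (.reg 1) ;; .put 11 (.reg 2) (.reg 3) ;; .set 2 (Expr.inc (.reg 2)))
    (.put 10 (.reg 3) (.const 0))) 3 (s.setReg 2 0)
    (fun k s' => ∃ l : List (Fin n), s'.reg 2 = l.length ∧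
      (∀ i (h : i < l.length), s'.arr 11 i = (l[i] : Fin n)) ∧
      (∀ v : Fin n, v < k → s'.arr 10 v = if v ∈ l then D v + s.reg 1 else 0) ∧ l.Nodup ∧
      ∀ v : Fin n, v ∈ l ↔ (v : ℕ) < k ∧ v ∈ S)
    ⟨[], by simp, by simp, by simp, by simp, by simp⟩ (by
      rintro v s' ha hr ⟨l, h1, h2, h3, h4, h5⟩
      have e12 : s'.arr 12 = s.arr 12 := ha 12 (by decide)
      have e1 : s'.reg 1 = s.reg 1 := hr 1 (by decide) (by decide)
      by_cases hv : v ∈ S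
      · have h12 : s.arr 12 v ≠ 0 := (hS v).2 hv
        have hvl : v ∉ l := by rw [h5]; omega
        refine ⟨l ++ [v], ?_, ?_, ?_, ?_, ?_⟩
        · simp [e12, h12, h1]
        · intro i hi
          simp only [List.length_append, List.length_singleton] at hi
          rcases Nat.lt_or_eq_of_le (Nat.lt_succ_iff.1 hi) with hlt | rfl
          · simp [e12, h12, h1, List.getElem_append_left hlt, hlt.ne, h2 i hlt]
          · simp [e12, h12, h1]
        · intro w hw
          by_cases hwv : w = v
          · subst hwv
            simp [e12, h12, e1, (hD w).2 hv]
          · have hne : (w : ℕ) ≠ v := fun h => hwv (Fin.ext h)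
            simp [e12, h12, hwv, hne, h3 w (by omega)]
        · simp [List.nodup_append, h4]
          rintro a ha rfl
          exact hvl ha
        · intro w
          simp only [List.mem_append, List.mem_singleton, h5]
          constructor
          · rintro (⟨h, h'⟩ | rfl)
            · exact ⟨by omega, h'⟩
            · exact ⟨by omega, hv⟩
          · rintro ⟨h, h'⟩
            by_cases hwv : w = v
            · exact Or.inr hwv
            · have hne : (w : ℕ) ≠ v := fun h => hwv (Fin.ext h)
              exact Or.inl ⟨by omega, h'⟩
      · have h12 : s.arr 12 v = 0 := by
          by_contra h
          exact hv ((hS v).1 h)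
        refine ⟨l, ?_, ?_, ?_, h4, ?_⟩
        · simp [e12, h12, h1]
        · intro i hi
          simp [e12, h12, h2 i hi]
        · intro w hw
          by_cases hwv : w = v
          · subst hwv
            simp [e12, h12, h5]
          · have hne : (w : ℕ) ≠ v := fun h => hwv (Fin.ext h)
            simp [e12, h12, hne, h3 w (by omega)]
        · intro w
          rw [h5]
          constructor
          · rintro ⟨h, h'⟩
            exact ⟨by omega, h'⟩
          · rintro ⟨h, h'⟩
            have hne : (w : ℕ) ≠ v := fun h => hv (Fin.ext h ▸ h')
            exact ⟨by omega, h'⟩)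
  obtain ⟨l, h1, h2, h3, h4, h5⟩ := key
  exact ⟨l, ⟨h1, h2, fun v => h3 v v.isLt⟩, h4, fun v => by rw [h5]; simp⟩

/-- An entry `0` in array `10` means that a vertex has not been found yet. The start value `b` is
nonzero in order that entries of found vertices can be told apart from it. -/
theorem bfsVisit_spec {G : SimpleGraph (Fin n)} {L : Fin n → List (Fin n)} (hL : IsAdjLists G L)
    {D : Fin n → ℕ} {b : ℕ} (hb : b ≠ 0) {l : List (Fin n)} {v : Fin n} (hv : v ∈ l)
    (hfar : ∀ y, G.Adj v y → y ∉ l → D y = D v + 1) (hnd : l.Nodup) {s : Store}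
    (hs4 : s.reg 4 = v) (hs : QueueRep D b l s) :
    ∃ ext, QueueRep D b (l ++ ext) ((Cmd.forN 4 5 bfsVisit).run L s) ∧ (l ++ ext).Nodup ∧
      (∀ a ∈ ext, D a = D v + 1) ∧ ∀ y, G.Adj v y → y ∈ l ++ ext := by
  have key := Cmd.forN_induct L bfsVisit 4 5 s v hs4
    (fun pre s' => ∃ ext, QueueRep D b (l ++ ext) s' ∧ (l ++ ext).Nodup ∧
      (∀ a ∈ ext, D a = D v + 1) ∧ ∀ y ∈ pre, y ∈ l ++ ext)
    ⟨[], by simpa using hs, by simpa using hnd, by simp, by simp⟩ (by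
      rintro pre y post s' hpre - hr ⟨ext, h1, h2, h3, h4⟩
      have hvy : G.Adj v y := ((hL v).2 y).1 (by rw [hpre]; simp)
      have e4 : s'.reg 4 = v := (hr 4 (by decide) (by decide)).trans hs4
      by_cases hy : y ∈ l ++ ext
      · have h10 : s'.arr 10 y ≠ 0 := by
          rw [h1.dist, if_pos hy]; omega
        have hrun : bfsVisit.run L (s'.setReg 5 y) = s'.setReg 5 y := by
          simp [bfsVisit, h10]
        rw [hrun]
        refine ⟨ext, ⟨h1.tail, h1.queue, h1.dist⟩, h2, h3, fun x hx => ?_⟩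
        rcases List.mem_append.1 hx with hx | hx
        · exact h4 x hx
        · rw [List.mem_singleton.1 hx]; exact hy
      · have h10 : s'.arr 10 y = 0 := by rw [h1.dist, if_neg hy]
        have hv10 : s'.arr 10 v = D v + b := by
          rw [h1.dist, if_pos (List.mem_append_left _ hv)]
        have hDy := hfar y hvy (fun h => hy (List.mem_append_left _ h))
        refine ⟨ext ++ [y], ?_, ?_, ?_, ?_⟩
        · rw [← List.append_assoc]
          have ht := h1.tail
          refine ⟨?_, ?_, ?_⟩
          · simp [bfsVisit, h10, ht, Nat.add_assoc]
          · intro i hi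
            rw [List.length_append, List.length_singleton] at hi
            rcases Nat.lt_or_eq_of_le (Nat.lt_succ_iff.1 hi) with hlt | rfl
            · rw [List.getElem_append_left hlt]
              have hne : i ≠ l.length + ext.length := by simpa using hlt.ne
              simp [bfsVisit, h10, ht, hne, h1.queue i hlt]
            · simp [bfsVisit, h10, ht]
          · intro w
            by_cases hwy : w = y
            · subst hwy
              simp [bfsVisit, h10, e4, hv10, hDy]; omega
            · have hne : (w : ℕ) ≠ y := fun h => hwy (Fin.ext h)
              have := h1.dist w
              simp [bfsVisit, h10, hne, hwy, this]
        · rw [← List.append_assoc, List.nodup_append]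
          refine ⟨h2, by simp, ?_⟩
          rintro a ha c hc rfl
          rw [List.mem_singleton.1 hc] at ha
          exact hy ha
        · intro a ha
          rcases List.mem_append.1 ha with ha | ha
          · exact h3 a ha
          · rw [List.mem_singleton.1 ha]; exact hDy
        · intro x hx
          rw [← List.append_assoc]
          rcases List.mem_append.1 hx with hx | hx
          · exact List.mem_append_left _ (h4 x hx)
          · exact List.mem_append_right _ hx)
  obtain ⟨ext, h1, h2, h3, h4⟩ := key
  exact ⟨ext, h1, h2, h3, fun y hy => h4 y (((hL v).2 y).2 hy)⟩

/-- The time spent so far is charged to the processed prefix of the queue. In the end the queue is a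
permutation of the vertices, so the charges add up to the sum over all vertices of their scanning
costs. -/
theorem bfs_spec {G : SimpleGraph (Fin n)} {L : Fin n → List (Fin n)} (hL : IsAdjLists G L)
    (hc : G.Connected) {S : Set (Fin n)} {D : Fin n → ℕ} (hD : G.IsDistTo S D) (s : Store)
    (hS : ∀ v : Fin n, s.arr 12 v ≠ 0 ↔ v ∈ S) (hb : s.reg 1 ≠ 0) :
    (∃ l, Searched D (s.reg 1) l (bfs.run L s)) ∧ Cmd.Linear L bfs s := by
  obtain ⟨l₀, hrep, hnd, hmem⟩ := bfsInit_spec L D S s hS (fun v => hD.eq_zero_iff hc)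
  set w := (Cmd.set 4 (.cell 11 (.reg 3)) ;; .forN 4 5 bfsVisit).weight with hw
  have hD0 : ∀ a ∈ l₀, D a = 0 := fun a ha => (hD.eq_zero_iff hc).2 ((hmem a).1 ha)
  obtain ⟨T, hT, l, hl, hq, hTl⟩ := Cmd.forV_induct_time L
    (.set 4 (.cell 11 (.reg 3)) ;; .forN 4 5 bfsVisit) 3 (bfsInit.run L s)
    (fun h s' T => ∃ l, QueueRep D (s.reg 1) l s' ∧ QueueInv G S D l h ∧
      T ≤ ((l.take h).map (fun v => 12 + w * (1 + (L v).length))).sum)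
    ⟨l₀, hrep, ⟨hnd, by
        rw [List.pairwise_iff_forall_sublist]
        intro a b hab
        rw [hD0 a (hab.subset (by simp))]
        exact Nat.zero_le _, fun v hv => (hmem v).2 hv, by simp, by
        intro hh a ha
        rw [hD0 a ha]
        exact Nat.zero_le _, Nat.zero_le _⟩, by simp⟩ (by
      rintro h s' T - - ⟨l, hrep, hq, hT⟩
      have hh := hq.lt_length hc hD h.isLt
      have hrun : (Cmd.set 4 (.cell 11 (.reg 3))).run L (s'.setReg 3 h) =
          (s'.setReg 3 h).setReg 4 l[(h : ℕ)] := by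
        simp [hrep.queue h hh]
      have hrep' : QueueRep D (s.reg 1) l ((s'.setReg 3 h).setReg 4 l[(h : ℕ)]) :=
        ⟨hrep.tail, hrep.queue, hrep.dist⟩
      obtain ⟨ext, h1, h2, h3, h4⟩ := bfsVisit_spec hL hb (List.getElem_mem hh) (by
        intro y hy hyl
        have h5 : ¬ D y ≤ D l[(h : ℕ)] := fun h => hyl (hq.mem_of_le hc hD hh h)
        have h6 := hD.le_succ_of_adj hc hy
        omega) hq.nodup (by simp) hrep'
      refine ⟨l ++ ext, ?_, hq.extend hh h2 h3 h4, ?_⟩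
      · rw [Cmd.run_seq, hrun]
        exact h1
      · rw [List.take_append_of_le_length (by omega), List.take_add_one,
          List.getElem?_eq_getElem hh]
        simp only [Option.toList_some, List.map_append, List.sum_append, List.map_cons,
          List.map_nil, List.sum_cons, List.sum_nil, Nat.add_zero]
        refine Nat.add_le_add hT (Nat.add_le_add_left ?_ _)
        have h7 := Cmd.time_le_of_scans L 4 (.forN 4 5 bfsVisit)
          ((Cmd.set 4 (.cell 11 (.reg 3))).run L (s'.setReg 3 h)) (by decide) (by decide)
        rw [hrun] at h7
        simp only [Cmd.time, Cmd.weight] at h7 hw ⊢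
        rw [hrun]
        simp only [Store.setReg_reg, ↓reduceIte, nbrs_val] at h7 ⊢
        have h8 : (Expr.cell 11 (.reg 3)).cost + 1 ≤
          ((Expr.cell 11 (.reg 3)).cost + 1) * (1 + (L l[(h : ℕ)]).length) :=
          Nat.le_mul_of_pos_right _ (by omega)
        rw [hw, Nat.add_mul]
        omega)
  have hlen : l.length = n := by
    have h1 := hq.le
    have h2 := hq.nodup.length_le_card
    rw [Fintype.card_fin] at h2
    omega
  have hsearch : Searched D (s.reg 1) l (bfs.run L s) := by
    have hall : ∀ v, v ∈ l := by
      intro v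
      have h2 := List.toFinset_card_of_nodup hq.nodup
      have h1 : l.toFinset = Finset.univ := by
        rw [← Finset.card_eq_iff_eq_univ, h2, hlen, Fintype.card_fin]
      rw [← List.mem_toFinset, h1]
      exact Finset.mem_univ v
    exact ⟨hq.nodup, hlen, hq.sorted, hl.queue, fun v => by
      have := hl.dist v
      rw [if_pos (hall v)] at this
      exact this⟩
  refine ⟨⟨l, hsearch⟩, ?_⟩
  refine Cmd.Linear.seq (Cmd.Linear.seq (Cmd.linear_of_flat (by decide) _)
    (Cmd.linear_forV (by decide) (by decide) _)) (Cmd.linear_forV_of_le hT ?_)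
  rw [← hsearch.sum_eq]
  rwa [List.take_of_length_le hlen.le] at hTl

/-- Running through the vertices in search order costs no more than running through them in
numerical order, because each vertex occurs exactly once in the queue. -/
theorem linear_queue {L : Fin n → List (Fin n)} {c : Cmd} (hs : c.scans 4) (h4 : 4 ∉ c.wr)
    (h11 : 11 ∉ c.wa) {D : Fin n → ℕ} {b : ℕ} {l : List (Fin n)} {s : Store}
    (hl : Searched D b l s) : Cmd.Linear L (.forV 3 (.set 4 (.cell 11 (.reg 3)) ;; c)) s := by
  obtain ⟨T, hT, hTl⟩ := Cmd.forV_induct_time L (.set 4 (.cell 11 (.reg 3)) ;; c) 3 s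
    (fun h _ T => T ≤ ((l.take h).map (fun v => 12 +
      (Cmd.set 4 (.cell 11 (.reg 3)) ;; c).weight * (1 + (L v).length))).sum) (by simp) (by
    intro h s' T ha _ hT
    have hh : (h : ℕ) < l.length := by rw [hl.length]; exact h.isLt
    have h1 : s'.arr 11 h = (l[(h : ℕ)] : Fin n) := by
      rw [ha 11 (by simpa [Cmd.wa] using h11), hl.queue h hh]
    rw [List.take_add_one, List.getElem?_eq_getElem hh]
    simp only [Option.toList_some, List.map_append, List.sum_append, List.map_cons,
      List.map_nil, List.sum_cons, List.sum_nil, Nat.add_zero]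
    refine Nat.add_le_add hT (Nat.add_le_add_left ?_ _)
    have h7 := Cmd.time_le_of_scans L 4 c ((s'.setReg 3 h).setReg 4 l[(h : ℕ)]) hs h4
    simp only [Store.setReg_reg, ↓reduceIte, nbrs_val] at h7
    have h8 : (Expr.cell 11 (.reg 3)).cost + 1 ≤
      ((Expr.cell 11 (.reg 3)).cost + 1) * (1 + (L l[(h : ℕ)]).length) :=
      Nat.le_mul_of_pos_right _ (by omega)
    simp only [Cmd.time, Cmd.weight, Nat.add_mul _ c.weight, Cmd.run_set, Expr.val_cell,
      Expr.val_reg, Store.setReg_reg, ↓reduceIte, Store.setReg_arr, h1]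
    omega)
  refine Cmd.linear_forV_of_le hT ?_
  rw [← hl.sum_eq]
  rwa [List.take_of_length_le hl.length.le] at hTl

/-! ### Counting neighbours -/

/-- Increase the cell of array `a` at the vertex in register `x` for every neighbour that is marked
in array `m`. -/
def countNbrs (x a m : ℕ) : Cmd :=
  .forN x 5 (.ite (.cell m (.reg 5)) (.put a (.reg x) (Expr.inc (.cell a (.reg x)))) .nop)

theorem countNbrs_spec (L : Fin n → List (Fin n)) {x a m : ℕ} (hx : x ≠ 5) (ham : m ≠ a)
    {s : Store} {v : Fin n} (hv : s.reg x = v) :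
    ((countNbrs x a m).run L s).arr a v =
      s.arr a v + (L v).countP (fun y => s.arr m (y : Fin n) ≠ 0) ∧
    ∀ i, i ≠ (v : ℕ) → ((countNbrs x a m).run L s).arr a i = s.arr a i := by
  have key := Cmd.forN_induct L (.ite (.cell m (.reg 5))
    (.put a (.reg x) (Expr.inc (.cell a (.reg x)))) .nop) x 5 s v hv
    (fun pre s' => s'.arr a v = s.arr a v + pre.countP (fun y => s.arr m (y : Fin n) ≠ 0) ∧
      ∀ i, i ≠ (v : ℕ) → s'.arr a i = s.arr a i) ⟨by simp, fun _ _ => rfl⟩ (by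
    rintro pre y post s' - ha hr ⟨h1, h2⟩
    have e1 : s'.arr m = s.arr m := ha m (by simpa [Cmd.wa] using ham)
    have e2 : s'.reg x = v := (hr x hx (by simp [Cmd.wr])).trans hv
    by_cases hy : s.arr m y = 0
    · refine ⟨by simp [e1, hy, h1, List.countP_append], fun i hi => by simp [e1, hy, h2 i hi]⟩
    · refine ⟨by simp [e1, hy, h1, List.countP_append, hx, e2]; omega,
        fun i hi => by simp [e1, hy, h2 i hi, hx, e2, hi]⟩)
  exact key

theorem IsAdjLists.countP_eq {G : SimpleGraph (Fin n)} {L : Fin n → List (Fin n)}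
    (hL : IsAdjLists G L) (v : Fin n) (p : Fin n → Prop) [DecidablePred p] :
    (L v).countP (fun y => decide (p y)) = {y | p y ∧ G.Adj v y}.ncard := by
  rw [List.countP_eq_length_filter, ← List.toFinset_card_of_nodup ((hL v).1.filter _),
    ← Set.ncard_coe_finset]
  congr 1
  ext y
  simp [(hL v).2 y, and_comm]

/-! ### Gates -/

/-- For the vertex in register `4`, compute the size of its projection to the set marked in array
`12`, and a gate. -/
def gateStep : Cmd :=
  .put 14 (.reg 4) (.const 0) ;; .put 15 (.reg 4) (.reg 4) ;;
  .ite (.bin .equal (.cell 10 (.reg 4)) (.const 2))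
    (countNbrs 4 14 12)
    (.forN 4 5 (.ite (.bin .equal (Expr.inc (.cell 10 (.reg 5))) (.cell 10 (.reg 4)))
      (.ite (.bin .less (.cell 14 (.reg 4)) (.cell 14 (.reg 5)))
        (.put 14 (.reg 4) (.cell 14 (.reg 5)) ;; .put 15 (.reg 4) (.cell 15 (.reg 5))) .nop) .nop))

/-- Compute gates of all vertices, after a search with start value `1`. -/
def gates : Cmd := .forV 3 (.set 4 (.cell 11 (.reg 3)) ;; gateStep)

/-- The vertices of `S` closest to `z`. -/
def proj (G : SimpleGraph (Fin n)) (S : Set (Fin n)) (D : Fin n → ℕ) (z : Fin n) : Set (Fin n) :=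
  {q | q ∈ S ∧ G.dist q z = D z}

/-- The gate data of vertex `z`. -/
def GateAt (G : SimpleGraph (Fin n)) (S : Set (Fin n)) (D : Fin n → ℕ) (s : Store) (z : Fin n) :
    Prop :=
  s.arr 14 z = (proj G S D z).ncard ∧ ∃ g : Fin n, s.arr 15 z = g ∧ D g = 1 ∧
    ∀ q ∈ S, (G.Adj q g ↔ G.dist q z = D z)

/-- A vertex at distance one is its own gate. Beyond that, the projection of a predecessor `y` of
`z` is contained in that of `z`, and some predecessor has the same projection. Hence a predecessor
with a largest projection has exactly the projection of `z`, and its gate serves `z` as well;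
comparing sizes replaces comparing sets. -/
theorem gateStep_spec {G : SimpleGraph (Fin n)} {L : Fin n → List (Fin n)} (hL : IsAdjLists G L)
    (hh : G.IsHelly) (hc : G.Connected) {S : Set (Fin n)} {D : Fin n → ℕ} (hD : G.IsDistTo S D)
    (hS : ∀ p ∈ S, ∀ q ∈ S, G.dist p q ≤ 2) {s : Store} {z : Fin n} (hz : s.reg 4 = z)
    (h12 : ∀ v : Fin n, s.arr 12 v ≠ 0 ↔ v ∈ S) (h10 : ∀ v : Fin n, s.arr 10 v = D v + 1)
    (hprev : ∀ y, D y ≠ 0 → D y < D z → GateAt G S D s y) :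
    (D z ≠ 0 → GateAt G S D (gateStep.run L s) z) ∧
      ∀ y, y ≠ z → GateAt G S D s y → GateAt G S D (gateStep.run L s) y := by
  -- Array `10` holds the distance plus one, so the program compares with `2` to detect distance
  -- one.
  by_cases h1 : D z = 1
  · have hrun : gateStep.run L s = (countNbrs 4 14 12).run L ((s.setArr 14 z 0).setArr 15 z z) := by
      simp [gateStep, h10, h1, hz]
    have hspec := countNbrs_spec L (x := 4) (a := 14) (m := 12) (by decide) (by decide)
      (s := (s.setArr 14 z 0).setArr 15 z z) (v := z) (by simpa using hz)
    rw [← hrun] at hspec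
    have h15 : (gateStep.run L s).arr 15 = ((s.setArr 14 z 0).setArr 15 z z).arr 15 := by
      rw [hrun]
      exact Cmd.run_arr L _ _ (by decide)
    constructor
    · intro _
      refine ⟨?_, z, by simp [h15], h1, fun q _ => by rw [h1, SimpleGraph.dist_eq_one_iff_adj]⟩
      rw [hspec.1, hL.countP_eq]
      simp only [Store.setArr_arr, Nat.reduceEqDiff, false_and, ↓reduceIte, true_and, h12,
        Nat.zero_add, proj, h1, SimpleGraph.dist_eq_one_iff_adj]
      congr 1
      ext q
      simp [G.adj_comm z q]
    · rintro y hy ⟨h2, g, h3, h4⟩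
      have hne : (y : ℕ) ≠ z := fun h => hy (Fin.ext h)
      refine ⟨?_, g, by simp [h15, hne, h3], h4⟩
      rw [hspec.2 y hne]
      simp [hne, h2]
  · set s₁ := (s.setArr 14 z 0).setArr 15 z z with hs₁
    have key := Cmd.forN_induct L
      (.ite (.bin .equal (Expr.inc (.cell 10 (.reg 5))) (.cell 10 (.reg 4)))
        (.ite (.bin .less (.cell 14 (.reg 4)) (.cell 14 (.reg 5)))
          (.put 14 (.reg 4) (.cell 14 (.reg 5)) ;; .put 15 (.reg 4) (.cell 15 (.reg 5))) .nop) .nop)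
      4 5 s₁ z (by simpa [hs₁] using hz)
      (fun pre s' => (s'.arr 14 z = 0 ∨ ∃ y ∈ pre, D y + 1 = D z ∧ s'.arr 14 z = s.arr 14 y ∧
          s'.arr 15 z = s.arr 15 y) ∧
        (∀ y ∈ pre, D y + 1 = D z → s.arr 14 y ≤ s'.arr 14 z) ∧
        (∀ i, i ≠ (z : ℕ) → s'.arr 14 i = s.arr 14 i ∧ s'.arr 15 i = s.arr 15 i))
      ⟨Or.inl (by simp [hs₁]), by simp, fun i hi => by simp [hs₁, hi]⟩ (by
        rintro pre y post s' hpre ha hr ⟨g1, g2, g3⟩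
        have hzy : G.Adj z y := ((hL z).2 y).1 (by rw [hpre]; simp)
        have hne : (y : ℕ) ≠ z := fun h => hzy.ne (Fin.ext h).symm
        have e10 : s'.arr 10 = s.arr 10 := by
          rw [ha 10 (by decide)]
          funext i; simp [hs₁]
        have e4 : s'.reg 4 = z := by
          rw [hr 4 (by decide) (by decide)]
          simpa [hs₁] using hz
        obtain ⟨f1, f2⟩ := g3 y hne
        by_cases hDy : D y + 1 = D z
        · by_cases hlt : s'.arr 14 z < s.arr 14 y
          · refine ⟨Or.inr ⟨y, by simp, hDy, ?_, ?_⟩, ?_, ?_⟩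
            · simp [e10, h10, e4, hDy, f1, hlt]
            · simp [e10, h10, e4, hDy, f1, hlt, f2]
            · intro x hx hxz
              have : s.arr 14 x ≤ s.arr 14 y := by
                rcases List.mem_append.1 hx with hx | hx
                · exact (g2 x hx hxz).trans hlt.le
                · rw [List.mem_singleton.1 hx]
              simpa [e10, h10, e4, hDy, f1, hlt] using this
            · intro i hi
              simp [e10, h10, e4, hDy, f1, hlt, hi, g3 i hi]
          · refine ⟨?_, ?_, ?_⟩
            · rcases g1 with g1 | ⟨x, hx, hx'⟩
              · exact Or.inl (by simpa [h10, e4, hDy, f1, hlt, e10] using g1)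
              · exact Or.inr ⟨x, List.mem_append_left _ hx,
                  by simpa [h10, e4, hDy, f1, hlt, e10] using hx'⟩
            · intro x hx hxz
              have : s.arr 14 x ≤ s'.arr 14 z := by
                rcases List.mem_append.1 hx with hx | hx
                · exact g2 x hx hxz
                · rw [List.mem_singleton.1 hx]; omega
              simpa [e10, h10, e4, hDy, f1, hlt] using this
            · intro i hi
              simp [e10, h10, e4, hDy, f1, hlt, g3 i hi]
        · refine ⟨?_, ?_, ?_⟩
          · rcases g1 with g1 | ⟨x, hx, hx'⟩
            · exact Or.inl (by simpa [h10, e4, hDy, e10] using g1)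
            · exact Or.inr ⟨x, List.mem_append_left _ hx, by simpa [h10, e4, hDy, e10] using hx'⟩
          · intro x hx hxz
            have : s.arr 14 x ≤ s'.arr 14 z := by
              rcases List.mem_append.1 hx with hx | hx
              · exact g2 x hx hxz
              · rw [List.mem_singleton.1 hx] at hxz; exact absurd hxz hDy
            simpa [e10, h10, e4, hDy] using this
          · intro i hi
            simp [e10, h10, e4, hDy, g3 i hi])
    have hrun : gateStep.run L s = (Cmd.forN 4 5
      (.ite (.bin .equal (Expr.inc (.cell 10 (.reg 5))) (.cell 10 (.reg 4)))
        (.ite (.bin .less (.cell 14 (.reg 4)) (.cell 14 (.reg 5)))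
          (.put 14 (.reg 4) (.cell 14 (.reg 5)) ;; .put 15 (.reg 4) (.cell 15 (.reg 5)))
          .nop) .nop)).run L s₁ := by
      simp [gateStep, h10, h1, hz, hs₁]
    rw [← hrun] at key
    obtain ⟨k1, k2, k3⟩ := key
    constructor
    · intro h0
      obtain ⟨y, hzy, hDy, hy⟩ := hh.exists_pred_same_projection hc hD hS (z := z) (by omega)
      have hsub : proj G S D z ⊆ proj G S D y := fun q hq => ⟨hq.1, hy q hq.1 hq.2⟩
      have hsub' : ∀ x, G.Adj z x → D x + 1 = D z → proj G S D x ⊆ proj G S D z := by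
        rintro x hzx hx q ⟨hq, hqx⟩
        refine ⟨hq, ?_⟩
        have h1 := hD.le q hq z
        have h2 := hc.dist_triangle (u := q) (v := x) (w := z)
        have h3 := SimpleGraph.dist_eq_one_iff_adj.2 hzx.symm
        omega
      have hpos : 0 < (proj G S D z).ncard := by
        rw [Set.ncard_pos]
        obtain ⟨q, hq, he⟩ := hD.exists_eq z
        exact ⟨q, hq, he⟩
      have hPy := (hprev y (by omega) (by omega)).1
      have hle := k2 y (((hL z).2 y).2 hzy) hDy
      have hle' := Set.ncard_le_ncard hsub
      rcases k1 with k1 | ⟨x, hx, hDx, e14, e15⟩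
      · omega
      · have hzx := ((hL z).2 x).1 hx
        obtain ⟨hPx, g, hg, hDg, hgq⟩ := hprev x (by omega) (by omega)
        -- The chosen `x` has at least as large a projection as the predecessor `y` whose projection
        -- contains that of `z`.
        have heq := Set.eq_of_subset_of_ncard_le (hsub' x hzx hDx) (by omega)
        refine ⟨by rw [e14, hPx, heq], g, by rw [e15, hg], hDg, fun q hq => ?_⟩
        rw [hgq q hq]
        have : q ∈ proj G S D x ↔ q ∈ proj G S D z := by rw [heq]
        simpa [proj, hq] using this
    · rintro y hy ⟨h2, g, h3, h4⟩
      have hne : (y : ℕ) ≠ z := fun h => hy (Fin.ext h)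
      exact ⟨by rw [(k3 y hne).1, h2], g, by rw [(k3 y hne).2, h3], h4⟩

/-- Vertices are treated in order of distance, so the data of all vertices closer to `S` are final
when a vertex needs them. -/
theorem gates_spec {G : SimpleGraph (Fin n)} {L : Fin n → List (Fin n)} (hL : IsAdjLists G L)
    (hh : G.IsHelly) (hc : G.Connected) {S : Set (Fin n)} {D : Fin n → ℕ} (hD : G.IsDistTo S D)
    (hS : ∀ p ∈ S, ∀ q ∈ S, G.dist p q ≤ 2) {s : Store}
    (h12 : ∀ v : Fin n, s.arr 12 v ≠ 0 ↔ v ∈ S) {l : List (Fin n)} (hl : Searched D 1 l s) :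
    (∃ g : Fin n → Fin n, G.IsGate S D g ∧
      ∀ z, D z ≠ 0 → (gates.run L s).arr 15 z = g z) ∧ Cmd.Linear L gates s := by
  refine ⟨?_, linear_queue (by decide) (by decide) (by decide) hl⟩
  have key := Cmd.forV_induct L (.set 4 (.cell 11 (.reg 3)) ;; gateStep) 3 s
    (fun k s' => ∀ i (hi : i < l.length), i < k → D l[i] ≠ 0 → GateAt G S D s' l[i])
    (by simp) (by
    intro h s' ha _ hI
    have hhl : (h : ℕ) < l.length := by rw [hl.length]; exact h.isLt
    have h11 : s'.arr 11 h = (l[(h : ℕ)] : Fin n) := by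
      rw [ha 11 (by decide), hl.queue h hhl]
    have e12 := ha 12 (by decide)
    have e10 := ha 10 (by decide)
    obtain ⟨g1, g2⟩ := gateStep_spec hL hh hc hD hS
      (s := (s'.setReg 3 h).setReg 4 l[(h : ℕ)]) (z := l[(h : ℕ)])
      (by simp) (by simpa [e12] using h12) (by simpa [e10] using hl.dist) (by
        intro y hy0 hy
        obtain ⟨i, hi, rfl⟩ := List.getElem_of_mem (hl.mem y)
        refine hI i hi ?_ hy0
        by_contra hle
        rcases Nat.lt_or_eq_of_le (not_lt.1 hle) with hlt | heq
        · have := List.pairwise_iff_getElem.1 hl.sorted h i hhl hi hlt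
          omega
        · simp only [← heq, lt_irrefl] at hy)
    have hrun : (Cmd.set 4 (.cell 11 (.reg 3)) ;; gateStep).run L (s'.setReg 3 h) =
        gateStep.run L ((s'.setReg 3 h).setReg 4 l[(h : ℕ)]) := by
      simp [h11]
    rw [hrun]
    intro i hi hik hi0
    rcases Nat.lt_or_eq_of_le (Nat.lt_succ_iff.1 hik) with hlt | heq
    · refine g2 _ ?_ (hI i hi hlt hi0)
      intro he
      have := (hl.nodup.getElem_inj_iff).1 he
      omega
    · subst heq
      exact g1 hi0)
  have hall : ∀ z, D z ≠ 0 → GateAt G S D (gates.run L s) z := by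
    intro z hz
    obtain ⟨i, hi, rfl⟩ := List.getElem_of_mem (hl.mem z)
    exact key i hi (by rw [← hl.length]; exact hi) hz
  have hex : ∀ z, ∃ g : Fin n, D z ≠ 0 → (gates.run L s).arr 15 z = g ∧ D g = 1 ∧
      ∀ q ∈ S, (G.Adj q g ↔ G.dist q z = D z) := by
    intro z
    by_cases hz : D z = 0
    · exact ⟨z, fun h => absurd hz h⟩
    · obtain ⟨-, g, h1, h2⟩ := hall z hz
      exact ⟨g, fun _ => ⟨h1, h2⟩⟩
  choose g hg using hex
  exact ⟨g, fun z hz => (hg z hz).2, fun z hz => (hg z hz).1⟩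

/-! ### Marking and counting -/

/-- Defines an array pointwise. The expression may even read cells of array `a` itself, as long as
its value is known in every store that differs from `s` only in array `a` and register `3`. -/
theorem forV_put_spec (L : Fin n → List (Fin n)) (a : ℕ) (e : Expr) (s : Store) (f : Fin n → ℕ)
    (h : ∀ (s' : Store) (v : Fin n), (∀ b, b ≠ a → s'.arr b = s.arr b) →
      (∀ y, y ≠ 3 → s'.reg y = s.reg y) → e.val (s'.setReg 3 v) = f v) (v : Fin n) :
    ((Cmd.forV 3 (.put a (.reg 3) e)).run L s).arr a v = f v := by
  have key := Cmd.forV_induct L (.put a (.reg 3) e) 3 s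
    (fun k s' => ∀ v : Fin n, v < k → s'.arr a v = f v) (by simp) (by
      intro w s' ha hr hI v hv
      have he := h s' w (fun b hb => ha b (by simpa [Cmd.wa] using hb))
        (fun y hy => hr y hy (by simp [Cmd.wr]))
      by_cases hvw : v = w
      · subst hvw; simp [he]
      · have hne : (v : ℕ) ≠ w := fun h => hvw (Fin.ext h)
        simp [hne, hI v (by omega)])
  exact key v v.isLt

theorem linear_forV_put {L : Fin n → List (Fin n)} {a : ℕ} {e : Expr} (s : Store) :
    Cmd.Linear L (.forV 3 (.put a (.reg 3) e)) s :=
  Cmd.linear_forV rfl (by simp [Cmd.wr]) s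

/-- Mark in array `16` the gates of the vertices whose entry in array `10` is the level in
register `17`. -/
def markGates : Cmd :=
  .forV 3 (.put 16 (.reg 3) (.const 0)) ;;
  .forV 3 (.ite (.bin .equal (.cell 10 (.reg 3)) (.reg 17))
    (.put 16 (.cell 15 (.reg 3)) (.const 1)) .nop)

/-- Register `17` contains `k + 1` because array `10` holds distances plus one. Level `0` is
excluded, since nothing is known about the gates of vertices in `S`. -/
theorem markGates_spec {L : Fin n → List (Fin n)} {D : Fin n → ℕ} {g : Fin n → Fin n} {k : ℕ}
    (hk : k ≠ 0) {s : Store} (h10 : ∀ v : Fin n, s.arr 10 v = D v + 1) (h17 : s.reg 17 = k + 1)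
    (h15 : ∀ z, D z ≠ 0 → s.arr 15 z = g z) :
    (∀ y : Fin n, (markGates.run L s).arr 16 y ≠ 0 ↔ y ∈ SimpleGraph.gatesAt D g k) ∧
      Cmd.Linear L markGates s := by
  refine ⟨?_, Cmd.Linear.seq (linear_forV_put _) (Cmd.linear_forV (by decide) (by decide) _)⟩
  set s₁ := (Cmd.forV 3 (.put 16 (.reg 3) (.const 0))).run L s with hs₁
  have h0 : ∀ v : Fin n, s₁.arr 16 v = 0 := forV_put_spec L 16 _ s (fun _ => 0) (by simp)
  have key := Cmd.forV_induct L (.ite (.bin .equal (.cell 10 (.reg 3)) (.reg 17))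
    (.put 16 (.cell 15 (.reg 3)) (.const 1)) .nop) 3 s₁
    (fun i s' => ∀ y : Fin n, s'.arr 16 y ≠ 0 ↔ ∃ z : Fin n, z < i ∧ D z = k ∧ g z = y)
    (by simp [h0]) (by
      intro v s' ha hr hI y
      have e10 : s'.arr 10 = s.arr 10 := (ha 10 (by decide)).trans (Cmd.run_arr L _ _ (by decide))
      have e15 : s'.arr 15 = s.arr 15 := (ha 15 (by decide)).trans (Cmd.run_arr L _ _ (by decide))
      have e17 : s'.reg 17 = k + 1 :=
        ((hr 17 (by decide) (by decide)).trans (Cmd.run_reg L _ _ (by decide))).trans h17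
      by_cases hv : D v = k
      · have hg := h15 v (by omega)
        have hrun : (Cmd.ite (.bin .equal (.cell 10 (.reg 3)) (.reg 17))
            (.put 16 (.cell 15 (.reg 3)) (.const 1)) .nop).run L (s'.setReg 3 v) =
            (s'.setReg 3 v).setArr 16 (g v) 1 := by
          simp [e10, h10, hv, e17, e15, hg]
        rw [hrun]
        by_cases hy : g v = y
        · subst hy
          simp only [Store.setArr_arr, true_and, ↓reduceIte, ne_eq, one_ne_zero, not_false_eq_true,
            true_iff]
          exact ⟨v, by omega, hv, rfl⟩
        · have hne : (y : ℕ) ≠ g v := fun h => hy (Fin.ext h).symm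
          simp only [Store.setArr_arr, hne, and_false, ↓reduceIte, Store.setReg_arr]
          rw [hI y]
          constructor
          · rintro ⟨z, hz, hz'⟩
            exact ⟨z, by omega, hz'⟩
          · rintro ⟨z, hz, hz', hz''⟩
            have hzv : (z : ℕ) ≠ v := fun h => hy (by rw [← Fin.ext h]; exact hz'')
            exact ⟨z, by omega, hz', hz''⟩
      · have hrun : (Cmd.ite (.bin .equal (.cell 10 (.reg 3)) (.reg 17))
            (.put 16 (.cell 15 (.reg 3)) (.const 1)) .nop).run L (s'.setReg 3 v) =
            s'.setReg 3 v := by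
          simp [e10, h10, hv, e17]
        rw [hrun, Store.setReg_arr, hI y]
        constructor
        · rintro ⟨z, hz, hz'⟩
          exact ⟨z, by omega, hz'⟩
        · rintro ⟨z, hz, hz', hz''⟩
          have hzv : (z : ℕ) ≠ v := fun h => hv (by rw [← Fin.ext h]; exact hz')
          exact ⟨z, by omega, hz', hz''⟩)
  intro y
  have := key y
  rw [markGates, Cmd.run_seq, this]
  exact ⟨fun ⟨z, _, hz⟩ => ⟨z, hz⟩, fun ⟨z, hz⟩ => ⟨z, z.isLt, hz⟩⟩

/-- Count, for every vertex, the neighbours that are marked in array `16`. -/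
def countMarked : Cmd :=
  .set 16 (.const 0) ;;
  .forV 3 (.ite (.cell 16 (.reg 3)) (.set 16 (Expr.inc (.reg 16))) .nop ;;
    .put 17 (.reg 3) (.const 0) ;; countNbrs 3 17 16)

theorem countMarked_spec {G : SimpleGraph (Fin n)} {L : Fin n → List (Fin n)}
    (hL : IsAdjLists G L) {H : Set (Fin n)} {s : Store}
    (hH : ∀ y : Fin n, s.arr 16 y ≠ 0 ↔ y ∈ H) :
    (∀ v : Fin n, (countMarked.run L s).arr 17 v = {y | y ∈ H ∧ G.Adj v y}.ncard) ∧
      (countMarked.run L s).reg 16 = H.ncard ∧ Cmd.Linear L countMarked s := by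
  have key := Cmd.forV_induct L (.ite (.cell 16 (.reg 3)) (.set 16 (Expr.inc (.reg 16))) .nop ;;
    .put 17 (.reg 3) (.const 0) ;; countNbrs 3 17 16) 3 (s.setReg 16 0)
    (fun i s' => (∀ v : Fin n, v < i → s'.arr 17 v = {y | y ∈ H ∧ G.Adj v y}.ncard) ∧
      s'.reg 16 = {y : Fin n | y < i ∧ y ∈ H}.ncard) (by simp) (by
      rintro v s' ha hr ⟨h1, h2⟩
      have e16 : s'.arr 16 = s.arr 16 := ha 16 (by decide)
      set s₂ := ((Cmd.ite (.cell 16 (.reg 3)) (.set 16 (Expr.inc (.reg 16))) .nop).run L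
        (s'.setReg 3 v)) with hs₂
      have a2 : s₂.arr = s'.arr := by
        simp only [hs₂, Cmd.run_ite, Cmd.run_nop, Cmd.run_set]
        split_ifs <;> rfl
      have r2 : s₂.reg 3 = v := by
        rw [hs₂, Cmd.run_reg L _ _ (by decide)]; simp
      obtain ⟨c1, c2⟩ := countNbrs_spec L (x := 3) (a := 17) (m := 16) (by decide) (by decide)
        (s := s₂.setArr 17 v 0) (v := v) r2
      have hrun : (Cmd.ite (.cell 16 (.reg 3)) (.set 16 (Expr.inc (.reg 16))) .nop ;;
          .put 17 (.reg 3) (.const 0) ;; countNbrs 3 17 16).run L (s'.setReg 3 v) =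
          (countNbrs 3 17 16).run L (s₂.setArr 17 v 0) := by
        rw [Cmd.run_seq, Cmd.run_seq, Cmd.run_put, ← hs₂, Expr.val_reg, r2, Expr.val_const]
      rw [hrun]
      constructor
      · intro w hw
        by_cases hwv : w = v
        · subst hwv
          rw [c1, hL.countP_eq]
          have h16 : ∀ y : Fin n, (s₂.setArr 17 w 0).arr 16 y ≠ 0 ↔ y ∈ H := by
            simpa [a2, e16] using hH
          simp only [h16]
          simp
        · have hne : (w : ℕ) ≠ v := fun h => hwv (Fin.ext h)
          rw [c2 w hne]
          simp [hne, a2, h1 w (by omega)]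
      · rw [Cmd.run_reg L _ _ (by decide)]
        by_cases hv : v ∈ H
        · have h16 : s.arr 16 v ≠ 0 := (hH v).2 hv
          have : s₂.reg 16 = s'.reg 16 + 1 := by simp [hs₂, e16, h16]
          rw [Store.setArr_reg, this, h2]
          have hins : {y : Fin n | (y : ℕ) < v + 1 ∧ y ∈ H} =
              insert v {y : Fin n | (y : ℕ) < v ∧ y ∈ H} := by
            ext y
            simp only [Set.mem_ofPred_eq, Set.mem_insert_iff]
            constructor
            · rintro ⟨h, h'⟩
              by_cases hy : y = v
              · exact Or.inl hy
              · have hne : (y : ℕ) ≠ v := fun h => hy (Fin.ext h)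
                exact Or.inr ⟨by omega, h'⟩
            · rintro (rfl | ⟨h, h'⟩)
              · exact ⟨by omega, hv⟩
              · exact ⟨by omega, h'⟩
          rw [hins, Set.ncard_insert_of_notMem (by simp)]
        · have h16 : s.arr 16 v = 0 := by
            by_contra h
            exact hv ((hH v).1 h)
          have : s₂.reg 16 = s'.reg 16 := by simp [hs₂, e16, h16]
          rw [Store.setArr_reg, this, h2]
          congr 1
          ext y
          simp only [Set.mem_ofPred_eq]
          constructor
          · rintro ⟨h, h'⟩
            exact ⟨by omega, h'⟩
          · rintro ⟨h, h'⟩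
            have hne : (y : ℕ) ≠ v := fun h => hv (by rw [← Fin.ext h]; exact h')
            exact ⟨by omega, h'⟩)
  refine ⟨fun v => key.1 v v.isLt, ?_, Cmd.Linear.seq (Cmd.linear_of_flat (by decide) _)
    (Cmd.linear_forV (by decide) (by decide) _)⟩
  have := key.2
  rw [countMarked, Cmd.run_seq, Cmd.run_set, Expr.val_const, this]
  congr 1
  ext y
  simp

theorem ncard_inter_adj_eq_iff {G : SimpleGraph (Fin n)} {H : Set (Fin n)} {v : Fin n} :
    {y | y ∈ H ∧ G.Adj v y}.ncard = H.ncard ↔ ∀ y ∈ H, G.Adj v y := by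
  constructor
  · intro h y hy
    have := Set.eq_of_subset_of_ncard_le (fun y hy => hy.1 :
      {y | y ∈ H ∧ G.Adj v y} ⊆ H) h.ge
    rw [← this] at hy
    exact hy.2
  · intro h
    congr 1
    ext y
    exact ⟨fun hy => hy.1, fun hy => ⟨hy, h y hy⟩⟩

/-! ### Partition refinement -/

/-- Split the classes, in array `18`, of the marked vertices by adjacency to the vertex in
register `3`. -/
def refineStep : Cmd :=
  .forN 3 5 (.ite (.cell 12 (.reg 5)) (.put 19 (.cell 18 (.reg 5)) (.const 0)) .nop) ;;
  .forN 3 5 (.ite (.cell 12 (.reg 5))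
    (.ite (.cell 19 (.cell 18 (.reg 5))) .nop
      (.put 19 (.cell 18 (.reg 5)) (.reg 20) ;; .set 20 (Expr.inc (.reg 20))) ;;
      .put 18 (.reg 5) (.cell 19 (.cell 18 (.reg 5)))) .nop)

/-- Partition the vertices marked in array `12` by their neighbours among those marked in
array `16`. -/
def classes : Cmd :=
  .set 20 (.const 1) ;; .forV 3 (.put 18 (.reg 3) (.const 0)) ;;
  .forV 3 (.ite (.cell 16 (.reg 3)) refineStep .nop)

/-- Array `19` sends an old class to the new class of its members adjacent to `g`. The first pass
clears stale entries of the classes that are met; the second draws fresh numbers from register `20`,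
which exceeds all numbers in use. The number `0` stands for a missing entry, so the counter must be
nonzero. -/
theorem refineStep_spec {G : SimpleGraph (Fin n)} {L : Fin n → List (Fin n)} (hL : IsAdjLists G L)
    {S : Set (Fin n)} {s : Store} {g : Fin n} (hg : s.reg 3 = g)
    (h12 : ∀ v : Fin n, s.arr 12 v ≠ 0 ↔ v ∈ S) (hf : s.reg 20 ≠ 0)
    (hlt : ∀ b : Fin n, s.arr 18 b < s.reg 20) :
    (∀ b : Fin n, (refineStep.run L s).arr 18 b < (refineStep.run L s).reg 20) ∧
      (refineStep.run L s).reg 20 ≠ 0 ∧ ∀ b ∈ S, ∀ b' ∈ S,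
      ((refineStep.run L s).arr 18 b = (refineStep.run L s).arr 18 b' ↔
        s.arr 18 b = s.arr 18 b' ∧ (G.Adj b g ↔ G.Adj b' g)) := by
  set s₁ := (Cmd.forN 3 5 (.ite (.cell 12 (.reg 5))
    (.put 19 (.cell 18 (.reg 5)) (.const 0)) .nop)).run L s with hs₁
  have e12 : s₁.arr 12 = s.arr 12 := Cmd.run_arr L _ _ (by decide)
  have e18 : s₁.arr 18 = s.arr 18 := Cmd.run_arr L _ _ (by decide)
  have e20 : s₁.reg 20 = s.reg 20 := Cmd.run_reg L _ _ (by decide)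
  have e3 : s₁.reg 3 = g := (Cmd.run_reg L _ _ (by decide)).trans hg
  have h19 : ∀ b ∈ L g, b ∈ S → s₁.arr 19 (s.arr 18 b) = 0 :=
    Cmd.forN_induct L (.ite (.cell 12 (.reg 5)) (.put 19 (.cell 18 (.reg 5)) (.const 0)) .nop)
      3 5 s g hg (fun pre s' => ∀ b ∈ pre, b ∈ S → s'.arr 19 (s.arr 18 b) = 0) (by simp) (by
      intro pre v post s' _ ha _ hI b hb hbS
      have a12 := ha 12 (by decide)
      have a18 := ha 18 (by decide)
      rw [List.mem_append, List.mem_singleton] at hb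
      by_cases hv : v ∈ S
      · have := (h12 v).2 hv
        rcases hb with hb | rfl
        · simp [a12, a18, this, hI b hb hbS]
        · simp [a12, a18, this]
      · have : s.arr 12 v = 0 := by
          by_contra h
          exact hv ((h12 v).1 h)
        rcases hb with hb | rfl
        · simp [a12, this, hI b hb hbS]
        · exact absurd hbS hv)
  -- The invariant speaks of the processed members of `S`: each carries the new number of its old
  -- class, a nonzero entry for an old class stems from a processed member, and different old
  -- classes receive different new numbers. Unprocessed vertices keep their old numbers.
  have key := Cmd.forN_induct L (.ite (.cell 12 (.reg 5))
    (.ite (.cell 19 (.cell 18 (.reg 5))) .nop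
      (.put 19 (.cell 18 (.reg 5)) (.reg 20) ;; .set 20 (Expr.inc (.reg 20))) ;;
      .put 18 (.reg 5) (.cell 19 (.cell 18 (.reg 5)))) .nop) 3 5 s₁ g e3
    (fun pre s' => s.reg 20 ≤ s'.reg 20 ∧
      (∀ b : Fin n, ¬ (b ∈ pre ∧ b ∈ S) → s'.arr 18 b = s.arr 18 b) ∧
      (∀ b ∈ pre, b ∈ S → s'.arr 18 b = s'.arr 19 (s.arr 18 b) ∧
        s.reg 20 ≤ s'.arr 19 (s.arr 18 b) ∧ s'.arr 19 (s.arr 18 b) < s'.reg 20) ∧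
      (∀ b ∈ L g, b ∈ S → s'.arr 19 (s.arr 18 b) = 0 ∨
        ∃ b' ∈ pre, b' ∈ S ∧ s.arr 18 b' = s.arr 18 b) ∧
      (∀ b ∈ pre, b ∈ S → ∀ b' ∈ pre, b' ∈ S →
        s'.arr 19 (s.arr 18 b) = s'.arr 19 (s.arr 18 b') → s.arr 18 b = s.arr 18 b'))
    ⟨e20.ge, fun b _ => by rw [e18], by simp, fun b hb hbS => Or.inl (h19 b hb hbS), by simp⟩ (by
      rintro pre v post s' hpre ha - ⟨i1, i2, i3, i4, i5⟩
      have a12 : s'.arr 12 = s.arr 12 := (ha 12 (by decide)).trans e12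
      have hvL : v ∈ L g := by rw [hpre]; simp
      have hvpre : v ∉ pre := by
        have := (hL g).1
        rw [hpre, List.nodup_append] at this
        intro h
        exact this.2.2 v h v (by simp) rfl
      by_cases hv : v ∈ S
      · have m12 := (h12 v).2 hv
        have c18 : s'.arr 18 v = s.arr 18 v := i2 v (fun h => hvpre h.1)
        by_cases h0 : s'.arr 19 (s.arr 18 v) = 0
        · have hrun : (Cmd.ite (.cell 12 (.reg 5))
              (.ite (.cell 19 (.cell 18 (.reg 5))) .nop
                (.put 19 (.cell 18 (.reg 5)) (.reg 20) ;; .set 20 (Expr.inc (.reg 20))) ;;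
                .put 18 (.reg 5) (.cell 19 (.cell 18 (.reg 5)))) .nop).run L (s'.setReg 5 v) =
              (((s'.setReg 5 v).setArr 19 (s.arr 18 v) (s'.reg 20)).setReg 20
                (s'.reg 20 + 1)).setArr 18 v (s'.reg 20) := by
            simp [a12, m12, c18, h0]
          rw [hrun]
          have hne : ∀ b ∈ pre, b ∈ S → s.arr 18 b ≠ s.arr 18 v := by
            intro b hb hbS he
            have := (i3 b hb hbS).2.1
            rw [he, h0] at this
            omega
          have hnv : ∀ b ∈ pre, (b : ℕ) ≠ v := fun b hb h => hvpre (by rwa [← Fin.ext h])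
          refine ⟨by simp; omega, ?_, ?_, ?_, ?_⟩
          · intro b hb
            have hbv : (b : ℕ) ≠ v := fun h => hb (by rw [Fin.ext h]; exact ⟨by simp, hv⟩)
            simpa [hbv] using i2 b (fun h => hb ⟨List.mem_append_left _ h.1, h.2⟩)
          · intro b hb hbS
            rw [List.mem_append, List.mem_singleton] at hb
            rcases hb with hb | rfl
            · obtain ⟨j1, j2, j3⟩ := i3 b hb hbS
              simp only [Store.setArr_arr, Store.setReg_arr, Store.setArr_reg, Store.setReg_reg,
                hnv b hb, hne b hb hbS, and_false, ↓reduceIte, Nat.reduceEqDiff, false_and, j1]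
              exact ⟨trivial, j2, by omega⟩
            · simpa using i1
          · intro b hb hbS
            by_cases hbv : s.arr 18 b = s.arr 18 v
            · exact Or.inr ⟨v, by simp, hv, hbv.symm⟩
            · rcases i4 b hb hbS with h | ⟨b', hb', h⟩
              · exact Or.inl (by simpa [hbv] using h)
              · exact Or.inr ⟨b', List.mem_append_left _ hb', h⟩
          · intro b hb hbS b' hb' hbS' he
            rw [List.mem_append, List.mem_singleton] at hb hb'
            rcases hb with hb | rfl <;> rcases hb' with hb' | rfl
            · exact i5 b hb hbS b' hb' hbS' (by simpa [hne b hb hbS, hne b' hb' hbS'] using he)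
            · have := (i3 b hb hbS).2.2
              simp [hne b hb hbS] at he
              omega
            · have := (i3 b' hb' hbS').2.2
              simp [hne b' hb' hbS'] at he
              omega
            · rfl
        · have hrun : (Cmd.ite (.cell 12 (.reg 5))
              (.ite (.cell 19 (.cell 18 (.reg 5))) .nop
                (.put 19 (.cell 18 (.reg 5)) (.reg 20) ;; .set 20 (Expr.inc (.reg 20))) ;;
                .put 18 (.reg 5) (.cell 19 (.cell 18 (.reg 5)))) .nop).run L (s'.setReg 5 v) =
              (s'.setReg 5 v).setArr 18 v (s'.arr 19 (s.arr 18 v)) := by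
            simp [a12, m12, c18, h0]
          rw [hrun]
          obtain ⟨b₀, hb₀, hbS₀, hbe₀⟩ := (i4 v hvL hv).resolve_left h0
          refine ⟨by simpa using i1, ?_, ?_, ?_, ?_⟩
          · intro b hb
            have hbv : (b : ℕ) ≠ v := fun h => hb (by rw [Fin.ext h]; exact ⟨by simp, hv⟩)
            simpa [hbv] using i2 b (fun h => hb ⟨List.mem_append_left _ h.1, h.2⟩)
          · intro b hb hbS
            rw [List.mem_append, List.mem_singleton] at hb
            rcases hb with hb | rfl
            · have hnv : (b : ℕ) ≠ v := fun h => hvpre (by rwa [← Fin.ext h])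
              simpa [hnv] using i3 b hb hbS
            · have := i3 b₀ hb₀ hbS₀
              rw [hbe₀] at this
              simpa using this.2
          · intro b hb hbS
            rcases i4 b hb hbS with h | ⟨b', hb', h⟩
            · exact Or.inl (by simpa using h)
            · exact Or.inr ⟨b', List.mem_append_left _ hb', h⟩
          · have hrep : ∀ b ∈ pre ++ [v], b ∈ S → ∃ c ∈ pre, c ∈ S ∧ s.arr 18 c = s.arr 18 b := by
              intro b hb hbS
              rw [List.mem_append, List.mem_singleton] at hb
              rcases hb with hb | rfl
              · exact ⟨b, hb, hbS, rfl⟩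
              · exact ⟨b₀, hb₀, hbS₀, hbe₀⟩
            intro b hb hbS b' hb' hbS' he
            obtain ⟨c, hc, hcS, hce⟩ := hrep b hb hbS
            obtain ⟨c', hc', hcS', hce'⟩ := hrep b' hb' hbS'
            have := i5 c hc hcS c' hc' hcS'
            rw [hce, hce'] at this
            exact this (by simpa using he)
      · have m12 : s.arr 12 v = 0 := by
          by_contra h
          exact hv ((h12 v).1 h)
        have hrun : (Cmd.ite (.cell 12 (.reg 5))
              (.ite (.cell 19 (.cell 18 (.reg 5))) .nop
                (.put 19 (.cell 18 (.reg 5)) (.reg 20) ;; .set 20 (Expr.inc (.reg 20))) ;;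
                .put 18 (.reg 5) (.cell 19 (.cell 18 (.reg 5)))) .nop).run L (s'.setReg 5 v) =
              s'.setReg 5 v := by
          simp [a12, m12]
        rw [hrun]
        have hmem : ∀ b ∈ pre ++ [v], b ∈ S → b ∈ pre := by
          intro b hb hbS
          rw [List.mem_append, List.mem_singleton] at hb
          exact hb.resolve_right (fun h => hv (h ▸ hbS))
        refine ⟨by simpa using i1, ?_, ?_, ?_, ?_⟩
        · intro b hb
          exact i2 b (fun h => hb ⟨List.mem_append_left _ h.1, h.2⟩)
        · intro b hb hbS
          simpa using i3 b (hmem b hb hbS) hbS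
        · intro b hb hbS
          rcases i4 b hb hbS with h | ⟨b', hb', h⟩
          · exact Or.inl h
          · exact Or.inr ⟨b', List.mem_append_left _ hb', h⟩
        · intro b hb hbS b' hb' hbS' he
          exact i5 b (hmem b hb hbS) hbS b' (hmem b' hb' hbS') hbS' he)
  obtain ⟨i1, i2, i3, -, i5⟩ := key
  have hrun : refineStep.run L s = (Cmd.forN 3 5 (.ite (.cell 12 (.reg 5))
    (.ite (.cell 19 (.cell 18 (.reg 5))) .nop
      (.put 19 (.cell 18 (.reg 5)) (.reg 20) ;; .set 20 (Expr.inc (.reg 20))) ;;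
      .put 18 (.reg 5) (.cell 19 (.cell 18 (.reg 5)))) .nop)).run L s₁ := rfl
  rw [← hrun] at i1 i2 i3 i5
  have hmem : ∀ b, b ∈ L g ↔ G.Adj b g := fun b => by rw [(hL g).2, G.adj_comm]
  refine ⟨fun b => ?_, by omega, fun b hb b' hb' => ?_⟩
  · by_cases h : b ∈ L g ∧ b ∈ S
    · obtain ⟨j1, j2, j3⟩ := i3 b h.1 h.2
      omega
    · rw [i2 b h]
      exact (hlt b).trans_le i1
  · have l1 := hlt b
    have l2 := hlt b'
    by_cases h : b ∈ L g <;> by_cases h' : b' ∈ L g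
    · obtain ⟨j1, -⟩ := i3 b h hb
      obtain ⟨j1', -⟩ := i3 b' h' hb'
      have := i5 b h hb b' h' hb'
      rw [hmem] at h h'
      rw [j1, j1']
      exact ⟨fun e => ⟨this e, by simp [h, h']⟩, fun e => by rw [e.1]⟩
    · obtain ⟨j1, j2, -⟩ := i3 b h hb
      have j1' := i2 b' (fun e => h' e.1)
      rw [hmem] at h h'
      exact ⟨fun e => by omega, fun e => absurd (e.2.1 h) h'⟩
    · obtain ⟨j1', j2', -⟩ := i3 b' h' hb'
      have j1 := i2 b (fun e => h e.1)
      rw [hmem] at h h'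
      exact ⟨fun e => by omega, fun e => absurd (e.2.2 h') h⟩
    · rw [i2 b (fun e => h e.1), i2 b' (fun e => h' e.1)]
      rw [hmem] at h h'
      simp [h, h']

/-- Each marked vertex splits every class at a cost proportional to its own degree. At the end equal
numbers mean equal neighbourhoods in `H`. -/
theorem classes_spec {G : SimpleGraph (Fin n)} {L : Fin n → List (Fin n)} (hL : IsAdjLists G L)
    {S H : Set (Fin n)} {s : Store} (h12 : ∀ v : Fin n, s.arr 12 v ≠ 0 ↔ v ∈ S)
    (h16 : ∀ v : Fin n, s.arr 16 v ≠ 0 ↔ v ∈ H) :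
    (∀ b ∈ S, ∀ b' ∈ S, ((classes.run L s).arr 18 b = (classes.run L s).arr 18 b' ↔
      ∀ y ∈ H, (G.Adj b y ↔ G.Adj b' y))) ∧ Cmd.Linear L classes s := by
  refine ⟨?_, Cmd.Linear.seq (Cmd.linear_of_flat (by decide) _) (Cmd.Linear.seq (linear_forV_put _)
    (Cmd.linear_forV (by decide) (by decide) _))⟩
  set s₁ := (Cmd.forV 3 (.put 18 (.reg 3) (.const 0))).run L (s.setReg 20 1) with hs₁
  have h0 : ∀ v : Fin n, s₁.arr 18 v = 0 := forV_put_spec L 18 _ _ (fun _ => 0) (by simp)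
  have e20 : s₁.reg 20 = 1 := (Cmd.run_reg L _ _ (by decide)).trans (by simp)
  have e12 : s₁.arr 12 = s.arr 12 := Cmd.run_arr L _ _ (by decide)
  have e16 : s₁.arr 16 = s.arr 16 := Cmd.run_arr L _ _ (by decide)
  have key := Cmd.forV_induct L (.ite (.cell 16 (.reg 3)) refineStep .nop) 3 s₁
    (fun i s' => (∀ b : Fin n, s'.arr 18 b < s'.reg 20) ∧ s'.reg 20 ≠ 0 ∧
      ∀ b ∈ S, ∀ b' ∈ S, (s'.arr 18 b = s'.arr 18 b' ↔
        ∀ y ∈ H, (y : ℕ) < i → (G.Adj b y ↔ G.Adj b' y)))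
    ⟨by simp [h0, e20], by simp [e20], by simp [h0]⟩ (by
      rintro v s' ha - ⟨i1, i2, i3⟩
      have a12 : s'.arr 12 = s.arr 12 := (ha 12 (by decide)).trans e12
      have a16 : s'.arr 16 = s.arr 16 := (ha 16 (by decide)).trans e16
      have hlt : ∀ y : Fin n, (y : ℕ) < v + 1 → y = v ∨ (y : ℕ) < v := by
        intro y hy
        rcases Nat.lt_or_eq_of_le (Nat.lt_succ_iff.1 hy) with h | h
        · exact Or.inr h
        · exact Or.inl (Fin.ext h)
      by_cases hv : v ∈ H
      · have hrun : (Cmd.ite (.cell 16 (.reg 3)) refineStep .nop).run L (s'.setReg 3 v) =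
            refineStep.run L (s'.setReg 3 v) := by
          simp [a16, (h16 v).2 hv]
        rw [hrun]
        obtain ⟨j1, j2, j3⟩ := refineStep_spec hL (S := S) (s := s'.setReg 3 v) (g := v)
          (by simp) (by simpa [a12] using h12) (by simpa using i2) (by simpa using i1)
        refine ⟨j1, j2, fun b hb b' hb' => ?_⟩
        rw [j3 b hb b' hb', Store.setReg_arr, i3 b hb b' hb']
        constructor
        · rintro ⟨h1, h2⟩ y hy hyv
          rcases hlt y hyv with rfl | h
          · exact h2
          · exact h1 y hy h
        · exact fun h => ⟨fun y hy hyv => h y hy (by omega), h v hv (by omega)⟩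
      · have m16 : s.arr 16 v = 0 := by
          by_contra h
          exact hv ((h16 v).1 h)
        have hrun : (Cmd.ite (.cell 16 (.reg 3)) refineStep .nop).run L (s'.setReg 3 v) =
            s'.setReg 3 v := by
          simp [a16, m16]
        rw [hrun]
        refine ⟨by simpa using i1, by simpa using i2, fun b hb b' hb' => ?_⟩
        rw [Store.setReg_arr, i3 b hb b' hb']
        constructor
        · intro h1 y hy hyv
          rcases hlt y hyv with rfl | h
          · exact absurd hy hv
          · exact h1 y hy h
        · exact fun h y hy hyv => h y hy (by omega))
  intro b hb b' hb'
  have hrun : classes.run L s =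
    (Cmd.forV 3 (.ite (.cell 16 (.reg 3)) refineStep .nop)).run L s₁ := rfl
  rw [hrun, key.2.2 b hb b' hb']
  exact ⟨fun h y hy => h y hy y.isLt, fun h y hy _ => h y hy⟩

/-! ### Tallies -/

/-- Mark the value of `e` in array `a`, and count it in register `r` if it is new. -/
def tally (a r : ℕ) (e : Expr) : Cmd :=
  .ite (.cell a e) .nop (.put a e (.const 1) ;; .set r (Expr.inc (.reg r)))

/-- Array `a` marks, among the classes of members of `U`, the classes of members of `T`, and
register `r` counts the latter. -/
structure Tally (cls : Fin n → ℕ) (U : Set (Fin n)) (a r : ℕ) (T : Set (Fin n)) (s : Store) :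
    Prop where
  mark : ∀ b ∈ U, (s.arr a (cls b) ≠ 0 ↔ ∃ c ∈ T, cls c = cls b)
  count : s.reg r = (cls '' T).ncard

theorem Tally.congr {cls : Fin n → ℕ} {U T : Set (Fin n)} {a r : ℕ} {s s' : Store}
    (h : Tally cls U a r T s) (ha : s'.arr a = s.arr a) (hr : s'.reg r = s.reg r) :
    Tally cls U a r T s' :=
  ⟨fun b hb => by rw [ha]; exact h.mark b hb, by rw [hr]; exact h.count⟩

theorem tally_spec (L : Fin n → List (Fin n)) {cls : Fin n → ℕ} {U T : Set (Fin n)} {a r : ℕ}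
    {s : Store} {e : Expr} {b : Fin n} (h : Tally cls U a r T s) (hb : b ∈ U)
    (he : e.val s = cls b) : Tally cls U a r (insert b T) ((tally a r e).run L s) := by
  by_cases h0 : s.arr a (cls b) = 0
  · have hrun : (tally a r e).run L s = (s.setArr a (cls b) 1).setReg r (s.reg r + 1) := by
      simp [tally, he, h0]
    have hnot : cls b ∉ cls '' T := fun hm => (h.mark b hb).2 hm h0
    rw [hrun]
    refine ⟨fun c hc => ?_, ?_⟩
    · by_cases hcb : cls c = cls b
      · simp [hcb]
      · have := h.mark c hc
        simp only [Store.setReg_arr, Store.setArr_arr, hcb, and_false, ↓reduceIte, this,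
          Set.exists_mem_insert, Ne.symm hcb, false_or]
    · rw [Set.image_insert_eq, Set.ncard_insert_of_notMem hnot, ← h.count]
      simp
  · have hrun : (tally a r e).run L s = s := by
      simp [tally, he, h0]
    have hm := (h.mark b hb).1 h0
    rw [hrun]
    refine ⟨fun c hc => ?_, ?_⟩
    · rw [h.mark c hc, Set.exists_mem_insert]
      constructor
      · exact Or.inr
      · rintro (hcb | hcb)
        · rwa [← hcb]
        · exact hcb
    · have himg : cls b ∈ cls '' T := hm
      rw [Set.image_insert_eq, Set.insert_eq_of_mem himg, h.count]

/-! ### Selecting -/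

/-- Tally the class of a neighbour, in the set marked in array `12`, with largest entry in
array `17`. -/
def selectStep : Cmd :=
  .set 24 (.const 0) ;;
  .forN 3 5 (.ite (.cell 12 (.reg 5))
    (.ite (.bin .less (.reg 24) (.cell 17 (.reg 5)))
      (.set 24 (.cell 17 (.reg 5)) ;; .set 23 (.cell 18 (.reg 5))) .nop) .nop) ;;
  tally 20 21 (.reg 23)

/-- Tally the classes of a selection for the vertices marked in array `16`. -/
def select : Cmd :=
  .forV 3 (.put 20 (.cell 18 (.reg 3)) (.const 0)) ;; .set 21 (.const 0) ;;
  .forV 3 (.ite (.cell 16 (.reg 3)) selectStep .nop)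

/-- The running maximum starts at `0` and is replaced only by a strictly larger value. The
hypotheses `hex` and `hf` provide a candidate with nonzero value, so register `23` is certain to be
written. -/
theorem selectStep_spec {G : SimpleGraph (Fin n)} {L : Fin n → List (Fin n)}
    (hL : IsAdjLists G L) {S T : Set (Fin n)} {cls f : Fin n → ℕ} {s : Store} {g : Fin n}
    (hg : s.reg 3 = g) (h12 : ∀ v : Fin n, s.arr 12 v ≠ 0 ↔ v ∈ S)
    (h17 : ∀ v : Fin n, s.arr 17 v = f v) (h18 : ∀ v : Fin n, s.arr 18 v = cls v)
    (hex : ∃ b ∈ S, G.Adj b g) (hf : ∀ b ∈ S, G.Adj b g → f b ≠ 0)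
    (ht : Tally cls Set.univ 20 21 T s) :
    ∃ b ∈ S, G.Adj b g ∧ (∀ c ∈ S, G.Adj c g → f c ≤ f b) ∧
      Tally cls Set.univ 20 21 (insert b T) (selectStep.run L s) := by
  set s₁ := (Cmd.forN 3 5 (.ite (.cell 12 (.reg 5))
    (.ite (.bin .less (.reg 24) (.cell 17 (.reg 5)))
      (.set 24 (.cell 17 (.reg 5)) ;; .set 23 (.cell 18 (.reg 5))) .nop) .nop)).run L
      (s.setReg 24 0) with hs₁
  have key := Cmd.forN_induct L (.ite (.cell 12 (.reg 5))
    (.ite (.bin .less (.reg 24) (.cell 17 (.reg 5)))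
      (.set 24 (.cell 17 (.reg 5)) ;; .set 23 (.cell 18 (.reg 5))) .nop) .nop) 3 5
      (s.setReg 24 0) g (by simpa using hg)
    (fun pre s' => (s'.reg 24 = 0 ∨ ∃ b ∈ pre, b ∈ S ∧ s'.reg 24 = f b ∧ s'.reg 23 = cls b) ∧
      ∀ b ∈ pre, b ∈ S → f b ≤ s'.reg 24) (by simp) (by
      rintro pre v post s' - ha - ⟨i1, i2⟩
      have a12 : s'.arr 12 = s.arr 12 := ha 12 (by decide)
      have a17 : s'.arr 17 = s.arr 17 := ha 17 (by decide)
      have a18 : s'.arr 18 = s.arr 18 := ha 18 (by decide)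
      by_cases hv : v ∈ S
      · have m12 := (h12 v).2 hv
        by_cases hlt : s'.reg 24 < f v
        · have hrun : (Cmd.ite (.cell 12 (.reg 5))
              (.ite (.bin .less (.reg 24) (.cell 17 (.reg 5)))
                (.set 24 (.cell 17 (.reg 5)) ;; .set 23 (.cell 18 (.reg 5))) .nop) .nop).run L
              (s'.setReg 5 v) = ((s'.setReg 5 v).setReg 24 (f v)).setReg 23 (cls v) := by
            simp [a12, a17, a18, m12, h17, h18, hlt]
          rw [hrun]
          refine ⟨Or.inr ⟨v, by simp, hv, by simp, by simp⟩, fun b hb hbS => ?_⟩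
          rw [List.mem_append, List.mem_singleton] at hb
          rcases hb with hb | rfl
          · simpa using (i2 b hb hbS).trans hlt.le
          · simp
        · have hrun : (Cmd.ite (.cell 12 (.reg 5))
              (.ite (.bin .less (.reg 24) (.cell 17 (.reg 5)))
                (.set 24 (.cell 17 (.reg 5)) ;; .set 23 (.cell 18 (.reg 5))) .nop) .nop).run L
              (s'.setReg 5 v) = s'.setReg 5 v := by
            simp [a12, a17, m12, h17, hlt]
          rw [hrun]
          refine ⟨?_, fun b hb hbS => ?_⟩
          · rcases i1 with i1 | ⟨b, hb, hb'⟩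
            · exact Or.inl (by simpa using i1)
            · exact Or.inr ⟨b, List.mem_append_left _ hb, by simpa using hb'⟩
          · rw [List.mem_append, List.mem_singleton] at hb
            rcases hb with hb | rfl
            · simpa using i2 b hb hbS
            · simpa using not_lt.1 hlt
      · have m12 : s.arr 12 v = 0 := by
          by_contra h
          exact hv ((h12 v).1 h)
        have hrun : (Cmd.ite (.cell 12 (.reg 5))
              (.ite (.bin .less (.reg 24) (.cell 17 (.reg 5)))
                (.set 24 (.cell 17 (.reg 5)) ;; .set 23 (.cell 18 (.reg 5))) .nop) .nop).run L
              (s'.setReg 5 v) = s'.setReg 5 v := by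
          simp [a12, m12]
        rw [hrun]
        refine ⟨?_, fun b hb hbS => ?_⟩
        · rcases i1 with i1 | ⟨b, hb, hb'⟩
          · exact Or.inl (by simpa using i1)
          · exact Or.inr ⟨b, List.mem_append_left _ hb, by simpa using hb'⟩
        · rw [List.mem_append, List.mem_singleton] at hb
          rcases hb with hb | rfl
          · simpa using i2 b hb hbS
          · exact absurd hbS hv)
  obtain ⟨b₀, hb₀, hadj₀⟩ := hex
  have hmem : ∀ b, b ∈ L g ↔ G.Adj b g := fun b => by rw [(hL g).2, G.adj_comm]
  have hpos : s₁.reg 24 ≠ 0 := by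
    have h1 := key.2 b₀ ((hmem b₀).2 hadj₀) hb₀
    have h2 := hf b₀ hb₀ hadj₀
    rw [hs₁]
    omega
  obtain ⟨b, hb, hbS, e24, e23⟩ := key.1.resolve_left hpos
  refine ⟨b, hbS, (hmem b).1 hb, fun c hc hcg => ?_, ?_⟩
  · rw [← e24]
    exact key.2 c ((hmem c).2 hcg) hc
  · have hrun : selectStep.run L s = (tally 20 21 (.reg 23)).run L s₁ := rfl
    rw [hrun]
    refine tally_spec L (ht.congr ?_ ?_) (Set.mem_univ b) e23
    · exact Cmd.run_arr L _ _ (by decide)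
    · exact (Cmd.run_reg L _ _ (by decide)).trans (by simp)

/-- Whether a vertex passes the filter depends on the selection only through its classes, so the
program never stores the selected vertices. The function `sel` is built up alongside the loop, in
the proof only. -/
theorem select_spec {G : SimpleGraph (Fin n)} {L : Fin n → List (Fin n)}
    (hL : IsAdjLists G L) {S H : Set (Fin n)} {cls : Fin n → ℕ} {s : Store}
    (h12 : ∀ v : Fin n, s.arr 12 v ≠ 0 ↔ v ∈ S) (h16 : ∀ v : Fin n, s.arr 16 v ≠ 0 ↔ v ∈ H)
    (h17 : ∀ v : Fin n, s.arr 17 v = {y | y ∈ H ∧ G.Adj v y}.ncard)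
    (h18 : ∀ v : Fin n, s.arr 18 v = cls v) (hex : ∀ g ∈ H, ∃ b ∈ S, G.Adj b g) :
    (∃ sel : Fin n → Fin n, G.IsSelection S H sel ∧
      Tally cls Set.univ 20 21 (sel '' H) (select.run L s)) ∧ Cmd.Linear L select s := by
  refine ⟨?_, Cmd.Linear.seq (Cmd.linear_forV (by decide) (by decide) _)
    (Cmd.Linear.seq (Cmd.linear_of_flat (by decide) _)
      (Cmd.linear_forV (by decide) (by decide) _))⟩
  set s₁ := (Cmd.forV 3 (.put 20 (.cell 18 (.reg 3)) (.const 0))).run L s with hs₁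
  -- Array `20` is indexed by class numbers; only the numbers of existing classes have to be
  -- cleared.
  have h0 := Cmd.forV_induct L (.put 20 (.cell 18 (.reg 3)) (.const 0)) 3 s
    (fun i s' => ∀ b : Fin n, b < i → s'.arr 20 (cls b) = 0) (by simp) (by
      intro v s' ha _ hI b hb
      have a18 : s'.arr 18 = s.arr 18 := ha 18 (by decide)
      have hrun : (Cmd.put 20 (.cell 18 (.reg 3)) (.const 0)).run L (s'.setReg 3 v) =
          (s'.setReg 3 v).setArr 20 (cls v) 0 := by
        simp [a18, h18]
      rw [hrun]
      by_cases hbv : b = v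
      · simp [hbv]
      · have hne : (b : ℕ) ≠ v := fun h => hbv (Fin.ext h)
        simp [hI b (by omega)])
  have key := Cmd.forV_induct L (.ite (.cell 16 (.reg 3)) selectStep .nop) 3 (s₁.setReg 21 0)
    (fun i s' => ∃ sel : Fin n → Fin n, (∀ h ∈ H, (h : ℕ) < i → sel h ∈ S ∧ G.Adj (sel h) h ∧
        ∀ b ∈ S, G.Adj b h →
          {y | y ∈ H ∧ G.Adj b y}.ncard ≤ {y | y ∈ H ∧ G.Adj (sel h) y}.ncard) ∧
      Tally cls Set.univ 20 21 (sel '' {h | h ∈ H ∧ (h : ℕ) < i}) s')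
    ⟨id, by simp, ⟨fun b _ => by simpa using h0 b b.isLt, by simp⟩⟩ (by
      rintro v s' ha - ⟨sel, i1, i2⟩
      have e (k : ℕ) (hk : k ≠ 20) (hk' : k ∉ selectStep.wa) : s'.arr k = s.arr k :=
        (ha k (by simpa [Cmd.wa] using hk')).trans
          (Cmd.run_arr L _ _ (by simpa [Cmd.wa] using hk))
      by_cases hv : v ∈ H
      · have hrun : (Cmd.ite (.cell 16 (.reg 3)) selectStep .nop).run L (s'.setReg 3 v) =
            selectStep.run L (s'.setReg 3 v) := by
          simp [e 16 (by decide) (by decide), (h16 v).2 hv]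
        rw [hrun]
        obtain ⟨b, hb, hbv, hmax, ht⟩ := selectStep_spec hL
          (f := fun v => {y | y ∈ H ∧ G.Adj v y}.ncard) (s := s'.setReg 3 v) (g := v) (by simp)
          (by simpa [e 12 (by decide) (by decide)] using h12)
          (by simpa [e 17 (by decide) (by decide)] using h17)
          (by simpa [e 18 (by decide) (by decide)] using h18) (hex v hv)
          -- Any candidate `b` sees at least the gate `v` itself, so its count is not zero.
          (fun b _ hbv => by
            have hne : {y | y ∈ H ∧ G.Adj b y}.Nonempty := ⟨v, hv, hbv⟩
            exact ((Set.ncard_pos (Set.toFinite _)).2 hne).ne') (i2.congr rfl (by simp))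
        have hold : ∀ h : Fin n, (h : ℕ) < v → Function.update sel v b h = sel h := by
          intro h hh
          rw [Function.update_of_ne]
          rintro rfl
          omega
        refine ⟨Function.update sel v b, fun h hh hhv => ?_, ?_⟩
        · rcases Nat.lt_or_eq_of_le (Nat.lt_succ_iff.1 hhv) with hlt | heq
          · rw [hold h hlt]
            exact i1 h hh hlt
          · obtain rfl := Fin.ext heq
            rw [Function.update_self]
            exact ⟨hb, hbv, hmax⟩
        · convert ht using 1
          ext c
          simp only [Set.mem_image, Set.mem_ofPred_eq, Set.mem_insert_iff]
          constructor
          · rintro ⟨h, ⟨hh, hhv⟩, rfl⟩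
            rcases Nat.lt_or_eq_of_le (Nat.lt_succ_iff.1 hhv) with hlt | heq
            · exact Or.inr ⟨h, ⟨hh, hlt⟩, (hold h hlt).symm⟩
            · obtain rfl := Fin.ext heq
              exact Or.inl (Function.update_self _ _ _)
          · rintro (rfl | ⟨h, ⟨hh, hhv⟩, rfl⟩)
            · exact ⟨v, ⟨hv, by omega⟩, Function.update_self _ _ _⟩
            · exact ⟨h, ⟨hh, by omega⟩, hold h hhv⟩
      · have m16 : s.arr 16 v = 0 := by
          by_contra h
          exact hv ((h16 v).1 h)
        have hrun : (Cmd.ite (.cell 16 (.reg 3)) selectStep .nop).run L (s'.setReg 3 v) =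
            s'.setReg 3 v := by
          simp [e 16 (by decide) (by decide), m16]
        rw [hrun]
        have hlt : ∀ h : Fin n, h ∈ H → (h : ℕ) < v + 1 → (h : ℕ) < v := by
          intro h hh hhv
          rcases Nat.lt_or_eq_of_le (Nat.lt_succ_iff.1 hhv) with hlt | heq
          · exact hlt
          · exact absurd (Fin.ext heq ▸ hh) hv
        refine ⟨sel, fun h hh hhv => i1 h hh (hlt h hh hhv), ?_⟩
        convert i2.congr (s' := s'.setReg 3 v) rfl (by simp) using 4 with h
        exact ⟨fun hh => ⟨hh.1, hlt h hh.1 hh.2⟩, fun hh => ⟨hh.1, by omega⟩⟩)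
  obtain ⟨sel, i1, i2⟩ := key
  refine ⟨sel, fun h hh => i1 h hh h.isLt, ?_⟩
  have hrun : select.run L s =
    (Cmd.forV 3 (.ite (.cell 16 (.reg 3)) selectStep .nop)).run L (s₁.setReg 21 0) := rfl
  rw [hrun]
  simpa using i2

/-! ### Filtering -/

/-- Tally the class of the vertex in register `r` if it is marked in array `12` and its class in
array `20`. -/
def tallyMarked (r : ℕ) : Cmd :=
  .ite (.cell 12 (.reg r)) (.ite (.cell 20 (.cell 18 (.reg r)))
    (tally 25 23 (.cell 18 (.reg r))) .nop) .nop

/-- Mark in array `22` the vertices close to all classes marked in array `20`. -/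
def check : Cmd :=
  .forV 3 (.set 23 (.const 0) ;; .put 25 (.cell 18 (.reg 3)) (.const 0) ;;
    .forN 3 5 (.put 25 (.cell 18 (.reg 5)) (.const 0)) ;;
    tallyMarked 3 ;; .forN 3 5 (tallyMarked 5) ;;
    .put 22 (.reg 3) (.bin .equal (.reg 23) (.reg 21)))

theorem tallyMarked_spec (L : Fin n → List (Fin n)) {cls : Fin n → ℕ} {S M U T : Set (Fin n)}
    {r : ℕ} {s : Store} {v : Fin n} (hr : s.reg r = v) (hv : v ∈ U)
    (h12 : ∀ v : Fin n, s.arr 12 v ≠ 0 ↔ v ∈ S) (h18 : ∀ v : Fin n, s.arr 18 v = cls v)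
    (h20 : ∀ v : Fin n, s.arr 20 (cls v) ≠ 0 ↔ v ∈ M)
    (ht : Tally cls U 25 23 {b | b ∈ T ∧ b ∈ S ∧ b ∈ M} s) :
    Tally cls U 25 23 {b | b ∈ insert v T ∧ b ∈ S ∧ b ∈ M} ((tallyMarked r).run L s) := by
  by_cases hS : v ∈ S ∧ v ∈ M
  · have hrun : (tallyMarked r).run L s = (tally 25 23 (.cell 18 (.reg r))).run L s := by
      simp [tallyMarked, hr, h18, (h12 v).2 hS.1, (h20 v).2 hS.2]
    rw [hrun]
    convert tally_spec L ht hv (e := .cell 18 (.reg r)) (by simp [hr, h18]) using 1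
    ext b
    simp only [Set.mem_ofPred_eq, Set.mem_insert_iff]
    constructor
    · rintro ⟨h | h, h'⟩
      · exact Or.inl h
      · exact Or.inr ⟨h, h'⟩
    · rintro (rfl | h)
      · exact ⟨Or.inl rfl, hS⟩
      · exact ⟨Or.inr h.1, h.2⟩
  · have hrun : (tallyMarked r).run L s = s := by
      have h1 := h12 v
      have h2 := h20 v
      by_cases hvS : s.arr 12 v = 0
      · simp [tallyMarked, hr, hvS]
      · have : s.arr 20 (cls v) = 0 := by
          by_contra h
          exact hS ⟨h1.1 hvS, h2.1 h⟩
        simp [tallyMarked, hr, hvS, h18, this]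
    rw [hrun]
    convert ht using 1
    ext b
    simp only [Set.mem_ofPred_eq, Set.mem_insert_iff]
    constructor
    · rintro ⟨rfl | h, h'⟩
      · exact absurd h' hS
      · exact ⟨h, h'⟩
    · exact fun h => ⟨Or.inr h.1, h.2⟩

/-- The selected classes met in the closed neighbourhood of `x` are among the classes of `T`. All
classes of `T` are met exactly when the two numbers agree, so one comparison of counters replaces a
search for every class. -/
theorem check_spec {G : SimpleGraph (Fin n)} {L : Fin n → List (Fin n)}
    (hL : IsAdjLists G L) {S T : Set (Fin n)} {cls : Fin n → ℕ} {s : Store}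
    (h12 : ∀ v : Fin n, s.arr 12 v ≠ 0 ↔ v ∈ S) (h18 : ∀ v : Fin n, s.arr 18 v = cls v)
    (ht : Tally cls Set.univ 20 21 T s) (x : Fin n) :
    (check.run L s).arr 22 x ≠ 0 ↔
      ∀ c ∈ T, ∃ b ∈ S, (b = x ∨ G.Adj x b) ∧ cls b = cls c := by
  set M : Set (Fin n) := {v | ∃ c ∈ T, cls c = cls v} with hM
  have h20 : ∀ v : Fin n, s.arr 20 (cls v) ≠ 0 ↔ v ∈ M := fun v => ht.mark v (Set.mem_univ v)
  have key := Cmd.forV_induct L (.set 23 (.const 0) ;; .put 25 (.cell 18 (.reg 3)) (.const 0) ;;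
    .forN 3 5 (.put 25 (.cell 18 (.reg 5)) (.const 0)) ;;
    tallyMarked 3 ;; .forN 3 5 (tallyMarked 5) ;;
    .put 22 (.reg 3) (.bin .equal (.reg 23) (.reg 21))) 3 s
    (fun i s' => ∀ x : Fin n, x < i → (s'.arr 22 x ≠ 0 ↔
      (cls '' {b | (b = x ∨ G.Adj x b) ∧ b ∈ S ∧ b ∈ M}).ncard = (cls '' T).ncard)) (by simp) (by
      intro v s' ha hr hI x hx
      have e12 : s'.arr 12 = s.arr 12 := ha 12 (by decide)
      have e18 : s'.arr 18 = s.arr 18 := ha 18 (by decide)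
      have e20 : s'.arr 20 = s.arr 20 := ha 20 (by decide)
      have r21 : s'.reg 21 = (cls '' T).ncard := (hr 21 (by decide) (by decide)).trans ht.count
      set U : Set (Fin n) := {b | b = v ∨ G.Adj v b} with hU
      set s₁ := ((s'.setReg 3 v).setReg 23 0).setArr 25 (cls v) 0 with hs₁
      set s₂ := (Cmd.forN 3 5 (.put 25 (.cell 18 (.reg 5)) (.const 0))).run L s₁ with hs₂
      set s₃ := (tallyMarked 3).run L s₂ with hs₃
      set s₄ := (Cmd.forN 3 5 (tallyMarked 5)).run L s₃ with hs₄
      -- Marks are cleared only for the classes of `v` and its neighbours. This suffices because no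
      -- other class is tallied in this round, and it keeps the cost proportional to the degree.
      have hreset := Cmd.forN_induct L (.put 25 (.cell 18 (.reg 5)) (.const 0)) 3 5 s₁ v
        (by simp [hs₁]) (fun pre s' => ∀ b, b = v ∨ b ∈ pre → s'.arr 25 (cls b) = 0)
        (by simp [hs₁]) (by
          intro pre w post s'' _ ha' _ hI' b hb
          have a18 : s''.arr 18 = s.arr 18 := by
            rw [ha' 18 (by decide)]
            funext i
            simp [hs₁, e18]
          have hrun : (Cmd.put 25 (.cell 18 (.reg 5)) (.const 0)).run L (s''.setReg 5 w) =
              (s''.setReg 5 w).setArr 25 (cls w) 0 := by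
            simp [a18, h18]
          rw [hrun]
          rw [List.mem_append, List.mem_singleton] at hb
          by_cases hbw : b = w
          · simp [hbw]
          · have := hI' b (by tauto)
            simp [this])
      have t₂ : Tally cls U 25 23 {b | b ∈ (∅ : Set (Fin n)) ∧ b ∈ S ∧ b ∈ M} s₂ := by
        refine ⟨fun b hb => ?_, ?_⟩
        · have := hreset b (by simpa [hU, (hL v).2] using hb)
          simp [hs₂, this]
        · rw [hs₂, Cmd.run_reg L _ _ (by decide)]
          simp [hs₁]
      have arr (k : ℕ) (hk : k ≠ 25) (i : ℕ) : s₂.arr k i = s'.arr k i := by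
        rw [hs₂, Cmd.run_arr L _ _ (by simpa [Cmd.wa] using hk)]
        simp [hs₁, hk]
      have t₃ := tallyMarked_spec L (r := 3) (v := v)
        (by rw [hs₂, Cmd.run_reg L _ _ (by decide)]; simp [hs₁]) (by simp [hU])
        (fun b => by rw [arr 12 (by decide), e12]; exact h12 b)
        (fun b => by rw [arr 18 (by decide), e18]; exact h18 b)
        (fun b => by rw [arr 20 (by decide), e20]; exact h20 b) t₂
      rw [← hs₃] at t₃
      have r3 : s₃.reg 3 = v := by
        rw [hs₃, Cmd.run_reg L _ _ (by decide), hs₂, Cmd.run_reg L _ _ (by decide)]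
        simp [hs₁]
      have t₄ := Cmd.forN_induct L (tallyMarked 5) 3 5 s₃ v r3
        (fun pre s'' => Tally cls U 25 23 {b | b ∈ {b | b = v ∨ b ∈ pre} ∧ b ∈ S ∧ b ∈ M} s'')
        (by simpa using t₃) (by
          intro pre w post s'' hpre ha' _ hI'
          have arr' (k : ℕ) (hk : k ≠ 25) (i : ℕ) : s''.arr k i = s'.arr k i := by
            rw [ha' k (by simpa [tallyMarked, tally, Cmd.wa] using hk), hs₃,
              Cmd.run_arr L _ _ (by simpa [tallyMarked, tally, Cmd.wa] using hk), arr k hk]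
          have hw : w ∈ U := Or.inr (((hL v).2 w).1 (by rw [hpre]; simp))
          have := tallyMarked_spec L (r := 5) (v := w) (s := s''.setReg 5 w) (by simp) hw
            (fun b => by rw [Store.setReg_arr, arr' 12 (by decide), e12]; exact h12 b)
            (fun b => by rw [Store.setReg_arr, arr' 18 (by decide), e18]; exact h18 b)
            (fun b => by rw [Store.setReg_arr, arr' 20 (by decide), e20]; exact h20 b)
            (hI'.congr rfl (by simp))
          convert this using 1
          ext b
          simp only [Set.mem_ofPred_eq, List.mem_append, List.mem_singleton, Set.mem_insert_iff]
          tauto)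
      rw [← hs₄] at t₄
      have hrun : (Cmd.set 23 (.const 0) ;; .put 25 (.cell 18 (.reg 3)) (.const 0) ;;
          .forN 3 5 (.put 25 (.cell 18 (.reg 5)) (.const 0)) ;;
          tallyMarked 3 ;; .forN 3 5 (tallyMarked 5) ;;
          .put 22 (.reg 3) (.bin .equal (.reg 23) (.reg 21))).run L (s'.setReg 3 v) =
          (Cmd.put 22 (.reg 3) (.bin .equal (.reg 23) (.reg 21))).run L s₄ := by
        have hp : (Cmd.put 25 (.cell 18 (.reg 3)) (.const 0)).run L
            ((Cmd.set 23 (.const 0)).run L (s'.setReg 3 v)) = s₁ := by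
          simp [hs₁, e18, h18]
        rw [Cmd.run_seq, Cmd.run_seq, hp]
        rfl
      have r3' : s₄.reg 3 = v := by
        rw [hs₄, Cmd.run_reg L _ _ (by decide), r3]
      have r21' : s₄.reg 21 = (cls '' T).ncard := by
        rw [hs₄, Cmd.run_reg L _ _ (by decide), hs₃, Cmd.run_reg L _ _ (by decide), hs₂,
          Cmd.run_reg L _ _ (by decide)]
        simpa [hs₁] using r21
      rw [hrun]
      by_cases hxv : x = v
      · subst hxv
        have hcount := t₄.count
        simp only [(hL x).2] at hcount
        simp [r3', hcount, r21', Set.mem_ofPred_eq]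
      · have hne : (x : ℕ) ≠ v := fun h => hxv (Fin.ext h)
        have h22 : s₄.arr 22 = s'.arr 22 := by
          rw [hs₄, Cmd.run_arr L _ _ (by decide), hs₃, Cmd.run_arr L _ _ (by decide)]
          funext i
          exact arr 22 (by decide) i
        have := hI x (by omega)
        simpa [r3', hne, h22] using this)
  rw [check, key x x.isLt]
  have hsub : cls '' {b | (b = x ∨ G.Adj x b) ∧ b ∈ S ∧ b ∈ M} ⊆ cls '' T := by
    rintro _ ⟨b, ⟨-, -, c, hc, hcb⟩, rfl⟩
    exact ⟨c, hc, hcb⟩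
  constructor
  · intro h c hc
    have heq := Set.eq_of_subset_of_ncard_le hsub h.ge (Set.toFinite _)
    have : cls c ∈ cls '' T := ⟨c, hc, rfl⟩
    rw [← heq] at this
    obtain ⟨b, ⟨h1, h2, -⟩, h3⟩ := this
    exact ⟨b, h2, h1, h3⟩
  · intro h
    congr 1
    refine hsub.antisymm ?_
    rintro _ ⟨c, hc, rfl⟩
    obtain ⟨b, hb, hbx, hbc⟩ := h c hc
    exact ⟨b, ⟨hbx, hb, c, hc, hbc.symm⟩, hbc⟩

/-- Mark in array `22` the vertices that pass the filter of the set marked in array `12` for the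
vertices marked in array `16`, whose numbers of neighbours are in array `17`. -/
def filter : Cmd := classes ;; select ;; check

/-- Equality of class numbers translates into equality of neighbourhoods in `H`, since both `b` and
`sel h` belong to `S`, where the partition is meaningful. -/
theorem filter_spec {G : SimpleGraph (Fin n)} {L : Fin n → List (Fin n)}
    (hL : IsAdjLists G L) (hc : G.Connected) {S H : Set (Fin n)} {s : Store}
    (h12 : ∀ v : Fin n, s.arr 12 v ≠ 0 ↔ v ∈ S) (h16 : ∀ v : Fin n, s.arr 16 v ≠ 0 ↔ v ∈ H)
    (h17 : ∀ v : Fin n, s.arr 17 v = {y | y ∈ H ∧ G.Adj v y}.ncard)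
    (hex : ∀ g ∈ H, ∃ b ∈ S, G.Adj b g) :
    (∃ sel : Fin n → Fin n, G.IsSelection S H sel ∧
      ∀ x : Fin n, (filter.run L s).arr 22 x ≠ 0 ↔ G.PassesFilter S H sel x) ∧
      Cmd.Linear L filter s := by
  obtain ⟨h1, h1'⟩ := classes_spec hL h12 h16
  set s₁ := classes.run L s with hs₁
  have h12' : ∀ v : Fin n, s₁.arr 12 v ≠ 0 ↔ v ∈ S := by
    rw [hs₁, Cmd.run_arr L _ _ (by decide)]
    exact h12
  have h16' : ∀ v : Fin n, s₁.arr 16 v ≠ 0 ↔ v ∈ H := by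
    rw [hs₁, Cmd.run_arr L _ _ (by decide)]
    exact h16
  obtain ⟨⟨sel, h2, h2'⟩, h3⟩ := select_spec hL (cls := fun v => s₁.arr 18 v) h12' h16'
    (by rw [hs₁, Cmd.run_arr L _ _ (by decide)]; exact h17) (fun _ => rfl) hex
  refine ⟨⟨sel, h2, fun x => ?_⟩, Cmd.Linear.seq h1' (Cmd.Linear.seq h3
    (Cmd.linear_forV (by decide) (by decide) _))⟩
  have h4 := check_spec hL (S := S) (cls := fun v => s₁.arr 18 v) (s := select.run L s₁)
    (by rw [Cmd.run_arr L _ _ (by decide)]; exact h12')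
    (by rw [Cmd.run_arr L _ _ (by decide)]; exact fun _ => rfl) h2' x
  rw [filter, Cmd.run_seq, Cmd.run_seq, h4]
  simp only [SimpleGraph.PassesFilter, Set.forall_mem_image]
  refine forall₂_congr fun h hh => exists_congr fun b => ?_
  constructor
  · rintro ⟨hb, hbx, hcls⟩
    refine ⟨hb, ?_, (h1 b hb _ (h2 h hh).1).1 hcls⟩
    rw [hc.dist_le_one_iff]
    exact hbx.imp Eq.symm id
  · rintro ⟨hb, hbx, hcls⟩
    rw [hc.dist_le_one_iff] at hbx
    exact ⟨hb, hbx.imp Eq.symm id, (h1 b hb _ (h2 h hh).1).2 hcls⟩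

/-! ### Sweeps -/

/-- Conjunction. -/
def Expr.and (e f : Expr) : Expr := .bin .less (.bin .equal e (.const 0)) (.bin .less (.const 0) f)

-- Between truth values `0 < 1` is the only strict inequality. A product would do as well, but
-- multiplication is not tame.
@[simp] theorem Expr.val_and (e f : Expr) (s : Store) :
    (e.and f).val s = if e.val s ≠ 0 ∧ f.val s ≠ 0 then 1 else 0 := by
  rw [Expr.and]
  by_cases he : e.val s = 0 <;> by_cases hf : f.val s = 0 <;> simp [he, hf, Nat.pos_iff_ne_zero]

/-- The vertex found last by a search. -/
def lastFound : Expr := .cell 11 (.bin .minus (.reg 0) (.const 1))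

theorem Searched.lastFound {D : Fin n → ℕ} {b : ℕ} {l : List (Fin n)} {s : Store}
    (h : Searched D b l s) (h0 : s.reg 0 = n) (hn : 0 < n) :
    ∃ w : Fin n, lastFound.val s = w ∧ ∀ z, D z ≤ D w := by
  have hlen := h.length
  refine ⟨l[n - 1], ?_, fun z => ?_⟩
  · rw [← h.queue, WordRAM.lastFound]
    simp [h0]
  · obtain ⟨i, hi, rfl⟩ := List.getElem_of_mem (h.mem z)
    rcases Nat.lt_or_eq_of_le (by omega : i ≤ n - 1) with hlt | heq
    · exact List.pairwise_iff_getElem.1 h.sorted i (n - 1) hi (by omega) hlt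
    · simp only [heq, le_refl]

/-- Search the graph from the vertex in register `x`. -/
def search (x : ℕ) : Cmd :=
  .forV 3 (.put 12 (.reg 3) (.bin .equal (.reg 3) (.reg x))) ;; .set 1 (.const 1) ;; bfs

theorem search_spec {G : SimpleGraph (Fin n)} {L : Fin n → List (Fin n)} (hL : IsAdjLists G L)
    (hc : G.Connected) {x : ℕ} (hx : x ≠ 3) {s : Store} {u : Fin n} (hu : s.reg x = u) :
    (∃ l, Searched (G.dist u) 1 l ((search x).run L s)) ∧ Cmd.Linear L (search x) s := by
  set s₁ := (Cmd.forV 3 (.put 12 (.reg 3) (.bin .equal (.reg 3) (.reg x)))).run L s with hs₁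
  have h12 : ∀ v : Fin n, s₁.arr 12 v = if v = u then 1 else 0 :=
    forV_put_spec L 12 _ s _ (fun s' v _ hr => by simp [hr x hx, hu, hx, Fin.ext_iff])
  obtain ⟨h1, h2⟩ := bfs_spec hL hc (SimpleGraph.IsDistTo.dist_singleton G u) (s₁.setReg 1 1)
    (fun v => by simp [h12]) (by simp)
  exact ⟨h1, (linear_forV_put s).seq ((Cmd.linear_of_flat (by decide) _).seq h2)⟩

/-- Write a vertex farthest from the one in register `x` into register `y`. -/
def farthest (x y : ℕ) : Cmd := search x ;; .set y lastFound

theorem farthest_spec {G : SimpleGraph (Fin n)} {L : Fin n → List (Fin n)} (hL : IsAdjLists G L)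
    (hc : G.Connected) {x y : ℕ} (hx : x ≠ 3) {s : Store} {u : Fin n} (hu : s.reg x = u)
    (h0 : s.reg 0 = n) :
    (∃ w : Fin n, ((farthest x y).run L s).reg y = w ∧ (∀ z, G.dist u z ≤ G.dist u w) ∧
      ∀ z : Fin n, ((farthest x y).run L s).arr 10 z = G.dist u z + 1) ∧
      Cmd.Linear L (farthest x y) s := by
  obtain ⟨⟨l, hl⟩, h1⟩ := search_spec hL hc hx hu
  obtain ⟨w, hw, hmax⟩ := hl.lastFound
    ((Cmd.run_reg L _ _ (by simp [search, bfs, bfsInit, bfsVisit, Cmd.wr])).trans h0)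
    (Fin.pos_iff_nonempty.2 ⟨u⟩)
  exact ⟨⟨w, by simp [farthest, hw], hmax, by simpa [farthest] using hl.dist⟩,
    h1.seq (Cmd.linear_of_flat rfl _)⟩

/-! ### Maxima -/

/-- Find a vertex marked in array `13` with largest entry in array `17`. -/
def argmax : Cmd :=
  .set 15 (.const 0) ;;
  .forV 3 (.ite (.cell 13 (.reg 3))
    (.ite (.bin .less (.reg 15) (Expr.inc (.cell 17 (.reg 3))))
      (.set 15 (Expr.inc (.cell 17 (.reg 3))) ;; .set 14 (.reg 3)) .nop) .nop)

/-- Register `15` holds the maximum plus one, so that `0` signals that no vertex is marked, even if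
all entries are zero. -/
theorem argmax_spec (L : Fin n → List (Fin n)) {P : Set (Fin n)} {f : Fin n → ℕ} {s : Store}
    (h13 : ∀ v : Fin n, s.arr 13 v ≠ 0 ↔ v ∈ P) (h17 : ∀ v : Fin n, s.arr 17 v = f v) :
    ((argmax.run L s).reg 15 = 0 ∧ P = ∅ ∨ ∃ c : Fin n, (argmax.run L s).reg 14 = c ∧ c ∈ P ∧
      (argmax.run L s).reg 15 = f c + 1 ∧ ∀ b ∈ P, f b ≤ f c) ∧ Cmd.Linear L argmax s := by
  refine ⟨?_, (Cmd.linear_of_flat rfl _).seq (Cmd.linear_forV (by decide) (by decide) _)⟩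
  have key := Cmd.forV_induct L (.ite (.cell 13 (.reg 3))
    (.ite (.bin .less (.reg 15) (Expr.inc (.cell 17 (.reg 3))))
      (.set 15 (Expr.inc (.cell 17 (.reg 3))) ;; .set 14 (.reg 3)) .nop) .nop) 3 (s.setReg 15 0)
    (fun i s' => (s'.reg 15 = 0 ∨ ∃ c : Fin n, s'.reg 14 = c ∧ c ∈ P ∧ s'.reg 15 = f c + 1) ∧
      ∀ b : Fin n, b < i → b ∈ P → f b < s'.reg 15) (by simp) (by
      rintro v s' ha - ⟨i1, i2⟩
      have a13 : s'.arr 13 = s.arr 13 := ha 13 (by decide)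
      have a17 : s'.arr 17 = s.arr 17 := ha 17 (by decide)
      by_cases hv : v ∈ P ∧ s'.reg 15 < f v + 1
      · have hrun : (Cmd.ite (.cell 13 (.reg 3))
            (.ite (.bin .less (.reg 15) (Expr.inc (.cell 17 (.reg 3))))
              (.set 15 (Expr.inc (.cell 17 (.reg 3))) ;; .set 14 (.reg 3)) .nop) .nop).run L
              (s'.setReg 3 v) = ((s'.setReg 3 v).setReg 15 (f v + 1)).setReg 14 v := by
          simp [a13, a17, (h13 v).2 hv.1, h17, hv.2]
        rw [hrun]
        refine ⟨Or.inr ⟨v, by simp, hv.1, by simp⟩, fun b hb hbP => ?_⟩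
        by_cases hbv : b = v
        · simp [hbv]
        · have := i2 b (by omega) hbP
          simp
          omega
      · have hrun : (Cmd.ite (.cell 13 (.reg 3))
            (.ite (.bin .less (.reg 15) (Expr.inc (.cell 17 (.reg 3))))
              (.set 15 (Expr.inc (.cell 17 (.reg 3))) ;; .set 14 (.reg 3)) .nop) .nop).run L
              (s'.setReg 3 v) = s'.setReg 3 v := by
          by_cases h : s.arr 13 v = 0
          · simp [a13, h]
          · have : ¬ s'.reg 15 < f v + 1 := fun hlt => hv ⟨(h13 v).1 h, hlt⟩
            simp [a13, a17, h, h17, this]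
        rw [hrun]
        refine ⟨by simpa using i1, fun b hb hbP => ?_⟩
        by_cases hbv : b = v
        · subst hbv
          have : ¬ s'.reg 15 < f b + 1 := fun hlt => hv ⟨hbP, hlt⟩
          simp
          omega
        · simpa using i2 b (by omega) hbP)
  obtain ⟨k1, k2⟩ := key
  have hrun : argmax.run L s = (Cmd.forV 3 (.ite (.cell 13 (.reg 3))
    (.ite (.bin .less (.reg 15) (Expr.inc (.cell 17 (.reg 3))))
      (.set 15 (Expr.inc (.cell 17 (.reg 3))) ;; .set 14 (.reg 3)) .nop) .nop)).run L
      (s.setReg 15 0) := rfl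
  rw [← hrun] at k1 k2
  rcases k1 with k1 | ⟨c, hc, hcP, hcf⟩
  · refine Or.inl ⟨k1, Set.eq_empty_of_forall_notMem fun b hb => ?_⟩
    have := k2 b b.isLt hb
    omega
  · refine Or.inr ⟨c, hc, hcP, hcf, fun b hb => ?_⟩
    have := k2 b b.isLt hb
    omega

/-! ### Filters and slices -/

/-- Mark in array `22` the vertices that pass the filter of the set marked in array `12` for the
gates of the vertices at distance one less than the content of register `13`. -/
def gateFilter : Cmd :=
  .set 1 (.const 1) ;; bfs ;; gates ;; .set 17 (.reg 13) ;; markGates ;; countMarked ;; filter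

theorem gateFilter_spec {G : SimpleGraph (Fin n)} {L : Fin n → List (Fin n)}
    (hL : IsAdjLists G L) (hh : G.IsHelly) (hc : G.Connected) {S : Set (Fin n)} (hS : S.Nonempty)
    (hS2 : ∀ p ∈ S, ∀ q ∈ S, G.dist p q ≤ 2) {r : ℕ} (h2 : 2 ≤ r) {s : Store}
    (h12 : ∀ v : Fin n, s.arr 12 v ≠ 0 ↔ v ∈ S) (h13 : s.reg 13 = r) :
    (∃ D g sel, G.IsDistTo S D ∧ G.IsGate S D g ∧
      G.IsSelection S (SimpleGraph.gatesAt D g (r - 1)) sel ∧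
      (∀ v : Fin n, (gateFilter.run L s).arr 10 v = D v + 1) ∧
      ∀ v : Fin n, (gateFilter.run L s).arr 22 v ≠ 0 ↔
        G.PassesFilter S (SimpleGraph.gatesAt D g (r - 1)) sel v) ∧
      Cmd.Linear L gateFilter s := by
  obtain ⟨D, hD⟩ := G.exists_isDistTo hS
  obtain ⟨⟨l, hl⟩, h1⟩ := bfs_spec hL hc hD (s.setReg 1 1) (by simpa using h12) (by simp)
  set s₁ := bfs.run L (s.setReg 1 1) with hs₁
  have a12 : s₁.arr 12 = s.arr 12 := Cmd.run_arr L _ _ (by decide)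
  obtain ⟨⟨g, hg, hg'⟩, h3⟩ := gates_spec hL hh hc hD hS2 (by rw [a12]; exact h12) hl
  set s₂ := gates.run L s₁ with hs₂
  have b12 : s₂.arr 12 = s.arr 12 := (Cmd.run_arr L _ _ (by decide)).trans a12
  have b10 : s₂.arr 10 = s₁.arr 10 := Cmd.run_arr L _ _ (by decide)
  have b13 : s₂.reg 13 = r := by
    rw [hs₂, Cmd.run_reg L _ _ (by decide), hs₁, Cmd.run_reg L _ _ (by decide)]
    simpa using h13
  -- Register `17` holds `r = (r - 1) + 1`, the shifted level `r - 1`, which is positive because `2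
  -- ≤ r`.
  obtain ⟨h4, h5⟩ := markGates_spec (L := L) (D := D) (g := g) (k := r - 1) (by omega)
    (s := s₂.setReg 17 r) (by simpa [b10] using hl.dist) (by simp; omega) (by simpa using hg')
  set s₃ := markGates.run L (s₂.setReg 17 r) with hs₃
  obtain ⟨h6, -, h7⟩ := countMarked_spec hL h4
  set s₄ := countMarked.run L s₃ with hs₄
  have c12 : s₄.arr 12 = s.arr 12 := (Cmd.run_arr L _ _ (by decide)).trans
    ((Cmd.run_arr L _ _ (by decide)).trans b12)
  have c10 : s₄.arr 10 = s₁.arr 10 := (Cmd.run_arr L _ _ (by decide)).trans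
    ((Cmd.run_arr L _ _ (by decide)).trans b10)
  have c16 : s₄.arr 16 = s₃.arr 16 := Cmd.run_arr L _ _ (by decide)
  obtain ⟨⟨sel, h8, h9⟩, h10⟩ := filter_spec hL hc (S := S) (s := s₄)
    (H := SimpleGraph.gatesAt D g (r - 1))
    (by rw [c12]; exact h12) (by rw [c16]; exact h4) h6 (by
      rintro _ ⟨z, hz, rfl⟩
      obtain ⟨q, hq, hqz⟩ := hD.exists_eq z
      exact ⟨q, hq, ((hg z (by omega)).2 q hq).2 hqz⟩)
  have hrun : gateFilter.run L s = filter.run L s₄ := by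
    simp only [gateFilter, Cmd.run_seq, Cmd.run_set, Expr.val_const, Expr.val_reg, ← hs₁, ← hs₂,
      b13, ← hs₃, ← hs₄]
  refine ⟨⟨D, g, sel, hD, hg, h8, fun v => ?_, fun v => ?_⟩, ?_⟩
  · rw [hrun, Cmd.run_arr L _ _ (by decide), c10, hl.dist]
    simp
  · rw [hrun, h9]
  · refine (Cmd.linear_of_flat rfl _).seq (h1.seq (h3.seq ((Cmd.linear_of_flat rfl _).seq ?_)))
    simp only [Cmd.run_set, Expr.val_reg, ← hs₂, b13]
    exact h5.seq (h7.seq h10)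

/-- In a clique, the central vertices are those adjacent to all gates. -/
theorem eccLe_iff_of_clique {G : SimpleGraph (Fin n)} (hc : G.Connected) {K : Set (Fin n)}
    (hK : ∀ x ∈ K, ∀ y ∈ K, G.dist x y ≤ 1) {D : Fin n → ℕ} {g : Fin n → Fin n}
    (hD : G.IsDistTo K D) (hg : G.IsGate K D g) {r : ℕ} (h1 : 1 ≤ r) {w : Fin n}
    (hw : ∀ z, D z ≤ D w) {x : Fin n} (hx : x ∈ K) :
    G.EccLe x r ↔ D w ≤ r ∧ {y | y ∈ SimpleGraph.gatesAt D g r ∧ G.Adj x y}.ncard =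
      (SimpleGraph.gatesAt D g r).ncard := by
  rw [ncard_inter_adj_eq_iff]
  constructor
  · refine fun h => ⟨(hD.le x hx w).trans (h w), ?_⟩
    rintro _ ⟨z, hz, rfl⟩
    exact ((hg z (by omega)).2 x hx).2 (le_antisymm ((h z).trans hz.ge) (hD.le x hx z))
  · rintro ⟨h2, h3⟩ z
    -- Vertices closer than `r` to the clique are reached from `x` with one additional step inside
    -- the clique; only the vertices at distance exactly `r` impose a condition, and it is adjacency
    -- to their gates.
    rcases Nat.lt_or_eq_of_le ((hw z).trans h2) with hlt | heq
    · obtain ⟨q, hq, hqz⟩ := hD.exists_eq z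
      have h4 := hc.dist_triangle (u := x) (v := q) (w := z)
      have h5 := hK x hx q hq
      omega
    · rw [((hg z (by omega)).2 x hx).1 (h3 _ ⟨z, heq, rfl⟩), heq]

/-- Mark in array `12` the intersection of the balls around the vertices in registers `10` and `11`
whose radii are in registers `18` and `19`. -/
def ballsInter : Cmd :=
  search 10 ;;
  .forV 3 (.put 13 (.reg 3) (.bin .less (.cell 10 (.reg 3)) (.bin .plus (.reg 18) (.const 2)))) ;;
  search 11 ;;
  .forV 3 (.put 12 (.reg 3) (Expr.and (.cell 13 (.reg 3))
    (.bin .less (.cell 10 (.reg 3)) (.bin .plus (.reg 19) (.const 2)))))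

/-- Array `10` holds distances plus one, so comparing it strictly with the radius plus two tests
membership in a closed ball. -/
theorem ballsInter_spec {G : SimpleGraph (Fin n)} {L : Fin n → List (Fin n)}
    (hL : IsAdjLists G L) (hc : G.Connected) {s : Store} {u w : Fin n} (hu : s.reg 10 = u)
    (hw : s.reg 11 = w) :
    (∀ v : Fin n, (ballsInter.run L s).arr 12 v ≠ 0 ↔
      G.dist u v ≤ s.reg 18 ∧ G.dist w v ≤ s.reg 19) ∧ Cmd.Linear L ballsInter s := by
  obtain ⟨⟨l, hl⟩, h1⟩ := search_spec hL hc (by decide) hu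
  set s₁ := (search 10).run L s with hs₁
  set s₂ := (Cmd.forV 3 (.put 13 (.reg 3)
    (.bin .less (.cell 10 (.reg 3)) (.bin .plus (.reg 18) (.const 2))))).run L s₁ with hs₂
  have r₂ (k : ℕ) (hk : k ≠ 3) (hk' : k ∉ (search 10).wr) : s₂.reg k = s.reg k :=
    (Cmd.run_reg L _ _ (by simpa [Cmd.wr] using hk)).trans (Cmd.run_reg L _ _ hk')
  have h13 : ∀ v : Fin n, s₂.arr 13 v = if G.dist u v ≤ s.reg 18 then 1 else 0 :=
    forV_put_spec L 13 _ s₁ _ (fun s' v ha hr => by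
      have h18 : s₁.reg 18 = s.reg 18 := Cmd.run_reg L _ _ (by decide)
      have hd := hl.dist v
      simp only [Expr.val_less, Expr.val_cell, Expr.val_reg, Store.setReg_reg, ↓reduceIte,
        Store.setReg_arr, ha 10 (by decide), hd, Expr.val_plus, Expr.val_const, hr 18 (by decide),
        h18, Nat.reduceEqDiff]
      congr 1
      rw [eq_iff_iff]
      omega)
  obtain ⟨⟨l', hl'⟩, h2⟩ := search_spec hL hc (x := 11) (s := s₂) (u := w) (by decide)
    (by rw [r₂ 11 (by decide) (by decide), hw])
  set s₃ := (search 11).run L s₂ with hs₃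
  have a13 : s₃.arr 13 = s₂.arr 13 := Cmd.run_arr L _ _ (by decide)
  have r19 : s₃.reg 19 = s.reg 19 := (Cmd.run_reg L _ _ (by decide)).trans
    (r₂ 19 (by decide) (by decide))
  have h12 : ∀ v : Fin n, (ballsInter.run L s).arr 12 v =
      if G.dist u v ≤ s.reg 18 ∧ G.dist w v ≤ s.reg 19 then 1 else 0 :=
    forV_put_spec L 12 _ s₃ _ (fun s' v ha hr => by
      have hd := hl'.dist v
      simp only [Expr.val_and, Expr.val_less, Expr.val_cell, Expr.val_reg, Store.setReg_reg,
        ↓reduceIte, Store.setReg_arr, ha 10 (by decide), ha 13 (by decide), hd, a13, h13,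
        Expr.val_plus, Expr.val_const, hr 19 (by decide), r19, Nat.reduceEqDiff]
      congr 1
      rw [eq_iff_iff]
      simp)
  exact ⟨fun v => by simp [h12], h1.seq ((linear_forV_put _).seq (h2.seq (linear_forV_put _)))⟩

/-- Mark in array `13` the vertices, in the clique marked in array `12`, whose eccentricity is at
most the content of register `13`. -/
def cliqueCenter : Cmd :=
  .set 1 (.const 1) ;; bfs ;; gates ;;
  .set 6 (.bin .less (.cell 10 lastFound) (.bin .plus (.reg 13) (.const 2))) ;;
  .set 17 (Expr.inc (.reg 13)) ;; markGates ;; countMarked ;;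
  .forV 3 (.put 13 (.reg 3) (Expr.and (.cell 12 (.reg 3))
    (Expr.and (.reg 6) (.bin .equal (.cell 17 (.reg 3)) (.reg 16)))))

/-- By `eccLe_iff_of_clique`, eccentricity at most `r` amounts to two tests: the vertex found last
by the search from `K` is within distance `r`, which is a global flag in register `6`, and the
vertex sees all gates of level `r`, which is a comparison of counts. -/
theorem cliqueCenter_spec {G : SimpleGraph (Fin n)} {L : Fin n → List (Fin n)}
    (hL : IsAdjLists G L) (hh : G.IsHelly) (hc : G.Connected) {K : Set (Fin n)} (hK : K.Nonempty)
    (hK1 : ∀ x ∈ K, ∀ y ∈ K, G.dist x y ≤ 1) {r : ℕ} (h1 : 1 ≤ r) {s : Store}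
    (h0 : s.reg 0 = n) (h12 : ∀ v : Fin n, s.arr 12 v ≠ 0 ↔ v ∈ K) (h13 : s.reg 13 = r) :
    (∃ D g, G.IsDistTo K D ∧ G.IsGate K D g ∧
      (∀ v : Fin n, (cliqueCenter.run L s).arr 10 v = D v + 1) ∧
      (∀ v : Fin n, D v ≠ 0 → (cliqueCenter.run L s).arr 15 v = g v) ∧
      ∀ v : Fin n, (cliqueCenter.run L s).arr 13 v ≠ 0 ↔ v ∈ K ∧ G.EccLe v r) ∧
      Cmd.Linear L cliqueCenter s := by
  obtain ⟨D, hD⟩ := G.exists_isDistTo hK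
  obtain ⟨⟨l, hl⟩, t1⟩ := bfs_spec hL hc hD (s.setReg 1 1) (by simpa using h12) (by simp)
  rw [Store.setReg_reg, if_pos rfl] at hl
  set s₁ := bfs.run L (s.setReg 1 1) with hs₁
  have a12 : s₁.arr 12 = s.arr 12 := Cmd.run_arr L _ _ (by decide)
  obtain ⟨⟨g, hg, hg'⟩, t2⟩ := gates_spec hL hh hc hD
    (fun p hp q hq => (hK1 p hp q hq).trans (by omega)) (by rw [a12]; exact h12) hl
  set s₂ := gates.run L s₁ with hs₂
  have b12 : s₂.arr 12 = s.arr 12 := (Cmd.run_arr L _ _ (by decide)).trans a12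
  have b10 : s₂.arr 10 = s₁.arr 10 := Cmd.run_arr L _ _ (by decide)
  have b11 : s₂.arr 11 = s₁.arr 11 := Cmd.run_arr L _ _ (by decide)
  have b13 : s₂.reg 13 = r := by
    rw [hs₂, Cmd.run_reg L _ _ (by decide), hs₁, Cmd.run_reg L _ _ (by decide)]
    simpa using h13
  have b0 : s₂.reg 0 = n := by
    rw [hs₂, Cmd.run_reg L _ _ (by decide), hs₁, Cmd.run_reg L _ _ (by decide)]
    simpa using h0
  have hl₂ : Searched D 1 l s₂ := ⟨hl.nodup, hl.length, hl.sorted, by rw [b11]; exact hl.queue,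
    by rw [b10]; exact hl.dist⟩
  obtain ⟨w, hw, hmax⟩ := hl₂.lastFound b0 (Fin.pos_iff_nonempty.2 ⟨hK.some⟩)
  set s₃ := (s₂.setReg 6 (if D w ≤ r then 1 else 0)).setReg 17 (r + 1) with hs₃
  have e₃ : (Cmd.set 17 (Expr.inc (.reg 13))).run L ((Cmd.set 6 (.bin .less (.cell 10 lastFound)
      (.bin .plus (.reg 13) (.const 2)))).run L s₂) = s₃ := by
    have : D w + 1 < r + 2 ↔ D w ≤ r := by omega
    simp [hw, hl₂.dist, b13, hs₃, this]
  obtain ⟨h4, t3⟩ := markGates_spec (L := L) (D := D) (g := g) (k := r) (by omega)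
    (s := s₃) (by simpa [hs₃] using hl₂.dist) (by simp [hs₃]) (by simpa [hs₃] using hg')
  set s₄ := markGates.run L s₃ with hs₄
  obtain ⟨h5, h6, t4⟩ := countMarked_spec hL h4
  set s₅ := countMarked.run L s₄ with hs₅
  have arr₅ (k : ℕ) (hk : k ∉ countMarked.wa) (hk' : k ∉ markGates.wa) :
      s₅.arr k = s₂.arr k := by
    rw [hs₅, Cmd.run_arr L _ _ hk, hs₄, Cmd.run_arr L _ _ hk']
    rfl
  have r6 : s₅.reg 6 = if D w ≤ r then 1 else 0 := by
    rw [hs₅, Cmd.run_reg L _ _ (by decide), hs₄, Cmd.run_reg L _ _ (by decide)]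
    simp [hs₃]
  set c := Cmd.forV 3 (.put 13 (.reg 3) (Expr.and (.cell 12 (.reg 3))
    (Expr.and (.reg 6) (.bin .equal (.cell 17 (.reg 3)) (.reg 16))))) with hcdef
  have h7 : ∀ v : Fin n, (c.run L s₅).arr 13 v = if s.arr 12 v ≠ 0 ∧ D w ≤ r ∧
      {y | y ∈ SimpleGraph.gatesAt D g r ∧ G.Adj v y}.ncard =
        (SimpleGraph.gatesAt D g r).ncard then 1 else 0 :=
    forV_put_spec L 13 _ s₅ _ (fun s' v ha hr => by
      have hv := h5 v
      simp only [Expr.val_and, Expr.val_equal, Expr.val_cell, Expr.val_reg, Store.setReg_reg,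
        ↓reduceIte, Store.setReg_arr, ha 12 (by decide), ha 17 (by decide), hv,
        hr 6 (by decide), hr 16 (by decide), Nat.reduceEqDiff, r6, h6,
        arr₅ 12 (by decide) (by decide), b12]
      congr 1
      rw [eq_iff_iff]
      simp)
  have hrun : cliqueCenter.run L s = c.run L s₅ := by
    rw [hs₅, hs₄, ← e₃]
    rfl
  refine ⟨⟨D, g, hD, hg, fun v => ?_, fun v hv => ?_, fun v => ?_⟩, ?_⟩
  · rw [hrun, Cmd.run_arr L _ _ (by decide), arr₅ 10 (by decide) (by decide), hl₂.dist]
  · rw [hrun, Cmd.run_arr L _ _ (by decide), arr₅ 15 (by decide) (by decide), hg' v hv]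
  · rw [hrun, h7]
    have := h12 v
    by_cases hv : v ∈ K
    · rw [eccLe_iff_of_clique hc hK1 hD hg h1 hmax hv]
      simp only [this, hv, true_and]
      simp
    · simp [hv, this]
  · refine (Cmd.linear_of_flat rfl _).seq (t1.seq (t2.seq ((Cmd.linear_of_flat rfl _).seq
      ((Cmd.linear_of_flat rfl _).seq (Cmd.Linear.seq ?_ (Cmd.Linear.seq ?_
        (linear_forV_put _)))))))
    · rw [← e₃] at t3
      exact t3
    · rw [hs₄, ← e₃] at t4
      exact t4

/-- In the slice given by registers `10`, `11`, `18` and `19`, mark in array `13` the vertices of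
eccentricity at most the content of register `13`, and find one of them that is adjacent to the
largest number of gates. -/
def slice : Cmd :=
  ballsInter ;; cliqueCenter ;; .set 17 (.reg 13) ;; markGates ;; countMarked ;; argmax

/-- Two levels of gates are in play: level `r` decides which vertices of the clique have
eccentricity at most `r`, and level `r - 1` measures the extremality needed for
`IsHelly.not_eccLe_of_extremal`. -/
theorem slice_spec {G : SimpleGraph (Fin n)} {L : Fin n → List (Fin n)}
    (hL : IsAdjLists G L) (hh : G.IsHelly) (hc : G.Connected) (h4 : G.IsC4Free) {r : ℕ}
    (h1 : 1 ≤ r) {s : Store} {u w : Fin n} (h0 : s.reg 0 = n) (hu : s.reg 10 = u)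
    (hw : s.reg 11 = w) (huw : G.dist u w = s.reg 18 + s.reg 19) (h13 : s.reg 13 = r)
    {K : Set (Fin n)} (hK : K = {v | G.dist u v ≤ s.reg 18 ∧ G.dist w v ≤ s.reg 19}) :
    (∀ v : Fin n, (slice.run L s).arr 13 v ≠ 0 ↔ v ∈ K ∧ G.EccLe v r) ∧
      ((slice.run L s).reg 15 = 0 → ∀ v ∈ K, ¬ G.EccLe v r) ∧
      ((slice.run L s).reg 15 ≠ 0 → ∃ c : Fin n, (slice.run L s).reg 14 = c ∧ c ∈ K ∧
        G.EccLe c r ∧ (2 ≤ r → ∃ D g, G.IsDistTo K D ∧ G.IsGate K D g ∧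
          ∀ b ∈ K, G.EccLe b r →
            {y | y ∈ SimpleGraph.gatesAt D g (r - 1) ∧ G.Adj b y}.ncard ≤
              {y | y ∈ SimpleGraph.gatesAt D g (r - 1) ∧ G.Adj c y}.ncard)) ∧
      Cmd.Linear L slice s := by
  obtain ⟨g1, t1⟩ := ballsInter_spec hL hc hu hw
  set s₁ := ballsInter.run L s with hs₁
  have hK1 : ∀ x ∈ K, ∀ y ∈ K, G.dist x y ≤ 1 := by
    intro x hx y hy
    rw [hK] at hx hy
    rw [hc.dist_le_one_iff]
    by_cases hne : x = y
    · exact Or.inl hne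
    · exact Or.inr (hh.slice_adj hc h4 huw hx.1 hx.2 hy.1 hy.2 hne)
  have hKn : K.Nonempty := by
    obtain ⟨x, hx⟩ := hc.exists_dist_le huw.le
    rw [hK]
    exact ⟨x, by simpa [G.dist_comm] using hx⟩
  have r0 : s₁.reg 0 = n := (Cmd.run_reg L _ _ (by decide)).trans h0
  have r13 : s₁.reg 13 = r := (Cmd.run_reg L _ _ (by decide)).trans h13
  obtain ⟨⟨D, g, hD, hg, a10, a15, a13⟩, t2⟩ := cliqueCenter_spec hL hh hc hKn hK1 h1 r0
    (by rw [hK]; exact g1) r13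
  set s₂ := cliqueCenter.run L s₁ with hs₂
  have b13 : s₂.reg 13 = r := (Cmd.run_reg L _ _ (by decide)).trans r13
  set s₃ := s₂.setReg 17 r with hs₃
  set s₄ := markGates.run L s₃ with hs₄
  -- For `r = 1` the marked level is `0`, where gates have no meaning. The marks are therefore taken
  -- as they are, and identified with gates only under the assumption `2 ≤ r`.
  set H : Set (Fin n) := {y | s₄.arr 16 y ≠ 0} with hH
  obtain ⟨g5, -, t4⟩ := countMarked_spec hL (s := s₄) (H := H) (fun y => Iff.rfl)
  set s₅ := countMarked.run L s₄ with hs₅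
  have c13 : s₅.arr 13 = s₂.arr 13 := by
    rw [hs₅, Cmd.run_arr L _ _ (by decide), hs₄, Cmd.run_arr L _ _ (by decide)]
    rfl
  obtain ⟨g6, t5⟩ := argmax_spec L (P := {v | v ∈ K ∧ G.EccLe v r}) (s := s₅)
    (by rw [c13]; exact a13) g5
  have hrun : slice.run L s = argmax.run L s₅ := by
    simp only [slice, Cmd.run_seq, Cmd.run_set, Expr.val_reg, ← hs₁, ← hs₂, b13, ← hs₃, ← hs₄,
      ← hs₅]
  have t3 : Cmd.Linear L markGates s₃ :=
    (linear_forV_put _).seq (Cmd.linear_forV (by decide) (by decide) _)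
  rw [hrun]
  refine ⟨fun v => ?_, fun h v hv hvr => ?_, fun h => ?_, t1.seq (t2.seq
    ((Cmd.linear_of_flat rfl _).seq (Cmd.Linear.seq ?_ (Cmd.Linear.seq ?_ ?_))))⟩
  · rw [Cmd.run_arr L _ _ (by decide), c13, a13]
  · rcases g6 with ⟨-, he⟩ | ⟨c, -, -, hc', -⟩
    · have : v ∈ {v | v ∈ K ∧ G.EccLe v r} := ⟨hv, hvr⟩
      rw [he] at this
      exact this
    · omega
  · rcases g6 with ⟨h', -⟩ | ⟨c, hc', hcP, -, hmax⟩
    · exact absurd h' h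
    · refine ⟨c, hc', hcP.1, hcP.2, fun h2 => ⟨D, g, hD, hg, fun b hb hbr => ?_⟩⟩
      have := hmax b ⟨hb, hbr⟩
      have hHg : H = SimpleGraph.gatesAt D g (r - 1) := by
        ext y
        exact (markGates_spec (L := L) (D := D) (g := g) (k := r - 1) (by omega)
          (s := s₃) (by simpa [hs₃] using a10) (by simp [hs₃]; omega)
          (by simpa [hs₃] using a15)).1 y
      rwa [hHg] at this
  · simpa only [Cmd.run_set, Expr.val_reg, ← hs₂, b13] using t3
  · simpa only [Cmd.run_set, Expr.val_reg, ← hs₂, b13] using t4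
  · simpa only [Cmd.run_set, Expr.val_reg, ← hs₂, b13] using t5

end WordRAM

/-! ### Existence of the radius -/

namespace SimpleGraph

variable {V : Type*} [Finite V] [Nonempty V] {G : SimpleGraph V}

theorem exists_isRad (G : SimpleGraph V) : ∃ r, G.IsRad r := by
  classical
  have hex : ∃ r c, G.EccLe c r := by
    obtain ⟨c⟩ := ‹Nonempty V›
    obtain ⟨u, hu⟩ := G.exists_farthest c
    exact ⟨_, c, hu⟩
  exact ⟨Nat.find hex, Nat.find_spec hex, fun c k h => Nat.find_min' hex ⟨c, h⟩⟩

end SimpleGraph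

namespace WordRAM

variable {n : ℕ}

/-! ### The center -/

/-- Write a vertex farthest from the one in register `10` into register `11`, and their distance
into register `12`. -/
def sweep : Cmd := farthest 10 11 ;; .set 12 (.bin .minus (.cell 10 (.reg 11)) (.const 1))

theorem sweep_spec {G : SimpleGraph (Fin n)} {L : Fin n → List (Fin n)} (hL : IsAdjLists G L)
    (hc : G.Connected) {s : Store} {u : Fin n} (hu : s.reg 10 = u) (h0 : s.reg 0 = n) :
    (∃ w : Fin n, (sweep.run L s).reg 11 = w ∧ (∀ z, G.dist u z ≤ G.dist u w) ∧
      (sweep.run L s).reg 12 = G.dist u w) ∧ Cmd.Linear L sweep s := by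
  obtain ⟨⟨w, h1, h2, h3⟩, h4⟩ := farthest_spec hL hc (y := 11) (by decide) hu h0
  exact ⟨⟨w, by simp [sweep, h1], h2, by simp [sweep, h1, h3]⟩, h4.seq (Cmd.linear_of_flat rfl _)⟩

/-- The slice between the vertices in registers `10` and `11`, which are at the distance in
register `12`, that contains central vertices if the radius is in register `13`. -/
def sliceAt : Cmd := .set 18 (.bin .minus (.reg 12) (.reg 13)) ;; .set 19 (.reg 13) ;; slice

/-- Here `r` is any candidate for the radius. A vertex of eccentricity at most `r` is automatically
within `r` of `w`, so `A` consists of the vertices of the slice with this property. If any vertex of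
the graph has eccentricity at most `r`, the Helly property places one in the slice; an empty answer
therefore refutes the candidate. -/
theorem sliceAt_spec {G : SimpleGraph (Fin n)} {L : Fin n → List (Fin n)}
    (hL : IsAdjLists G L) (hh : G.IsHelly) (hc : G.Connected) (h4 : G.IsC4Free) {r : ℕ}
    (h1 : 1 ≤ r) {s : Store} {u w : Fin n} (h0 : s.reg 0 = n) (hu : s.reg 10 = u)
    (hw : s.reg 11 = w) (h12 : s.reg 12 = G.dist u w) (huw : ∀ z, G.dist u z ≤ G.dist u w)
    (h13 : s.reg 13 = r) (hr : r ≤ G.dist u w) {A : Set (Fin n)}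
    (hA : A = {a | G.EccLe a r ∧ G.dist u a ≤ G.dist u w - r}) :
    (∀ v : Fin n, (sliceAt.run L s).arr 13 v ≠ 0 ↔ v ∈ A) ∧
      (∀ a ∈ A, ∀ b ∈ A, G.dist a b ≤ 1) ∧
      ((sliceAt.run L s).reg 15 = 0 → ∀ v, ¬ G.EccLe v r) ∧
      ((sliceAt.run L s).reg 15 ≠ 0 → ∃ c : Fin n, (sliceAt.run L s).reg 14 = c ∧ c ∈ A) ∧
      Cmd.Linear L sliceAt s := by
  obtain ⟨g1, g2, g3, g4⟩ := slice_spec hL hh hc h4 h1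
    (s := (s.setReg 18 (G.dist u w - r)).setReg 19 r) (u := u) (w := w) (by simpa using h0)
    (by simpa using hu) (by simpa using hw) (by simp; omega) (by simpa using h13) rfl
  have hrun : sliceAt.run L s = slice.run L ((s.setReg 18 (G.dist u w - r)).setReg 19 r) := by
    simp [sliceAt, h12, h13]
  simp only [Store.setReg_reg, Nat.reduceEqDiff, ↓reduceIte, Set.mem_ofPred_eq] at g1 g2 g3
  rw [hrun]
  refine ⟨fun v => ?_, fun a ha b hb => ?_, fun h v hv => ?_, fun h => ?_, ?_⟩
  · rw [g1, hA]
    constructor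
    · exact fun h => ⟨h.2, h.1.1⟩
    · exact fun h => ⟨⟨h.2, by rw [G.dist_comm]; exact h.1 w⟩, h.1⟩
  · rw [hA] at ha hb
    rw [hc.dist_le_one_iff]
    by_cases hne : a = b
    · exact Or.inl hne
    · exact Or.inr (hh.slice_adj hc h4 (u := u) (w := w) (a := G.dist u w - r) (b := r) (by omega)
        ha.2 (by rw [G.dist_comm]; exact ha.1 w) hb.2 (by rw [G.dist_comm]; exact hb.1 w) hne)
  · obtain ⟨b, hb, hub, -⟩ := hh.exists_center hc hv u (G.dist u w - r)
      (fun z => (huw z).trans (by omega)) ∅ 0 (by simp) (by simp) (by simp)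
    exact g2 h b ⟨hub, by rw [G.dist_comm]; exact hb w⟩ hb
  · obtain ⟨c, hc, hcK, hcr, -⟩ := g3 h
    exact ⟨c, hc, by rw [hA]; exact ⟨hcr, hcK.1⟩⟩
  · refine (Cmd.linear_of_flat rfl _).seq ((Cmd.linear_of_flat rfl _).seq ?_)
    simpa [h12, h13] using g4

/-- Write the radius into register `13` and a central vertex into register `14`. -/
def radius : Cmd :=
  .set 10 (.const 0) ;; farthest 10 11 ;; .set 10 (.reg 11) ;; sweep ;;
  .set 13 (.bin .quot (Expr.inc (.reg 12)) (.const 2)) ;; sliceAt ;;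
  .ite (.reg 15) .nop (.set 13 (Expr.inc (.reg 13)) ;; sliceAt)

/-- The eccentricity of `u` lies between `2 * r - 3` and `2 * r`, so only two radii are possible.
The smaller one is tested on a slice, and a failure proves that the larger one is correct. -/
theorem radius_spec {G : SimpleGraph (Fin n)} {L : Fin n → List (Fin n)}
    (hL : IsAdjLists G L) (hh : G.IsHelly) (hc : G.Connected) (h4 : G.IsC4Free) {r : ℕ}
    (hr : G.IsRad r) (h2 : 2 ≤ r) {s : Store} (h0 : s.reg 0 = n) :
    (radius.run L s).reg 13 = r ∧
      (∃ c : Fin n, (radius.run L s).reg 14 = c ∧ G.EccLe c r) ∧ Cmd.Linear L radius s := by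
  have hn : 0 < n := Fin.pos_iff_nonempty.2 hc.nonempty
  obtain ⟨⟨u, hu, hmax, -⟩, t1⟩ := farthest_spec hL hc (x := 10) (y := 11) (by decide)
    (s := s.setReg 10 0) (u := ⟨0, hn⟩) (by simp) (by simpa using h0)
  set s₁ := (farthest 10 11).run L (s.setReg 10 0) with hs₁
  have r0 : s₁.reg 0 = n := (Cmd.run_reg L _ _ (by decide)).trans (by simpa using h0)
  obtain ⟨⟨w, hw, hmax', he⟩, t2⟩ := sweep_spec hL hc (s := s₁.setReg 10 u) (u := u) (by simp)
    (by simpa using r0)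
  set s₂ := sweep.run L (s₁.setReg 10 u) with hs₂
  obtain ⟨b1, b2⟩ := hh.rad_le_of_farthest hc h4 hr hmax hmax'
  have hre : r ≤ G.dist u w := hr.le u _ hmax'
  -- Half the eccentricity of `u`, rounded up: this is `r - 1` for `2 * r - 3` and `2 * r - 2`, and
  -- `r` for `2 * r - 1` and `2 * r`.
  set r' := (G.dist u w + 1) / 2 with hr'
  set s₃ := s₂.setReg 13 r' with hs₃
  have c0 : s₃.reg 0 = n := by
    simp only [hs₃, Store.setReg_reg, ↓reduceIte, OfNat.zero_ne_ofNat]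
    rw [hs₂, Cmd.run_reg L _ _ (by decide)]
    simpa using r0
  have c10 : s₃.reg 10 = u := by
    simp only [hs₃, Store.setReg_reg, Nat.reduceEqDiff, ↓reduceIte]
    rw [hs₂, Cmd.run_reg L _ _ (by decide)]
    simp
  have c11 : s₃.reg 11 = w := by simpa [hs₃] using hw
  have c12 : s₃.reg 12 = G.dist u w := by simpa [hs₃] using he
  obtain ⟨-, -, g3, g4, t3⟩ := sliceAt_spec hL hh hc h4 (r := r') (by omega) c0 c10 c11 c12 hmax'
    (by simp [hs₃]) (by omega) rfl
  set s₄ := sliceAt.run L s₃ with hs₄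
  have d (k : ℕ) (hk : k ∉ sliceAt.wr) : s₄.reg k = s₃.reg k := Cmd.run_reg L _ _ hk
  have d13 : s₄.reg 13 = r' := (d 13 (by decide)).trans (by simp [hs₃])
  set s₅ := s₄.setReg 13 (r' + 1) with hs₅
  have hrun : radius.run L s = if s₄.reg 15 = 0 then sliceAt.run L s₅ else s₄ := by
    simp only [radius, Cmd.run_seq, Cmd.run_set, Cmd.run_ite, Cmd.run_nop, Expr.val_const,
      Expr.val_reg, ← hs₁, hu, ← hs₂, Expr.val_quot, Expr.val_inc, he, ← hr', ← hs₃, ← hs₄, d13,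
      ← hs₅]
  have hsec : s₄.reg 15 = 0 → r = r' + 1 := by
    intro h
    have : r ≠ r' := by
      rintro h'
      obtain ⟨c, hcr⟩ := hr.exists_eccLe
      exact g3 h c (h' ▸ hcr)
    omega
  have hfin : s₄.reg 15 = 0 → (sliceAt.run L s₅).reg 13 = r ∧
      (∃ c : Fin n, (sliceAt.run L s₅).reg 14 = c ∧ G.EccLe c r) ∧ Cmd.Linear L sliceAt s₅ := by
    intro h
    have hrr := hsec h
    obtain ⟨-, -, g3', g4', t4⟩ := sliceAt_spec hL hh hc h4 (r := r) (s := s₅) (u := u) (w := w)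
      (by omega) (by simp [hs₅, d 0 (by decide), c0]) (by simp [hs₅, d 10 (by decide), c10])
      (by simp [hs₅, d 11 (by decide), c11]) (by simp [hs₅, d 12 (by decide), c12]) hmax'
      (by simp [hs₅, hrr]) (by omega) rfl
    refine ⟨(Cmd.run_reg L _ _ (by decide)).trans (by simp [hs₅, hrr]), ?_, t4⟩
    obtain ⟨c, hcr⟩ := hr.exists_eccLe
    obtain ⟨c', hc', hcA⟩ := g4' (fun h => g3' h c hcr)
    exact ⟨c', hc', hcA.1⟩
  have hlin : Cmd.Linear L radius s := by
    refine (Cmd.linear_of_flat rfl _).seq (t1.seq ((Cmd.linear_of_flat rfl _).seq (Cmd.Linear.seq ?_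
      ((Cmd.linear_of_flat rfl _).seq (Cmd.Linear.seq ?_ (Cmd.Linear.ite
        (fun _ => Cmd.linear_of_flat rfl _)
        (fun h => (Cmd.linear_of_flat rfl _).seq ?_)))))))
    all_goals simp only [Cmd.run_set, Expr.val_const, Expr.val_reg, ← hs₁, hu, ← hs₂, Expr.val_quot,
      Expr.val_inc, he, ← hr', ← hs₃, ← hs₄, d13, ← hs₅] at *
    · exact t2
    · exact t3
    · exact (hfin h).2.2
  rw [hrun]
  split_ifs with h
  · exact ⟨(hfin h).1, (hfin h).2.1, hlin⟩
  · obtain ⟨c, hc', hcA⟩ := g4 h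
    have : r = r' := le_antisymm (hr.le c _ hcA.1) (by omega)
    exact ⟨d13.trans this.symm, ⟨c, hc', this ▸ hcA.1⟩, hlin⟩

/-- Given the radius in register `13` and a central vertex in register `14`, write a vertex of
almost maximal eccentricity into register `10`. -/
def remote : Cmd :=
  .set 10 (.reg 14) ;; farthest 10 11 ;; .set 18 (.const 1) ;;
  .set 19 (.bin .minus (.reg 13) (.const 1)) ;; slice ;;
  .ite (.reg 15) (.set 10 (.reg 14) ;; farthest 10 11) .nop ;; .set 10 (.reg 11)

/-- Let `u₀` be farthest from `c`. If no central vertex is at distance at most one from `c` and at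
most `r - 1` from `u₀`, then `u₀` itself has eccentricity above `2 * r - 2`. Otherwise an extremal
central vertex `c'` of this slice exists, and a vertex farthest from `c'` will do. -/
theorem remote_spec {G : SimpleGraph (Fin n)} {L : Fin n → List (Fin n)}
    (hL : IsAdjLists G L) (hh : G.IsHelly) (hc : G.Connected) (h4 : G.IsC4Free) {r : ℕ}
    (hr : G.IsRad r) (h2 : 2 ≤ r) {s : Store} (h0 : s.reg 0 = n) (h13 : s.reg 13 = r) {c : Fin n}
    (h14 : s.reg 14 = c) (hcr : G.EccLe c r) :
    (∃ u : Fin n, (remote.run L s).reg 10 = u ∧ ¬ G.EccLe u (2 * r - 2)) ∧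
      Cmd.Linear L remote s := by
  have hdist : ∀ {c u : Fin n}, G.EccLe c r → (∀ z, G.dist c z ≤ G.dist c u) →
      G.dist c u = r := fun h h' => le_antisymm (h _) (hr.le _ _ h')
  obtain ⟨⟨u₀, hu₀, hmax, -⟩, t1⟩ := farthest_spec hL hc (x := 10) (y := 11) (by decide)
    (s := s.setReg 10 c) (u := c) (by simp) (by simpa using h0)
  set s₁ := (farthest 10 11).run L (s.setReg 10 c) with hs₁
  have a (k : ℕ) (hk : k ≠ 10) (hk' : k ∉ (farthest 10 11).wr) : s₁.reg k = s.reg k :=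
    (Cmd.run_reg L _ _ hk').trans (by simp [hk])
  have a13 : s₁.reg 13 = r := (a 13 (by decide) (by decide)).trans h13
  have a0 : s₁.reg 0 = n := (a 0 (by decide) (by decide)).trans h0
  have a10 : s₁.reg 10 = c := (Cmd.run_reg L _ _ (by decide)).trans (by simp)
  have hd := hdist hcr hmax
  set s₂ := (s₁.setReg 18 1).setReg 19 (r - 1) with hs₂
  obtain ⟨-, g2, g3, t2⟩ := slice_spec hL hh hc h4 (r := r) (by omega) (s := s₂) (u := c) (w := u₀)
    (by simpa [hs₂] using a0) (by simpa [hs₂] using a10) (by simpa [hs₂] using hu₀)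
    (by simp [hs₂]; omega) (by simpa [hs₂] using a13)
    (K := {v | G.dist c v ≤ 1 ∧ G.dist u₀ v ≤ r - 1}) (by simp [hs₂])
  set s₃ := slice.run L s₂ with hs₃
  have b (k : ℕ) (hk : k ∉ slice.wr) : s₃.reg k = s₂.reg k := Cmd.run_reg L _ _ hk
  have b0 : s₃.reg 0 = n := (b 0 (by decide)).trans (by simpa [hs₂] using a0)
  have b11 : s₃.reg 11 = u₀ := (b 11 (by decide)).trans (by simpa [hs₂] using hu₀)
  set s₄ := s₃.setReg 10 (s₃.reg 14) with hs₄
  have hrun : remote.run L s = if s₃.reg 15 = 0 then s₃.setReg 10 (s₃.reg 11) else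
      ((farthest 10 11).run L s₄).setReg 10 (((farthest 10 11).run L s₄).reg 11) := by
    simp only [remote, Cmd.run_seq, Cmd.run_set, Cmd.run_ite, Cmd.run_nop, Expr.val_const,
      Expr.val_reg, h14, ← hs₁, Expr.val_minus, Store.setReg_reg, Nat.reduceEqDiff, ↓reduceIte,
      a13, ← hs₂, ← hs₃, ← hs₄]
    split_ifs <;> rfl
  have hfin : s₃.reg 15 ≠ 0 → (∃ u : Fin n, ((farthest 10 11).run L s₄).reg 11 = u ∧
      ¬ G.EccLe u (2 * r - 2)) ∧ Cmd.Linear L (farthest 10 11) s₄ := by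
    intro h
    obtain ⟨c', hc', hcK, hcr', hext⟩ := g3 h
    obtain ⟨D, g, hD, hg, hb⟩ := hext h2
    obtain ⟨⟨u, hu, hmax', -⟩, t3⟩ := farthest_spec hL hc (x := 10) (y := 11) (by decide)
      (s := s₄) (u := c') (by simpa [hs₄] using hc') (by simpa [hs₄] using b0)
    exact ⟨⟨u, hu, hh.not_eccLe_of_extremal hc h4 h2 hcr (by omega) rfl hD hg hcK hcr' hb
      (hdist hcr' hmax')⟩, t3⟩
  have hlin : Cmd.Linear L remote s := by
    refine (Cmd.linear_of_flat rfl _).seq (Cmd.Linear.seq ?_ ((Cmd.linear_of_flat rfl _).seq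
      ((Cmd.linear_of_flat rfl _).seq (Cmd.Linear.seq ?_ (Cmd.Linear.seq (Cmd.Linear.ite
        (fun h => (Cmd.linear_of_flat rfl _).seq ?_) (fun _ => Cmd.linear_of_flat rfl _))
        (Cmd.linear_of_flat rfl _))))))
    all_goals simp only [Cmd.run_set, Expr.val_const, Expr.val_reg, h14, ← hs₁, Expr.val_minus,
      Store.setReg_reg, Nat.reduceEqDiff, ↓reduceIte, a13, ← hs₂, ← hs₃, ← hs₄] at *
    · exact t1
    · exact t2
    · exact (hfin h).2
  refine ⟨?_, hlin⟩
  rw [hrun]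
  split_ifs with h
  -- A smaller eccentricity of `u₀` would, by `IsHelly.exists_center_near` with `k = r - 1`, put a
  -- central vertex into the slice that was found to contain none.
  · refine ⟨u₀, by simp [b11], fun hcon => ?_⟩
    obtain ⟨x, hx, hcx, hux⟩ := hh.exists_center_near hc (u := u₀) (r := r) (k := r - 1)
      (fun z => (hcon z).trans (by omega)) (by omega) hcr
    exact g2 h x ⟨hcx, hux⟩ hx
  · obtain ⟨⟨u, hu, hu'⟩, -⟩ := hfin h
    exact ⟨u, by simp [hu], hu'⟩

/-- Compute the radius and the center of a graph of radius at least two. -/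
def largeCenter : Cmd :=
  radius ;; remote ;; sweep ;; sliceAt ;; search 14 ;;
  .forV 3 (.put 12 (.reg 3) (.bin .less (.cell 10 (.reg 3)) (.const 3))) ;; gateFilter ;;
  .forV 3 (.put 23 (.reg 3) (.cell 22 (.reg 3))) ;;
  .forV 3 (.put 12 (.reg 3) (.cell 13 (.reg 3))) ;; gateFilter ;;
  .forV 3 (.put 12 (.reg 3) (Expr.and (.bin .less (.cell 10 (.reg 3)) (.const 3))
    (Expr.and (.cell 22 (.reg 3)) (.cell 23 (.reg 3)))))

/-- Carries out `IsHelly.eccLe_iff_passesFilter` with `k` the eccentricity of `u` minus `r`. The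
filter for `A` runs last, so that array `10` still describes the distance to `A` in the final test.
-/
theorem largeCenter_spec {G : SimpleGraph (Fin n)} {L : Fin n → List (Fin n)}
    (hL : IsAdjLists G L) (hh : G.IsHelly) (hc : G.Connected) (h4 : G.IsC4Free) {r : ℕ}
    (hr : G.IsRad r) (h2 : 2 ≤ r) {s : Store} (h0 : s.reg 0 = n) :
    (largeCenter.run L s).reg 13 = r ∧
      (∀ v : Fin n, (largeCenter.run L s).arr 12 v ≠ 0 ↔ G.EccLe v r) ∧
      Cmd.Linear L largeCenter s := by
  obtain ⟨a13, ⟨c, a14, hcr⟩, t1⟩ := radius_spec hL hh hc h4 hr h2 h0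
  set s₁ := radius.run L s with hs₁
  have a0 : s₁.reg 0 = n := (Cmd.run_reg L _ _ (by decide)).trans h0
  obtain ⟨⟨u, b10, hu⟩, t2⟩ := remote_spec hL hh hc h4 hr h2 a0 a13 a14 hcr
  set s₂ := remote.run L s₁ with hs₂
  have b0 : s₂.reg 0 = n := (Cmd.run_reg L _ _ (by decide)).trans a0
  have b13 : s₂.reg 13 = r := (Cmd.run_reg L _ _ (by decide)).trans a13
  obtain ⟨⟨w, c11, hmax, c12⟩, t3⟩ := sweep_spec hL hc b10 b0
  set s₃ := sweep.run L s₂ with hs₃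
  have c0 : s₃.reg 0 = n := (Cmd.run_reg L _ _ (by decide)).trans b0
  have c10 : s₃.reg 10 = u := (Cmd.run_reg L _ _ (by decide)).trans b10
  have c13 : s₃.reg 13 = r := (Cmd.run_reg L _ _ (by decide)).trans b13
  have hlt : 2 * r - 2 < G.dist u w := by
    by_contra hcon
    exact hu (fun z => (hmax z).trans (not_lt.1 hcon))
  have hue : G.EccLe u (r + (G.dist u w - r)) := fun z => (hmax z).trans (by omega)
  have hk : r ≤ G.dist u w - r + 1 := by omega
  set A : Set (Fin n) := {a | G.EccLe a r ∧ G.dist u a ≤ G.dist u w - r} with hA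
  obtain ⟨g1, hA1, g2, g3, t4⟩ := sliceAt_spec hL hh hc h4 (by omega) c0 c10 c11 c12 hmax c13
    (by omega) hA
  set s₄ := sliceAt.run L s₃ with hs₄
  obtain ⟨c₀, d14, hc₀⟩ := g3 (fun h => g2 h c hcr)
  have d13 : s₄.reg 13 = r := (Cmd.run_reg L _ _ (by decide)).trans c13
  obtain ⟨⟨l, hl⟩, t5⟩ := search_spec hL hc (x := 14) (by decide) d14
  set s₅ := (search 14).run L s₄ with hs₅
  set s₆ := (Cmd.forV 3 (.put 12 (.reg 3)
    (.bin .less (.cell 10 (.reg 3)) (.const 3)))).run L s₅ with hs₆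
  set N : Set (Fin n) := {v | G.dist c₀ v ≤ 1} with hN
  have e12 : ∀ v : Fin n, s₆.arr 12 v = if G.dist c₀ v ≤ 1 then 1 else 0 :=
    forV_put_spec L 12 _ s₅ _ (fun s' v ha hr => by
      have hd := hl.dist v
      simp only [Expr.val_less, Expr.val_cell, Expr.val_reg, Store.setReg_reg, ↓reduceIte,
        Store.setReg_arr, ha 10 (by decide), hd, Expr.val_const]
      congr 1
      rw [eq_iff_iff]
      omega)
  have e13 : s₆.reg 13 = r :=
    (Cmd.run_reg L _ _ (by decide)).trans ((Cmd.run_reg L _ _ (by decide)).trans d13)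
  have f13 : s₆.arr 13 = s₄.arr 13 :=
    (Cmd.run_arr L _ _ (by decide)).trans (Cmd.run_arr L _ _ (by decide))
  obtain ⟨⟨DN, gN, sN, hDN, hgN, hsN, -, h22⟩, t6⟩ := gateFilter_spec hL hh hc (S := N)
    ⟨c₀, by simp [hN]⟩ (fun p hp q hq => by
      have h1 := hc.dist_triangle (u := p) (v := c₀) (w := q)
      have h2 := G.dist_comm (u := p) (v := c₀)
      simp only [hN, Set.mem_ofPred_eq] at hp hq
      omega) h2 (s := s₆) (fun v => by simp [e12, hN]) e13
  set s₇ := gateFilter.run L s₆ with hs₇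
  -- The result of the first filter is saved before the second overwrites array `22`; the marks of
  -- `A` have survived in array `13`.
  set s₈ := (Cmd.forV 3 (.put 23 (.reg 3) (.cell 22 (.reg 3)))).run L s₇ with hs₈
  have h23 : ∀ v : Fin n, s₈.arr 23 v = s₇.arr 22 v :=
    forV_put_spec L 23 _ s₇ _ (fun s' v ha hr => by simp [ha 22 (by decide)])
  set s₉ := (Cmd.forV 3 (.put 12 (.reg 3) (.cell 13 (.reg 3)))).run L s₈ with hs₉
  have i12 : ∀ v : Fin n, s₉.arr 12 v = s₄.arr 13 v :=
    forV_put_spec L 12 _ s₈ _ (fun s' v ha hr => by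
      have : s₈.arr 13 = s₄.arr 13 :=
        (Cmd.run_arr L _ _ (by decide)).trans ((Cmd.run_arr L _ _ (by decide)).trans f13)
      simp [ha 13 (by decide), this])
  have i13 : s₉.reg 13 = r := (Cmd.run_reg L _ _ (by decide)).trans
    ((Cmd.run_reg L _ _ (by decide)).trans ((Cmd.run_reg L _ _ (by decide)).trans e13))
  obtain ⟨⟨DA, gA, sA, hDA, hgA, hsA, j10, j22⟩, t7⟩ := gateFilter_spec hL hh hc (S := A)
    ⟨c₀, hc₀⟩ (fun p hp q hq => (hA1 p hp q hq).trans (by omega)) h2 (s := s₉)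
    (fun v => by rw [i12]; exact g1 v) i13
  set s' := gateFilter.run L s₉ with hs'
  have j23 : ∀ v : Fin n, s'.arr 23 v = s₇.arr 22 v := fun v => by
    rw [← h23, hs', Cmd.run_arr L _ _ (by decide), hs₉, Cmd.run_arr L _ _ (by decide)]
  have hfin : ∀ v : Fin n, (largeCenter.run L s).arr 12 v =
      if DA v ≤ 1 ∧ s'.arr 22 v ≠ 0 ∧ s₇.arr 22 v ≠ 0 then 1 else 0 :=
    forV_put_spec L 12 _ s' _ (fun s'' v ha hr => by
      have hd := j10 v
      have he := j23 v
      simp only [Expr.val_and, Expr.val_less, Expr.val_cell, Expr.val_reg, Store.setReg_reg,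
        ↓reduceIte, Store.setReg_arr, ha 10 (by decide), ha 22 (by decide), ha 23 (by decide), hd,
        he, Expr.val_const]
      congr 1
      rw [eq_iff_iff]
      simp)
  refine ⟨?_, fun v => ?_, t1.seq (t2.seq (t3.seq (t4.seq (t5.seq ((linear_forV_put _).seq
    (t6.seq ((linear_forV_put _).seq ((linear_forV_put _).seq (t7.seq
      (linear_forV_put _))))))))))⟩
  · refine (Cmd.run_reg L (Cmd.forV 3 (.put 12 (.reg 3)
      (Expr.and (.bin .less (.cell 10 (.reg 3)) (.const 3))
        (Expr.and (.cell 22 (.reg 3)) (.cell 23 (.reg 3)))))) s' (by decide)).trans ?_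
    exact (Cmd.run_reg L _ _ (by decide)).trans i13
  · rw [hh.eccLe_iff_passesFilter hc h2 hue hk hA hA1 hc₀ hN hDA hDN hgA hgN hsA hsN v,
      hfin, ← h22, ← j22]
    simp

/-- Compute the radius, in register `13`, and mark the center in array `12`. -/
def center : Cmd :=
  .forV 3 (.put 13 (.reg 3) (.const 1)) ;; .forV 3 (.put 16 (.reg 3) (.const 1)) ;;
  countMarked ;; argmax ;;
  .ite (.bin .equal (.reg 15) (.reg 0))
    (.set 13 (.bin .less (.const 1) (.reg 0)) ;;
      .forV 3 (.put 12 (.reg 3) (.bin .equal (Expr.inc (.cell 17 (.reg 3))) (.reg 0))))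
    largeCenter

theorem ncard_adj_add_one_eq_iff {G : SimpleGraph (Fin n)} (hc : G.Connected) {v : Fin n} :
    {y | G.Adj v y}.ncard + 1 = n ↔ G.EccLe v 1 := by
  have h1 : (insert v {y | G.Adj v y}).ncard = {y | G.Adj v y}.ncard + 1 :=
    Set.ncard_insert_of_notMem (by simp)
  rw [← h1]
  constructor
  · intro h z
    have huniv : insert v {y | G.Adj v y} = Set.univ :=
      Set.eq_of_subset_of_ncard_le (Set.subset_univ _) (by
        rw [h, Set.ncard_univ, Nat.card_eq_fintype_card, Fintype.card_fin])
    have hz : z ∈ insert v {y | G.Adj v y} := huniv ▸ Set.mem_univ z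
    rw [hc.dist_le_one_iff]
    exact hz.imp Eq.symm id
  · intro h
    have huniv : insert v {y | G.Adj v y} = Set.univ := by
      rw [Set.eq_univ_iff_forall]
      intro z
      exact (hc.dist_le_one_iff.1 (h z)).imp Eq.symm id
    rw [huniv, Set.ncard_univ, Nat.card_eq_fintype_card, Fintype.card_fin]

/-- The filters use gates at level `r - 1`, which must be positive, so radius at most one is treated
separately. It occurs exactly if the largest degree plus one equals `n`, and then the center is read
off the degrees. -/
theorem center_spec {G : SimpleGraph (Fin n)} {L : Fin n → List (Fin n)}
    (hL : IsAdjLists G L) (hh : G.IsHelly) (hc : G.Connected) (h4 : G.IsC4Free) {r : ℕ}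
    (hr : G.IsRad r) {s : Store} (h0 : s.reg 0 = n) :
    (center.run L s).reg 13 = r ∧
      (∀ v : Fin n, (center.run L s).arr 12 v ≠ 0 ↔ G.EccLe v r) ∧
      Cmd.Linear L center s := by
  have hn : 0 < n := Fin.pos_iff_nonempty.2 hc.nonempty
  set s₁ := (Cmd.forV 3 (.put 13 (.reg 3) (.const 1))).run L s with hs₁
  have a13 : ∀ v : Fin n, s₁.arr 13 v = 1 := forV_put_spec L 13 _ s (fun _ => 1) (by simp)
  set s₂ := (Cmd.forV 3 (.put 16 (.reg 3) (.const 1))).run L s₁ with hs₂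
  have b16 : ∀ v : Fin n, s₂.arr 16 v = 1 := forV_put_spec L 16 _ s₁ (fun _ => 1) (by simp)
  obtain ⟨g1, -, t1⟩ := countMarked_spec hL (s := s₂) (H := Set.univ) (by simp [b16])
  set s₃ := countMarked.run L s₂ with hs₃
  have c13 : ∀ v : Fin n, s₃.arr 13 v = 1 := fun v => by
    rw [hs₃, Cmd.run_arr L _ _ (by decide), hs₂, Cmd.run_arr L _ _ (by decide), a13]
  obtain ⟨g2, t2⟩ := argmax_spec L (P := Set.univ) (s := s₃) (by simp [c13]) g1
  set s₄ := argmax.run L s₃ with hs₄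
  have d17 : s₄.arr 17 = s₃.arr 17 := Cmd.run_arr L _ _ (by decide)
  have d0 : s₄.reg 0 = n := by
    rw [hs₄, Cmd.run_reg L _ _ (by decide), hs₃, Cmd.run_reg L _ _ (by decide), hs₂,
      Cmd.run_reg L _ _ (by decide), hs₁, Cmd.run_reg L _ _ (by decide), h0]
  simp only [Set.mem_univ, true_and] at g1 g2
  obtain ⟨c, hcmax, d15⟩ : ∃ c : Fin n, (∀ b, {y | G.Adj b y}.ncard ≤ {y | G.Adj c y}.ncard) ∧
      s₄.reg 15 = {y | G.Adj c y}.ncard + 1 := by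
    rcases g2 with ⟨-, h⟩ | ⟨c, -, h1, h2⟩
    · have := Set.mem_univ (⟨0, hn⟩ : Fin n)
      rw [h] at this
      exact this.elim
    · exact ⟨c, fun b => h2 b trivial, h1⟩
  have hcond : s₄.reg 15 = s₄.reg 0 ↔ r ≤ 1 := by
    rw [d15, d0, ncard_adj_add_one_eq_iff hc]
    constructor
    · exact hr.le c 1
    · intro h
      obtain ⟨v, hv⟩ := hr.exists_eccLe
      have h1 := (ncard_adj_add_one_eq_iff hc).2 (fun z => (hv z).trans h)
      have h2 := hcmax v
      rw [← ncard_adj_add_one_eq_iff hc]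
      have h3 : (insert c {y | G.Adj c y}).ncard = {y | G.Adj c y}.ncard + 1 :=
        Set.ncard_insert_of_notMem (by simp)
      have h4 := Set.ncard_le_ncard (Set.subset_univ (insert c {y | G.Adj c y}))
      rw [Set.ncard_univ, Nat.card_eq_fintype_card, Fintype.card_fin] at h4
      omega
  set d := Cmd.forV 3 (.put 12 (.reg 3)
    (.bin .equal (Expr.inc (.cell 17 (.reg 3))) (.reg 0))) with hd
  set s₅ := s₄.setReg 13 (if 1 < n then 1 else 0) with hs₅
  have hrun : center.run L s = if s₄.reg 15 = s₄.reg 0 then d.run L s₅ else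
      largeCenter.run L s₄ := by
    simp only [center, Cmd.run_seq, Cmd.run_set, Cmd.run_ite, Expr.val_equal, Expr.val_less,
      Expr.val_const, Expr.val_reg, ← hs₁, ← hs₂, ← hs₃, ← hs₄, d0, ← hs₅, ← hd]
    split_ifs <;> simp_all
  have hlin : Cmd.Linear L center s := by
    refine (linear_forV_put _).seq ((linear_forV_put _).seq (t1.seq (t2.seq (Cmd.Linear.ite
      (fun _ => (Cmd.linear_of_flat rfl _).seq (linear_forV_put _)) (fun h => ?_)))))
    have : ¬ r ≤ 1 := by
      rw [← hcond]
      intro h'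
      have h1 : (Expr.bin .equal (.reg 15) (.reg 0)).val s₄ = 0 := h
      simp [h'] at h1
    exact (largeCenter_spec hL hh hc h4 hr (by omega) d0).2.2
  rw [hrun]
  split_ifs with h
  · have hr1 := hcond.1 h
    -- Once the radius is at most one, only the graph with a single vertex has radius `0`.
    have hrn : r = if 1 < n then 1 else 0 := by
      split_ifs with h1
      · by_contra hne
        obtain ⟨v, hv⟩ := hr.exists_eccLe
        have h2 : ∀ z, v = z := fun z => by
          have h3 := hv z
          rw [show r = 0 by omega, Nat.le_zero] at h3
          exact (hc v z).dist_eq_zero_iff.1 h3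
        have h3 := (h2 ⟨0, hn⟩).symm.trans (h2 ⟨1, h1⟩)
        simp at h3
      · refine Nat.le_zero.1 (hr.le ⟨0, hn⟩ 0 fun z => ?_)
        have : z = ⟨0, hn⟩ := Fin.ext (by have := z.isLt; simp; omega)
        simp [this]
    have h12 : ∀ v : Fin n, (d.run L s₅).arr 12 v =
        if {y | G.Adj v y}.ncard + 1 = n then 1 else 0 :=
      forV_put_spec L 12 _ s₅ _ (fun s' v ha hr => by
        have hv := g1 v
        simp [ha 17 (by decide), hs₅, d17, hv, hr 0 (by decide), d0])
    refine ⟨?_, fun v => ?_, hlin⟩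
    · rw [Cmd.run_reg L _ _ (by decide), hrn]
      simp [hs₅]
    · have hv : ({y | G.Adj v y}.ncard + 1 = n) ↔ G.EccLe v r := by
        rw [ncard_adj_add_one_eq_iff hc]
        -- The degree test describes eccentricity at most `1`. For radius `0` there is only one
        -- vertex, and both conditions hold trivially.
        rcases Nat.lt_or_eq_of_le hr1 with h1 | h1
        · have hn1 : ¬ 1 < n := by
            intro h'
            rw [if_pos h'] at hrn
            omega
          have hz : ∀ z, z = v := fun z => Fin.ext (by have := z.isLt; have := v.isLt; omega)
          exact ⟨fun _ z => by simp [hz z], fun _ z => by simp [hz z]⟩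
        · rw [h1]
      rw [h12, ← hv]
      simp
  · have := largeCenter_spec hL hh hc h4 hr (by rw [hcond] at h; omega) d0
    exact ⟨this.1, this.2.1, hlin⟩

end WordRAM

/-! ### Comparison with the eccentricity and the center in extended natural numbers -/

namespace SimpleGraph

variable {V : Type*} {G : SimpleGraph V}

theorem Connected.eccent_le_iff_eccLe (hc : G.Connected) {v : V} {k : ℕ} :
    G.eccent v ≤ k ↔ G.EccLe v k := by
  rw [eccent_le_iff]
  refine forall_congr' fun z => ?_
  rw [← (hc v z).coe_dist_eq_edist, Nat.cast_le]

/-- The number `r` is attained and bounds every eccentricity from below, so it is the infimum that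
defines `G.radius`. -/
theorem IsRad.mem_center_iff [Finite V] {r : ℕ} (hr : G.IsRad r) (hc : G.Connected) {v : V} :
    v ∈ G.center ↔ G.EccLe v r := by
  have hle : ∀ u, (r : ℕ∞) ≤ G.eccent u := fun u => by
    have : Nonempty V := ⟨u⟩
    obtain ⟨w, hw⟩ := G.exists_farthest u
    refine (Nat.cast_le.2 (hr.le u _ hw)).trans ?_
    rw [(hc u w).coe_dist_eq_edist]
    exact edist_le_eccent
  have hrad : G.radius = r := by
    obtain ⟨c, hcr⟩ := hr.exists_eccLe
    exact le_antisymm ((radius_le_eccent).trans (hc.eccent_le_iff_eccLe.2 hcr))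
      (le_iInf hle)
  rw [center, Set.mem_ofPred_eq, hrad, ← hc.eccent_le_iff_eccLe]
  exact ⟨fun h => h.le, fun h => le_antisymm h (hle v)⟩

end SimpleGraph

/-! ### The two algorithms -/

namespace WordRAM

variable {n : ℕ}

/-- Compute the center. -/
def centerIndicator : Cmd :=
  center ;; .forV 3 (.put 2 (.reg 3) (.bin .less (.const 0) (.cell 12 (.reg 3))))

/-- Compute the eccentricities. -/
def eccentricities : Cmd :=
  center ;; .set 1 (Expr.inc (.reg 13)) ;; bfs ;;
  .forV 3 (.put 2 (.reg 3) (.bin .minus (.cell 10 (.reg 3)) (.const 1)))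

theorem centerIndicator_spec {G : SimpleGraph (Fin n)} {L : Fin n → List (Fin n)}
    (hL : IsAdjLists G L) (hh : G.IsHelly) (hc : G.Connected) (h4 : G.IsC4Free) {s : Store}
    (h0 : s.reg 0 = n) : Cmd.Linear L centerIndicator s ∧
      ∀ v : Fin n, ((centerIndicator.run L s).arr 2 v : ℕ∞) = G.center.indicator 1 v := by
  have := hc.nonempty
  obtain ⟨r, hr⟩ := G.exists_isRad
  obtain ⟨-, h2, h3⟩ := center_spec hL hh hc h4 hr h0
  refine ⟨h3.seq (linear_forV_put _), fun v => ?_⟩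
  have h5 : ∀ v : Fin n, (centerIndicator.run L s).arr 2 v =
      if 0 < (center.run L s).arr 12 v then 1 else 0 :=
    forV_put_spec L 2 _ (center.run L s) _ (fun s' v ha _ => by simp [ha 12 (by decide)])
  classical
  rw [h5, Set.indicator_apply]
  simp only [Nat.pos_iff_ne_zero, h2, hr.mem_center_iff hc]
  split_ifs <;> simp

/-- A search from the center with start value `r + 1` leaves `D v + r + 1` in array `10`, one more
than the eccentricity by `IsDistTo.eccLe_iff`. The shift keeps the start value nonzero even for `r =
0` and is subtracted at the end. -/
theorem eccentricities_spec {G : SimpleGraph (Fin n)} {L : Fin n → List (Fin n)}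
    (hL : IsAdjLists G L) (hh : G.IsHelly) (hc : G.Connected) (h4 : G.IsC4Free) {s : Store}
    (h0 : s.reg 0 = n) : Cmd.Linear L eccentricities s ∧
      ∀ v : Fin n, ((eccentricities.run L s).arr 2 v : ℕ∞) = G.eccent v := by
  have := hc.nonempty
  obtain ⟨r, hr⟩ := G.exists_isRad
  obtain ⟨h1, h2, h3⟩ := center_spec hL hh hc h4 hr h0
  set s₁ := center.run L s with hs₁
  obtain ⟨D, hD⟩ := G.exists_isDistTo (S := {c | G.EccLe c r}) hr.exists_eccLe
  obtain ⟨⟨l, hl⟩, h5⟩ := bfs_spec hL hc hD (s₁.setReg 1 (r + 1)) (by simpa using h2) (by simp)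
  rw [Store.setReg_reg, if_pos rfl] at hl
  set s₂ := bfs.run L (s₁.setReg 1 (r + 1)) with hs₂
  have e₁ : (Cmd.set 1 (Expr.inc (.reg 13))).run L s₁ = s₁.setReg 1 (r + 1) := by simp [h1]
  refine ⟨h3.seq ((Cmd.linear_of_flat rfl _).seq (Cmd.Linear.seq ?_ (linear_forV_put _))),
    fun v => ?_⟩
  · rw [← hs₁, e₁]
    exact h5
  · have h6 : ∀ v : Fin n, ((Cmd.forV 3 (.put 2 (.reg 3)
        (.bin .minus (.cell 10 (.reg 3)) (.const 1)))).run L s₂).arr 2 v = D v + r :=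
      forV_put_spec L 2 _ s₂ _ (fun s' v ha _ => by
        have := hl.dist v
        simp [ha 10 (by decide), this])
    have hrun : eccentricities.run L s = (Cmd.forV 3 (.put 2 (.reg 3)
        (.bin .minus (.cell 10 (.reg 3)) (.const 1)))).run L s₂ := by
      simp only [eccentricities, Cmd.run_seq, ← hs₁, e₁, ← hs₂]
    rw [hrun, h6]
    -- Both sides have the same finite upper bounds; this determines the extended natural number,
    -- with the value `⊤` treated separately.
    have key : ∀ k : ℕ, G.eccent v ≤ k ↔ ((D v + r : ℕ) : ℕ∞) ≤ k := fun k => by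
      rw [hc.eccent_le_iff_eccLe, hD.eccLe_iff hh hc hr, Nat.cast_le, Nat.add_comm]
    refine le_antisymm ?_ ((key _).2 le_rfl)
    rcases eq_or_ne (G.eccent v) ⊤ with h | h
    · rw [h]; exact le_top
    · lift G.eccent v to ℕ using h with m
      exact (key m).1 le_rfl

end WordRAM

theorem theorem3p12 :
    WordRAM.LinearTimeOn (fun _ G => G.Connected ∧ G.IsHelly ∧ G.IsC4Free)
      (fun _ G v => G.eccent v) ∧
    WordRAM.LinearTimeOn (fun _ G => G.Connected ∧ G.IsHelly ∧ G.IsC4Free)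
      (fun _ G v => G.center.indicator 1 v) := by
  constructor
  · refine WordRAM.linearTimeOn_of_cmd WordRAM.eccentricities (by decide) (by decide)
      (fun n G h => Fin.pos_iff_nonempty.2 h.1.nonempty) fun n G h L hL => ?_
    exact WordRAM.eccentricities_spec hL h.2.1 h.1 h.2.2 rfl
  · refine WordRAM.linearTimeOn_of_cmd WordRAM.centerIndicator (by decide) (by decide)
      (fun n G h => Fin.pos_iff_nonempty.2 h.1.nonempty) fun n G h L hL => ?_
    exact WordRAM.centerIndicator_spec hL h.2.1 h.1 h.2.2 rfl
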